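/- Let $(A,\rho,[\cdot,\cdot])$ be a Lie algebroid over a smooth (Hausdorff, second countable) manifold $M$, and let $1\le k\le \operatorname{rank}A$. **Notation.** *Differentials.* Extend the bracket to the Schouten bracket on $\Gamma(\wedge^\bullet A)$, with $[u,f]=\rho(u)f$, $[P,Q]=-(-1)^{(p-1)(q-1)}[Q,P]$ and $[P,Q\wedge R]=[P,Q]\wedge R+(-1)^{(p-1)q}Q\wedge[P,R]$, for $P,Q$ of degrees $p,q$. A *$k$-differential* is an $\mathbb R$-linear operator $\delta:\Gamma(\wedge^\bullet A)\to\Gamma(\wedge^{\bullet+k-1}A)$ such that, for $P$ of degree $p$, $$\delta(P\wedge Q)=\delta P\wedge Q+(-1)^{p(k-1)}P\wedge\delta Q,\qquad \delta[P,Q]=[\delta P,Q]+(-1)^{(p-1)(k-1)}[P,\delta Q].$$ $\mathcal R^k_{\mathrm{diff}}$ is the space of $k$-differentials modulo the operators $[\tau,\cdot]$, $\tau\in\Gamma(\wedge^kA)$. *Compatible tensors.* A *$\rho$-compatible $k$-tensor* is a section $\pi\in\Gamma(TM\otimes\wedge^{k-1}A)$ such that $\iota_{\rho^*\xi}\iota_\eta\pi=-\iota_{\rho^*\eta}\iota_\xi\pi$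 for all $\xi,\eta\in T^*M$ over the same point. Let $D_\rho$ be the derivation of $\wedge^\bullet(TM\oplus A)$ that extends $X+u\mapsto\rho(u)$; it maps $\wedge^kA$ to $TM\otimes\wedge^{k-1}A$, where $X\wedge P$ is identified with $X\otimes P$. $\mathcal R^k_\rho$ is the space of $\rho$-compatible $k$-tensors modulo those of the form $D_\rho\tau$, $\tau\in\Gamma(\wedge^kA)$. *Jets.* Let $\mathfrak JA$ be the first jet bundle of $A$ with its jet Lie algebroid structure, and let $\mathfrak h=\operatorname{Hom}(TM,A)\cong T^*M\otimes A\subset\mathfrak JA$ be the bundle of isotropy jet Lie algebras, with inclusion $i$. Here $j^1(fu)=f\,j^1u+df\otimes u$ for $u\in\Gamma(A)$, $f\in C^\infty(M)$, and the brackets are determined by $[j^1u,j^1v]=j^1[u,v]$, $[j^1u,K]=\mathcal L_uK$ and $[H,K]=K\rho H-H\rho K$ for $H,K\in\Gamma(\mathfrak h)$, where $(\mathcal L_uK)(X)=[u,K(X)]-K([\rho(u),X])$. The bundle $\wedge^kA$ is a module over both: $j^1u$ acts by $[u,\cdot]$, and $H\in\Gamma(\mathfrak h)$ acts by the derivation that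 extends $-H\circ\rho:A\to A$. For $L=\mathfrak JA$ or $L=\mathfrak h$, $H^1(L,\wedge^kA)$ is the space of $1$-cocycles (bundle maps $\chi:L\to\wedge^kA$ with $\chi([a,b])=a\cdot\chi(b)-b\cdot\chi(a)$ for $a,b\in\Gamma(L)$) modulo the coboundaries $a\mapsto a\cdot\tau$, $\tau\in\Gamma(\wedge^kA)$. Restriction to $\mathfrak h$ induces $i^*:H^1(\mathfrak JA,\wedge^kA)\to H^1(\mathfrak h,\wedge^kA)$. *Characteristic pairs.* For a $\rho$-compatible $k$-tensor $\pi$ let $\mu_\pi:\mathfrak h\to\wedge^kA$, $\mu_\pi(H)=(H\otimes\mathrm{id})\pi$, where $H\otimes\mathrm{id}$ maps $X\otimes P$ to $H(X)\wedge P$. A *$k$-characteristic pair* is a pair $(\chi,\pi)$ of a $1$-cocycle $\chi:\mathfrak JA\to\wedge^kA$ and a $\rho$-compatible $k$-tensor $\pi$ with $\chi|_{\mathfrak h}=\mu_\pi$. A $k$-differential $\delta$ corresponds to $(\chi,\pi)$, written $\delta=(\chi,\pi)$, if $\delta u=\chi(j^1u)$ for $u\in\Gamma(A)$ and $\delta f=(-1)^{k-1}\iota_{df}\pi$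 for $f\in C^\infty(M)$. **Theorem.** The relation $\delta=(\chi,\pi)$ is a one-to-one correspondence between $k$-differentials and $k$-characteristic pairs. For each $\rho$-compatible $k$-tensor $\pi$ the map $\mu_\pi$ is a $1$-cocycle. The assignments $$\mu:[\pi]\mapsto[\mu_\pi],\qquad \kappa:[\delta]\mapsto[\chi],\qquad i^!:[\delta]\mapsto[\pi]\qquad(\delta=(\chi,\pi))$$ are well-defined linear maps $\mu:\mathcal R^k_\rho\to H^1(\mathfrak h,\wedge^kA)$, $\kappa:\mathcal R^k_{\mathrm{diff}}\to H^1(\mathfrak JA,\wedge^kA)$, $i^!:\mathcal R^k_{\mathrm{diff}}\to\mathcal R^k_\rho$; the maps $\mu$ and $\kappa$ are injective, and $i^*\circ\kappa=\mu\circ i^!$. Moreover $$\beta:\mathcal R^k_{\mathrm{diff}}\to\{(x,y)\in H^1(\mathfrak JA,\wedge^kA)\times\mathcal R^k_\rho:\ i^*x=\mu(y)\},\qquad [\delta]\mapsto([\chi],[\pi])\quad(\delta=(\chi,\pi))$$ is a linear isomorphism onto the fibre product. -/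

import Mathlib

open Bundle Module
open scoped Manifold ContDiff Topology TensorProduct

set_option linter.unusedSectionVars false
set_option linter.unusedVariables false

namespace LieAlgd

noncomputable section

/-! ### Functions, sections and vector fields -/

section Sections

variable (E : Type*) [NormedAddCommGroup E] [NormedSpace ℝ E]
  (M : Type*) [TopologicalSpace M] [ChartedSpace E M]

/-- The ring `C^∞(M)`. -/
abbrev SmoothFn := ContMDiffMap 𝓘(ℝ, E) 𝓘(ℝ, ℝ) M ℝ ∞

/-- The space `𝔛(M)` of smooth vector fields. -/
abbrev VecField [IsManifold 𝓘(ℝ, E) ∞ M] :=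
  ContMDiffSection 𝓘(ℝ, E) E ∞ (fun x : M => TangentSpace 𝓘(ℝ, E) x)

variable {E M}

/-- The differential `d_x f`, a covector at `x`. -/
def dAt (f : SmoothFn E M) (x : M) : Dual ℝ (TangentSpace 𝓘(ℝ, E) x) :=
  (mfderiv 𝓘(ℝ, E) 𝓘(ℝ, ℝ) f x : E →L[ℝ] ℝ).toLinearMap

variable (E) (F : Type*) [NormedAddCommGroup F] [NormedSpace ℝ F]
  (V : M → Type*) [TopologicalSpace (TotalSpace F V)] [∀ x, TopologicalSpace (V x)]
  [∀ x, AddCommGroup (V x)] [∀ x, Module ℝ (V x)] [FiberBundle F V] [VectorBundle ℝ F V]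

/-- The space `Γ(A)` of smooth sections. -/
abbrev Sec := ContMDiffSection 𝓘(ℝ, E) F ∞ V

variable {E F V}

instance : SMul (SmoothFn E M) (Sec E F V) :=
  ⟨fun f s => ⟨fun x => f x • s x, f.contMDiff.smul_section s.contMDiff⟩⟩

@[simp] theorem smul_sec_apply (f : SmoothFn E M) (s : Sec E F V) (x : M) :
    (f • s) x = f x • s x := rfl

instance : Module (SmoothFn E M) (Sec E F V) where
  one_smul s := by ext x; simp
  mul_smul f g s := by ext x; simp [mul_smul]
  smul_zero f := by ext x; simp
  smul_add f s t := by ext x; simp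
  add_smul f g s := by ext x; simp [add_smul]
  zero_smul s := by ext x; simp

end Sections

/-! ### Multivector sections -/

section Ext

variable {E : Type*} [NormedAddCommGroup E] [NormedSpace ℝ E]
  {M : Type*} [TopologicalSpace M] [ChartedSpace E M]

/-- A map into a real vector space (finite-dimensional in practice) is smooth at `x` if all its
linear coordinates are. -/
def SmoothAt (E : Type*) [NormedAddCommGroup E] [NormedSpace ℝ E]
    {M : Type*} [TopologicalSpace M] [ChartedSpace E M]
    {W : Type*} [AddCommGroup W] [Module ℝ W] (G : M → W) (x : M) : Prop :=
  ∀ φ : Dual ℝ W, ContMDiffAt 𝓘(ℝ, E) 𝓘(ℝ, ℝ) ∞ (fun y => φ (G y)) x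

section SmoothAt

variable {W W' W'' : Type*} [AddCommGroup W] [Module ℝ W] [AddCommGroup W'] [Module ℝ W']
  [AddCommGroup W''] [Module ℝ W''] {x : M}

theorem SmoothAt.add {G G' : M → W} (h : SmoothAt E G x) (h' : SmoothAt E G' x) :
    SmoothAt E (fun y => G y + G' y) x := fun φ => by
  simpa using! (h φ).add (h' φ)

theorem SmoothAt.const (w : W) : SmoothAt E (fun _ : M => w) x := fun _ => contMDiffAt_const

theorem SmoothAt.linear {G : M → W} (h : SmoothAt E G x) (T : W →ₗ[ℝ] W') :
    SmoothAt E (fun y => T (G y)) x := fun φ => h (φ ∘ₗ T)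

theorem SmoothAt.sum {ι : Type*} {s : Finset ι} {G : ι → M → W}
    (h : ∀ i ∈ s, SmoothAt E (G i) x) : SmoothAt E (fun y => ∑ i ∈ s, G i y) x := fun φ => by
  simp only [map_sum]
  exact ContMDiffAt.sum fun i hi => h i hi φ

theorem SmoothAt.smul {f : M → ℝ} {G : M → W}
    (hf : ContMDiffAt 𝓘(ℝ, E) 𝓘(ℝ, ℝ) ∞ f x) (h : SmoothAt E G x) :
    SmoothAt E (fun y => f y • G y) x := fun φ => by
  simpa using! hf.mul (h φ)

theorem SmoothAt.congr {G G' : M → W} (h : SmoothAt E G x) (hG : ∀ᶠ y in 𝓝 x, G' y = G y) :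
    SmoothAt E G' x := fun φ => (h φ).congr_of_eventuallyEq (hG.mono fun y hy => by simp [hy])

theorem SmoothAt.bilin [FiniteDimensional ℝ W] {G : M → W} {G' : M → W'}
    (h : SmoothAt E G x) (h' : SmoothAt E G' x) (T : W →ₗ[ℝ] W' →ₗ[ℝ] W'') :
    SmoothAt E (fun y => T (G y) (G' y)) x := by
  let b := finBasis ℝ W
  have : ∀ y, T (G y) (G' y) = ∑ i, b.coord i (G y) • T (b i) (G' y) := fun y => by
    conv_lhs => rw [← b.sum_repr (G y)]
    simp only [map_sum, map_smul, LinearMap.sum_apply, LinearMap.smul_apply, Basis.coord_apply]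
  simp only [this]
  exact SmoothAt.sum fun i _ => SmoothAt.smul (h _) (h'.linear _)

theorem smoothAt_of_contMDiffAt {F : Type*} [NormedAddCommGroup F] [NormedSpace ℝ F]
    [FiniteDimensional ℝ F] {G : M → F} (h : ContMDiffAt 𝓘(ℝ, E) 𝓘(ℝ, F) ∞ G x) :
    SmoothAt E G x := fun φ =>
  (LinearMap.toContinuousLinearMap φ).contMDiff.contMDiffAt.comp x h

theorem contMDiffAt_of_smoothAt {F : Type*} [NormedAddCommGroup F] [NormedSpace ℝ F]
    [FiniteDimensional ℝ F] {G : M → F} (h : SmoothAt E G x) :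
    ContMDiffAt 𝓘(ℝ, E) 𝓘(ℝ, F) ∞ G x := by
  let b := finBasis ℝ F
  have : G = fun y => ∑ i, b.coord i (G y) • b i := by
    funext y
    exact (b.sum_repr (G y)).symm
  rw [this]
  exact ContMDiffAt.sum fun i _ => (h (b.coord i)).smul contMDiffAt_const

end SmoothAt

variable {F : Type*} [NormedAddCommGroup F] [NormedSpace ℝ F]
  {V : M → Type*} [TopologicalSpace (TotalSpace F V)] [∀ x, TopologicalSpace (V x)]
  [∀ x, AddCommGroup (V x)] [∀ x, Module ℝ (V x)] [FiberBundle F V] [VectorBundle ℝ F V]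

/-- Smoothness of a section `P` of the bundle of exterior algebras `∧^• A`: read in any local
trivialization of `A` (and the trivialization of `∧^• A` that it induces), the section is a smooth
map into the finite-dimensional space `∧^• F`. -/
def IsSmoothExt (E : Type*) [NormedAddCommGroup E] [NormedSpace ℝ E]
    {M : Type*} [TopologicalSpace M] [ChartedSpace E M]
    (F : Type*) [NormedAddCommGroup F] [NormedSpace ℝ F]
    {V : M → Type*} [TopologicalSpace (TotalSpace F V)] [∀ x, TopologicalSpace (V x)]
    [∀ x, AddCommGroup (V x)] [∀ x, Module ℝ (V x)] [FiberBundle F V] [VectorBundle ℝ F V]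
    (P : ∀ x, ExteriorAlgebra ℝ (V x)) : Prop :=
  ∀ (e : Trivialization F (π F V)) [MemTrivializationAtlas e], ∀ x ∈ e.baseSet,
    SmoothAt E (fun y => ExteriorAlgebra.map (e.linearMapAt ℝ y) (P y)) x

theorem contMDiffAt_sec_iff (e : Trivialization F (π F V)) [MemTrivializationAtlas e]
    [ContMDiffVectorBundle ∞ F V 𝓘(ℝ, E)]
    {s : ∀ x, V x} {x : M} (hx : x ∈ e.baseSet) :
    ContMDiffAt 𝓘(ℝ, E) (𝓘(ℝ, E).prod 𝓘(ℝ, F)) ∞ (fun y => TotalSpace.mk' F y (s y)) x ↔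
      ContMDiffAt 𝓘(ℝ, E) 𝓘(ℝ, F) ∞ (fun y => e.linearMapAt ℝ y (s y)) x := by
  rw [e.contMDiffAt_section_iff hx]
  refine Filter.EventuallyEq.contMDiffAt_iff ?_
  filter_upwards [e.open_baseSet.mem_nhds hx] with y hy
  rw [Trivialization.linearMapAt_apply, if_pos hy]

variable [FiniteDimensional ℝ F]

instance : FiniteDimensional ℝ (ExteriorAlgebra ℝ F) :=
  Module.Finite.of_basis (finBasis ℝ F).ExteriorAlgebra

/-- The algebra `Γ(∧^• A)` of smooth sections of the bundle of exterior algebras. -/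
@[ext] structure ExtSec (E : Type*) [NormedAddCommGroup E] [NormedSpace ℝ E]
    {M : Type*} [TopologicalSpace M] [ChartedSpace E M]
    (F : Type*) [NormedAddCommGroup F] [NormedSpace ℝ F]
    (V : M → Type*) [TopologicalSpace (TotalSpace F V)] [∀ x, TopologicalSpace (V x)]
    [∀ x, AddCommGroup (V x)] [∀ x, Module ℝ (V x)] [FiberBundle F V] [VectorBundle ℝ F V] where
  /-- The value at a point. -/
  val : ∀ x, ExteriorAlgebra ℝ (V x)
  smooth : IsSmoothExt E F val

theorem IsSmoothExt.add {P Q : ∀ x, ExteriorAlgebra ℝ (V x)} (h : IsSmoothExt E F P)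
    (h' : IsSmoothExt E F Q) : IsSmoothExt E F (P + Q) := fun e _ x hx => by
  simpa using! (h e x hx).add (h' e x hx)

theorem IsSmoothExt.mul {P Q : ∀ x, ExteriorAlgebra ℝ (V x)} (h : IsSmoothExt E F P)
    (h' : IsSmoothExt E F Q) : IsSmoothExt E F (P * Q) := fun e _ x hx => by
  simpa using! (h e x hx).bilin (h' e x hx) (LinearMap.mul ℝ (ExteriorAlgebra ℝ F))

theorem IsSmoothExt.const (r : ℝ) :
    IsSmoothExt E F (fun x => algebraMap ℝ (ExteriorAlgebra ℝ (V x)) r) := fun e _ x hx => by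
  simpa only [AlgHom.commutes] using
    SmoothAt.const (E := E) (x := x) (algebraMap ℝ (ExteriorAlgebra ℝ F) r)

theorem IsSmoothExt.smul {P : ∀ x, ExteriorAlgebra ℝ (V x)} (r : ℝ) (h : IsSmoothExt E F P) :
    IsSmoothExt E F (r • P) := by
  have : r • P = (fun x => algebraMap ℝ (ExteriorAlgebra ℝ (V x)) r) * P :=
    funext fun x => Algebra.smul_def r (P x)
  rw [this]
  exact (IsSmoothExt.const r).mul h

variable (E F V) in
/-- The smooth sections form a subalgebra of the algebra of all sections. -/
def extSections : Subalgebra ℝ (∀ x, ExteriorAlgebra ℝ (V x)) where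
  carrier := {P | IsSmoothExt E F P}
  mul_mem' ha hb := ha.mul hb
  add_mem' ha hb := ha.add hb
  algebraMap_mem' r := IsSmoothExt.const r

namespace ExtSec

instance : Zero (ExtSec E F V) := ⟨⟨0, (extSections E F V).zero_mem⟩⟩
instance : One (ExtSec E F V) := ⟨⟨1, (extSections E F V).one_mem⟩⟩
instance : Add (ExtSec E F V) := ⟨fun P Q => ⟨P.val + Q.val, P.smooth.add Q.smooth⟩⟩
instance : Mul (ExtSec E F V) := ⟨fun P Q => ⟨P.val * Q.val, P.smooth.mul Q.smooth⟩⟩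
instance : Neg (ExtSec E F V) := ⟨fun P => ⟨-P.val, (extSections E F V).neg_mem P.smooth⟩⟩
instance : Sub (ExtSec E F V) :=
  ⟨fun P Q => ⟨P.val - Q.val, (extSections E F V).sub_mem P.smooth Q.smooth⟩⟩
instance : SMul ℝ (ExtSec E F V) := ⟨fun r P => ⟨r • P.val, P.smooth.smul r⟩⟩
instance : SMul ℕ (ExtSec E F V) :=
  ⟨fun n P => ⟨n • P.val, (extSections E F V).nsmul_mem P.smooth n⟩⟩
instance : SMul ℤ (ExtSec E F V) :=
  ⟨fun n P => ⟨n • P.val, (extSections E F V).zsmul_mem P.smooth n⟩⟩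
instance : Pow (ExtSec E F V) ℕ :=
  ⟨fun P n => ⟨P.val ^ n, (extSections E F V).pow_mem P.smooth n⟩⟩
instance : NatCast (ExtSec E F V) := ⟨fun n => ⟨n, (extSections E F V).natCast_mem n⟩⟩
instance : IntCast (ExtSec E F V) := ⟨fun n => ⟨n, (extSections E F V).intCast_mem n⟩⟩

theorem val_injective : Function.Injective (val : ExtSec E F V → _) := fun _ _ => ExtSec.ext

instance : Ring (ExtSec E F V) :=
  val_injective.ring val rfl rfl (fun _ _ => rfl) (fun _ _ => rfl) (fun _ => rfl) (fun _ _ => rfl)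
    (fun _ _ => rfl) (fun _ _ => rfl) (fun _ _ => rfl) (fun _ => rfl) (fun _ => rfl)

@[simp] theorem zero_val (x : M) : (0 : ExtSec E F V).val x = 0 := rfl
@[simp] theorem one_val (x : M) : (1 : ExtSec E F V).val x = 1 := rfl
@[simp] theorem add_val (P Q : ExtSec E F V) (x : M) : (P + Q).val x = P.val x + Q.val x := rfl
@[simp] theorem sub_val (P Q : ExtSec E F V) (x : M) : (P - Q).val x = P.val x - Q.val x := rfl
@[simp] theorem neg_val (P : ExtSec E F V) (x : M) : (-P).val x = -P.val x := rfl
@[simp] theorem mul_val (P Q : ExtSec E F V) (x : M) : (P * Q).val x = P.val x * Q.val x := rfl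
@[simp] theorem rsmul_val (r : ℝ) (P : ExtSec E F V) (x : M) : (r • P).val x = r • P.val x := rfl

theorem val_ext {P Q : ExtSec E F V} (h : ∀ x, P.val x = Q.val x) : P = Q :=
  ExtSec.ext (funext h)

instance : Module ℝ (ExtSec E F V) where
  one_smul P := val_ext fun x => one_smul ℝ _
  mul_smul r r' P := val_ext fun x => mul_smul r r' (P.val x)
  smul_zero r := val_ext fun x => smul_zero r
  smul_add r P Q := val_ext fun x => smul_add r (P.val x) (Q.val x)
  add_smul r r' P := val_ext fun x => add_smul r r' (P.val x)
  zero_smul P := val_ext fun x => zero_smul ℝ (P.val x)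

instance : Algebra ℝ (ExtSec E F V) :=
  Algebra.ofModule (fun r P Q => val_ext fun x => smul_mul_assoc r (P.val x) (Q.val x))
    (fun r P Q => val_ext fun x => mul_smul_comm r (P.val x) (Q.val x))

end ExtSec

variable [ContMDiffVectorBundle ∞ F V 𝓘(ℝ, E)]

/-- A function as a section of degree `0`. -/
def ofFn (f : SmoothFn E M) : ExtSec E F V :=
  ⟨fun x => algebraMap ℝ _ (f x), fun e _ x hx => by
    have : SmoothAt E (fun y => f y • (1 : ExteriorAlgebra ℝ F)) x :=
      SmoothAt.smul f.contMDiff.contMDiffAt (SmoothAt.const 1)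
    simpa [Algebra.algebraMap_eq_smul_one] using this⟩

/-- A section of `A` as a section of degree `1`. -/
def ofSec (u : Sec E F V) : ExtSec E F V :=
  ⟨fun x => ExteriorAlgebra.ι ℝ (u x), fun e _ x hx => by
    have h := smoothAt_of_contMDiffAt ((contMDiffAt_sec_iff e hx).1 u.contMDiff.contMDiffAt)
    simpa using h.linear (ExteriorAlgebra.ι ℝ)⟩

end Ext

/-! ### Multivector sections as an algebra over the functions -/

section ExtAlg

variable {E : Type*} [NormedAddCommGroup E] [NormedSpace ℝ E]
  {M : Type*} [TopologicalSpace M] [ChartedSpace E M]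
  {F : Type*} [NormedAddCommGroup F] [NormedSpace ℝ F] [FiniteDimensional ℝ F]
  {V : M → Type*} [TopologicalSpace (TotalSpace F V)] [∀ x, TopologicalSpace (V x)]
  [∀ x, AddCommGroup (V x)] [∀ x, Module ℝ (V x)] [FiberBundle F V] [VectorBundle ℝ F V]

variable [ContMDiffVectorBundle ∞ F V 𝓘(ℝ, E)]

instance : Algebra (SmoothFn E M) (ExtSec E F V) :=
  RingHom.toAlgebra'
    { toFun := ofFn
      map_one' := ExtSec.val_ext (fun x => by simp [ofFn])
      map_mul' := fun f g => ExtSec.val_ext (fun x => by simp [ofFn])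
      map_zero' := ExtSec.val_ext (fun x => by simp [ofFn])
      map_add' := fun f g => ExtSec.val_ext (fun x => by simp [ofFn]) }
    fun f P => ExtSec.val_ext (fun x => Algebra.commutes (f x) (P.1 x))

@[simp] theorem smul_ext_apply (f : SmoothFn E M) (P : ExtSec E F V) (x : M) :
    (f • P).1 x = f x • P.1 x := by
  rw [Algebra.smul_def, Algebra.smul_def]; rfl

instance : IsScalarTower ℝ (SmoothFn E M) (ExtSec E F V) :=
  ⟨fun r f P => ExtSec.val_ext (fun x => by
    rw [smul_ext_apply]; simp [mul_smul])⟩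

instance : IsScalarTower ℝ (SmoothFn E M) (Sec E F V) :=
  ⟨fun r f s => by ext x; simp [mul_smul]⟩

variable (E F V) in
/-- The `C^∞(M)`-module `Γ(∧^k A)`. -/
def extDeg (k : ℕ) : Submodule (SmoothFn E M) (ExtSec E F V) where
  carrier := {P | ∀ x, P.1 x ∈ (⋀[ℝ]^k (V x) : Submodule ℝ (ExteriorAlgebra ℝ (V x)))}
  add_mem' {P Q} hP hQ x := Submodule.add_mem _ (hP x) (hQ x)
  zero_mem' x := Submodule.zero_mem _
  smul_mem' f P hP x := by
    rw [smul_ext_apply]; exact Submodule.smul_mem _ _ (hP x)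

end ExtAlg

section HomSec

variable {E : Type*} [NormedAddCommGroup E] [NormedSpace ℝ E]
  {M : Type*} [TopologicalSpace M] [ChartedSpace E M]
  {F : Type*} [NormedAddCommGroup F] [NormedSpace ℝ F]
  {V : M → Type*} [TopologicalSpace (TotalSpace F V)] [∀ x, TopologicalSpace (V x)]
  [∀ x, AddCommGroup (V x)] [∀ x, Module ℝ (V x)] [FiberBundle F V] [VectorBundle ℝ F V]
  {F' : Type*} [NormedAddCommGroup F'] [NormedSpace ℝ F']
  {V' : M → Type*} [TopologicalSpace (TotalSpace F' V')] [∀ x, TopologicalSpace (V' x)]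
  [∀ x, AddCommGroup (V' x)] [∀ x, Module ℝ (V' x)] [FiberBundle F' V'] [VectorBundle ℝ F' V']

theorem sec_sum_apply {ι : Type*} (s : Finset ι) (t : ι → Sec E F V) (x : M) :
    (∑ i ∈ s, t i) x = ∑ i ∈ s, t i x := by
  classical
  induction s using Finset.induction_on with
  | empty => simp
  | insert a s ha ih => simp [Finset.sum_insert ha, ih]

variable (E F V F' V') in
/-- The space `Γ(Hom(A, A'))` of smooth vector bundle maps `A → A'` over the identity: families
of linear maps between the fibres that send smooth sections to smooth sections. -/
def homSections : Submodule ℝ (∀ x, V x →ₗ[ℝ] V' x) where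
  carrier := {T | ∀ s : Sec E F V, ContMDiff 𝓘(ℝ, E) (𝓘(ℝ, E).prod 𝓘(ℝ, F')) ∞
    (fun x => TotalSpace.mk' F' x (T x (s x)))}
  add_mem' {T T'} h h' s := (h s).add_section (h' s)
  zero_mem' s := (0 : Sec E F' V').contMDiff
  smul_mem' r T h s := (h s).const_smul_section (a := r)

variable (E F V F' V') in
/-- `Γ(Hom(A, A'))` as a type. -/
abbrev HomSec := ↥(homSections E F V F' V')

/-- A bundle map applied to a section. -/
def HomSec.app (T : HomSec E F V F' V') (s : Sec E F V) : Sec E F' V' :=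
  ⟨fun x => T.1 x (s x), T.2 s⟩

@[simp] theorem HomSec.app_apply (T : HomSec E F V F' V') (s : Sec E F V) (x : M) :
    T.app s x = T.1 x (s x) := rfl

theorem HomSec.app_add (T : HomSec E F V F' V') (s t : Sec E F V) :
    T.app (s + t) = T.app s + T.app t := by ext x; simp

theorem HomSec.app_smul (T : HomSec E F V F' V') (f : SmoothFn E M) (s : Sec E F V) :
    T.app (f • s) = f • T.app s := by ext x; simp

instance : SMul (SmoothFn E M) (HomSec E F V F' V') :=
  ⟨fun f T => ⟨fun x => f x • T.1 x, fun s => f.contMDiff.smul_section (T.2 s)⟩⟩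

@[simp] theorem smul_hom_val (f : SmoothFn E M) (T : HomSec E F V F' V') (x : M) :
    (f • T).1 x = f x • T.1 x := rfl

instance : Module (SmoothFn E M) (HomSec E F V F' V') where
  one_smul s := Subtype.ext (funext fun x => by simp)
  mul_smul f g s := Subtype.ext (funext fun x => by simp [mul_smul])
  smul_zero f := Subtype.ext (funext fun x => by simp)
  smul_add f s t := Subtype.ext (funext fun x => by simp)
  add_smul f g s := Subtype.ext (funext fun x => by simp [add_smul])
  zero_smul s := Subtype.ext (funext fun x => by simp)

instance : IsScalarTower ℝ (SmoothFn E M) (HomSec E F V F' V') :=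
  ⟨fun r f s => Subtype.ext (funext fun x => by simp [mul_smul])⟩

end HomSec

section Deriv

variable {E : Type*} [NormedAddCommGroup E] [NormedSpace ℝ E]
  {M : Type*} [TopologicalSpace M] [ChartedSpace E M] [IsManifold 𝓘(ℝ, E) ∞ M]

/-- The derivative `X(f) = df(X)` of a function along a vector field. -/
def lieD (X : VecField E M) (f : SmoothFn E M) : SmoothFn E M :=
  ⟨fun x => dAt f x (X x), by
    have h := (f.contMDiff.contMDiff_tangentMap (m := ∞) (by simp)).comp X.contMDiff
    exact (contMDiff_snd_tangentBundle_modelSpace ℝ 𝓘(ℝ, ℝ)).comp h⟩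

@[simp] theorem lieD_apply (X : VecField E M) (f : SmoothFn E M) (x : M) :
    lieD X f x = dAt f x (X x) := rfl

theorem dAt_mul (f g : SmoothFn E M) (x : M) :
    dAt (f * g) x = f x • dAt g x + g x • dAt f x := by
  have hf := f.contMDiff.mdifferentiableAt (x := x) (by simp)
  have hg := g.contMDiff.mdifferentiableAt (x := x) (by simp)
  ext v
  have := DFunLike.congr_fun (hf.hasMFDerivAt.mul hg.hasMFDerivAt).mfderiv v
  simpa [dAt] using! this

theorem dAt_add (f g : SmoothFn E M) (x : M) : dAt (f + g) x = dAt f x + dAt g x := by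
  have hf := f.contMDiff.mdifferentiableAt (x := x) (by simp)
  have hg := g.contMDiff.mdifferentiableAt (x := x) (by simp)
  ext v
  have := DFunLike.congr_fun (hf.hasMFDerivAt.add hg.hasMFDerivAt).mfderiv v
  simpa [dAt] using! this

theorem dAt_congr {f g : SmoothFn E M} {x : M} (h : ∀ᶠ y in 𝓝 x, f y = g y) :
    dAt f x = dAt g x := by
  unfold dAt
  rw [Filter.EventuallyEq.mfderiv_eq (f₁ := f) (f := g) h]

theorem dAt_one (x : M) : dAt (1 : SmoothFn E M) x = 0 := by
  ext v
  have : mfderiv 𝓘(ℝ, E) 𝓘(ℝ, ℝ) (fun _ : M => (1 : ℝ)) x = 0 := mfderiv_const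
  exact congrArg (fun l => l v) this

end Deriv

/-! ### Lie algebroids -/

section LieAlgebroid

variable (E : Type*) [NormedAddCommGroup E] [NormedSpace ℝ E]
  {M : Type*} [TopologicalSpace M] [ChartedSpace E M] [IsManifold 𝓘(ℝ, E) ∞ M]
  (F : Type*) [NormedAddCommGroup F] [NormedSpace ℝ F]
  (V : M → Type*) [TopologicalSpace (TotalSpace F V)] [∀ x, TopologicalSpace (V x)]
  [∀ x, AddCommGroup (V x)] [∀ x, Module ℝ (V x)] [FiberBundle F V] [VectorBundle ℝ F V]

/-- A Lie algebroid structure on the vector bundle `A` with fibres `V x`. -/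
structure LieAlgebroid where
  /-- The anchor `ρ : A → TM`. -/
  anchor : HomSec E F V E (fun x : M => TangentSpace 𝓘(ℝ, E) x)
  /-- The Lie bracket on `Γ(A)`. -/
  bracket : Sec E F V →ₗ[ℝ] Sec E F V →ₗ[ℝ] Sec E F V
  bracket_self : ∀ u, bracket u u = 0
  jacobi : ∀ u v w, bracket u (bracket v w) = bracket (bracket u v) w + bracket v (bracket u w)
  leibniz : ∀ (u : Sec E F V) (f : SmoothFn E M) (v : Sec E F V),
    bracket u (f • v) = f • bracket u v + lieD (anchor.app u) f • v
  anchor_bracket : ∀ (u v : Sec E F V) (x : M),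
    anchor.app (bracket u v) x = VectorField.mlieBracket 𝓘(ℝ, E) (anchor.app u) (anchor.app v) x

end LieAlgebroid

/-! ### Frames, and bundle maps from `C^∞(M)`-linear maps -/

section Frame

variable {E : Type*} [NormedAddCommGroup E] [NormedSpace ℝ E] [FiniteDimensional ℝ E]
  {M : Type*} [TopologicalSpace M] [ChartedSpace E M] [T2Space M] [IsManifold 𝓘(ℝ, E) ∞ M]
  {F : Type*} [NormedAddCommGroup F] [NormedSpace ℝ F] [FiniteDimensional ℝ F]
  {V : M → Type*} [TopologicalSpace (TotalSpace F V)] [∀ x, TopologicalSpace (V x)]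
  [∀ x, AddCommGroup (V x)] [∀ x, Module ℝ (V x)] [FiberBundle F V] [VectorBundle ℝ F V]
  [ContMDiffVectorBundle ∞ F V 𝓘(ℝ, E)]

theorem exists_frame (x₀ : M) (e : Trivialization F (π F V)) [MemTrivializationAtlas e]
    (hx₀ : x₀ ∈ e.baseSet) :
    ∃ (U : Set M) (χ : SmoothFn E M) (s : Fin (finrank ℝ F) → Sec E F V),
      IsOpen U ∧ x₀ ∈ U ∧ U ⊆ e.baseSet ∧ tsupport χ ⊆ e.baseSet ∧ (∀ y ∈ U, χ y = 1) ∧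
      (∀ y ∈ U, ∀ i, e.linearMapAt ℝ y (s i y) = finBasis ℝ F i) ∧
      ∀ t : Sec E F V, ∃ c : Fin (finrank ℝ F) → SmoothFn E M, χ • t = ∑ i, c i • s i := by
  obtain ⟨ψ, -, hψ⟩ := (SmoothBumpFunction.nhds_basis_tsupport (I := 𝓘(ℝ, E)) x₀).mem_iff.1
    (e.open_baseSet.mem_nhds hx₀)
  obtain ⟨U, hU, hUo, hxU⟩ := eventually_nhds_iff.1 (ψ.eventuallyEq_one)
  have hψc : ContMDiff 𝓘(ℝ, E) 𝓘(ℝ, ℝ) ∞ ψ := ψ.contMDiff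
  let ψ' : SmoothFn E M := ⟨ψ, hψc⟩
  let b := finBasis ℝ F
  have hs : ∀ i, ContMDiff 𝓘(ℝ, E) (𝓘(ℝ, E).prod 𝓘(ℝ, F)) ∞
      (fun y => TotalSpace.mk' F y (ψ y • e.symmₗ ℝ y (b i))) := fun i =>
    ContMDiffOn.smul_section_of_tsupport (s := fun y => e.symmₗ ℝ y (b i)) hψc.contMDiffOn
      e.open_baseSet hψ fun y hy => by
        refine ((contMDiffAt_sec_iff e hy).2 ?_).contMDiffWithinAt
        refine (contMDiffAt_const (c := b i)).congr_of_eventuallyEq ?_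
        filter_upwards [e.open_baseSet.mem_nhds hy] with z hz
        exact Trivialization.linearMapAt_symmₗ (R := ℝ) e hz (b i)
  have hc : ∀ (t : Sec E F V) i, ContMDiff 𝓘(ℝ, E) 𝓘(ℝ, ℝ) ∞
      (fun y => ψ y • b.coord i (e.linearMapAt ℝ y (t y))) := fun t i =>
    contMDiff_of_tsupport fun y hy => by
      have hy' := hψ (tsupport_smul_subset_left _ _ hy)
      exact hψc.contMDiffAt.smul (smoothAt_of_contMDiffAt
        ((contMDiffAt_sec_iff e hy').1 t.contMDiff.contMDiffAt) (b.coord i))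
  refine ⟨U ∩ e.baseSet, ψ' * ψ', fun i => ⟨_, hs i⟩, hUo.inter e.open_baseSet, ⟨hxU, hx₀⟩,
      Set.inter_subset_right, (tsupport_mul_subset_left (f := ψ) (g := ψ)).trans hψ, ?_, ?_, fun t => ⟨fun i => ⟨_, hc t i⟩, ?_⟩⟩
  · intro y hy
    have : ψ y = 1 := hU y hy.1
    change ψ y * ψ y = 1
    simp [this]
  · intro y hy i
    have : ψ y = 1 := hU y hy.1
    change e.linearMapAt ℝ y (ψ y • e.symmₗ ℝ y (b i)) = b i
    rw [this, one_smul]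
    exact Trivialization.linearMapAt_symmₗ (R := ℝ) e hy.2 (b i)
  · ext y
    rw [sec_sum_apply]
    change (ψ y * ψ y) • t y = ∑ i, (ψ y • b.coord i (e.linearMapAt ℝ y (t y))) •
      (ψ y • e.symmₗ ℝ y (b i))
    by_cases hy : y ∈ e.baseSet
    · have : t y = ∑ i, b.coord i (e.linearMapAt ℝ y (t y)) • e.symmₗ ℝ y (b i) := by
        conv_lhs => rw [← Trivialization.symmₗ_linearMapAt (R := ℝ) e hy (t y), ← b.sum_repr (e.linearMapAt ℝ y (t y))]
        simp only [map_sum, map_smul, Basis.coord_apply]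
      conv_lhs => rw [this]
      rw [Finset.smul_sum]
      refine Finset.sum_congr rfl fun i _ => ?_
      simp only [smul_smul, smul_eq_mul]
      congr 1
      ring
    · have : ψ y = 0 := image_eq_zero_of_notMem_tsupport fun h => hy (hψ h)
      simp [this]

/-- A `C^∞(M)`-linear map on sections is given by fibrewise linear maps. -/
theorem exists_hom {F' : Type*} [NormedAddCommGroup F'] [NormedSpace ℝ F']
    {V' : M → Type*} [TopologicalSpace (TotalSpace F' V')] [∀ x, TopologicalSpace (V' x)]
    [∀ x, AddCommGroup (V' x)] [∀ x, Module ℝ (V' x)] [FiberBundle F' V'] [VectorBundle ℝ F' V']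
    (Φ : Sec E F V →ₗ[SmoothFn E M] Sec E F' V') :
    ∃ T : HomSec E F V F' V', ∀ s, T.app s = Φ s := by
  suffices h : ∀ x : M, ∃ T : V x →ₗ[ℝ] V' x, ∀ s : Sec E F V, T (s x) = Φ s x by
    choose T hT using h
    refine ⟨⟨T, fun s => ?_⟩, fun s => ?_⟩
    · simpa only [hT] using (Φ s).contMDiff
    · ext x; exact hT x s
  intro x
  let e := trivializationAt F V x
  obtain ⟨U, χ, s, -, hxU, hUe, -, hχ, hs, hex⟩ := exists_frame (E := E) x e
    (mem_baseSet_trivializationAt F V x)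
  refine ⟨((finBasis ℝ F).constr ℝ (fun i => Φ (s i) x)) ∘ₗ e.linearMapAt ℝ x, fun t => ?_⟩
  obtain ⟨c, hc⟩ := hex t
  have hc' := hc
  have h1 : t x = ∑ i, c i x • s i x := by
    have := congrArg (fun r : Sec E F V => r x) hc
    simpa [hχ x hxU, sec_sum_apply] using this
  have h2 : Φ t x = ∑ i, c i x • Φ (s i) x := by
    have := congrArg (fun r : Sec E F V => Φ r x) hc
    simp only [map_smul, map_sum, sec_sum_apply] at this
    simpa [hχ x hxU] using this
  rw [h1, h2]
  simp [hs x hxU]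

end Frame

/-! ### Derivation extensions -/

section DerivExt

variable {W W' : Type*} [AddCommGroup W] [Module ℝ W] [AddCommGroup W'] [Module ℝ W']

theorem ι_mul_ι_mul_swap (u v : W) (P : ExteriorAlgebra ℝ W) :
    ExteriorAlgebra.ι ℝ u * (ExteriorAlgebra.ι ℝ v * P) =
      -(ExteriorAlgebra.ι ℝ v * (ExteriorAlgebra.ι ℝ u * P)) := by
  rw [← mul_assoc, ← mul_assoc, eq_neg_iff_add_eq_zero, ← add_mul,
    ExteriorAlgebra.ι_add_mul_swap, zero_mul]

/-- The extension of a linear endomorphism `T` of `W` to a derivation of the exterior algebra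
`∧^• W`, characterized by `derivExt_one` and `derivExt_ι_mul`. -/
def derivExt (T : W →ₗ[ℝ] W) : ExteriorAlgebra ℝ W →ₗ[ℝ] ExteriorAlgebra ℝ W :=
  CliffordAlgebra.foldr' (0 : QuadraticForm ℝ W)
    (LinearMap.mk₂ ℝ
      (fun (w : W) (p : ExteriorAlgebra ℝ W × ExteriorAlgebra ℝ W) =>
        ExteriorAlgebra.ι ℝ (T w) * p.1 + ExteriorAlgebra.ι ℝ w * p.2)
      (fun a b p => by simp only [map_add, add_mul]; abel)
      (fun r a p => by simp only [map_smul, smul_mul_assoc, smul_add])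
      (fun a p q => by simp only [Prod.fst_add, Prod.snd_add, mul_add]; abel)
      (fun r a p => by simp only [Prod.smul_fst, Prod.smul_snd, mul_smul_comm, smul_add]))
    (fun w P fP => by
      change ExteriorAlgebra.ι ℝ (T w) * (ExteriorAlgebra.ι ℝ w * P) +
        ExteriorAlgebra.ι ℝ w * (ExteriorAlgebra.ι ℝ (T w) * P + ExteriorAlgebra.ι ℝ w * fP) = _
      rw [mul_add, ι_mul_ι_mul_swap (T w) w P, ← mul_assoc _ _ fP, ExteriorAlgebra.ι_sq_zero]
      simp)
    0

@[simp] theorem derivExt_algebraMap (T : W →ₗ[ℝ] W) (r : ℝ) :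
    derivExt T (algebraMap ℝ _ r) = 0 := by
  unfold derivExt
  exact (CliffordAlgebra.foldr'_algebraMap _ _ _ _ _).trans (smul_zero r)

theorem derivExt_one (T : W →ₗ[ℝ] W) : derivExt T 1 = 0 := by
  rw [← map_one (algebraMap ℝ _), derivExt_algebraMap]

theorem derivExt_ι_mul (T : W →ₗ[ℝ] W) (w : W) (P : ExteriorAlgebra ℝ W) :
    derivExt T (ExteriorAlgebra.ι ℝ w * P) =
      ExteriorAlgebra.ι ℝ (T w) * P + ExteriorAlgebra.ι ℝ w * derivExt T P := by
  unfold derivExt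
  exact CliffordAlgebra.foldr'_ι_mul _ _ _ _ _ _

@[elab_as_elim]
theorem ext_induction {p : ExteriorAlgebra ℝ W → Prop} (P : ExteriorAlgebra ℝ W)
    (algebraMap : ∀ r, p (algebraMap ℝ _ r)) (add : ∀ P Q, p P → p Q → p (P + Q))
    (ι_mul : ∀ P w, p P → p (ExteriorAlgebra.ι ℝ w * P)) : p P :=
  CliffordAlgebra.left_induction (Q := (0 : QuadraticForm ℝ W)) algebraMap add ι_mul P

theorem derivExt_ι (T : W →ₗ[ℝ] W) (w : W) :
    derivExt T (ExteriorAlgebra.ι ℝ w) = ExteriorAlgebra.ι ℝ (T w) := by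
  simpa [derivExt_one] using derivExt_ι_mul T w 1

/-- The derivation property. -/
theorem derivExt_mul (T : W →ₗ[ℝ] W) (P Q : ExteriorAlgebra ℝ W) :
    derivExt T (P * Q) = derivExt T P * Q + P * derivExt T Q := by
  induction P using ext_induction with
  | algebraMap r => simp [← Algebra.smul_def]
  | add P P' h h' => simp only [add_mul, map_add, h, h']; abel
  | ι_mul P w h =>
    rw [mul_assoc, derivExt_ι_mul, h, derivExt_ι_mul]
    simp only [mul_add, add_mul, mul_assoc]; abel

theorem derivExt_add (T T' : W →ₗ[ℝ] W) (P : ExteriorAlgebra ℝ W) :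
    derivExt (T + T') P = derivExt T P + derivExt T' P := by
  induction P using ext_induction with
  | algebraMap r => simp
  | add P P' h h' => simp only [map_add, h, h']; abel
  | ι_mul P w h =>
    simp only [derivExt_ι_mul, h, LinearMap.add_apply, map_add, add_mul, mul_add]; abel

theorem derivExt_smul (r : ℝ) (T : W →ₗ[ℝ] W) (P : ExteriorAlgebra ℝ W) :
    derivExt (r • T) P = r • derivExt T P := by
  induction P using ext_induction with
  | algebraMap r => simp
  | add P P' h h' => simp only [map_add, h, h', smul_add]
  | ι_mul P w h =>
    simp only [derivExt_ι_mul, h, LinearMap.smul_apply, map_smul, smul_mul_assoc, mul_smul_comm,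
      smul_add]

theorem derivExt_natural (g : W →ₗ[ℝ] W') (T : W →ₗ[ℝ] W) (T' : W' →ₗ[ℝ] W')
    (h : ∀ w, g (T w) = T' (g w)) (P : ExteriorAlgebra ℝ W) :
    ExteriorAlgebra.map g (derivExt T P) = derivExt T' (ExteriorAlgebra.map g P) := by
  induction P using ext_induction with
  | algebraMap r => simp
  | add P P' h h' => simp only [map_add, h, h']
  | ι_mul P w h' => simp [derivExt_ι_mul, h, h']

theorem ι_mul_mem (w : W) {k : ℕ} {P : ExteriorAlgebra ℝ W}
    (hP : P ∈ (⋀[ℝ]^k W : Submodule ℝ (ExteriorAlgebra ℝ W))) :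
    ExteriorAlgebra.ι ℝ w * P ∈ (⋀[ℝ]^(k + 1) W : Submodule ℝ (ExteriorAlgebra ℝ W)) := by
  change _ ∈ LinearMap.range (ExteriorAlgebra.ι ℝ) ^ (k + 1)
  rw [pow_succ']; exact Submodule.mul_mem_mul ⟨_, rfl⟩ hP

theorem derivExt_mem (T : W →ₗ[ℝ] W) (k : ℕ) {P : ExteriorAlgebra ℝ W}
    (hP : P ∈ (⋀[ℝ]^k W : Submodule ℝ (ExteriorAlgebra ℝ W))) :
    derivExt T P ∈ (⋀[ℝ]^k W : Submodule ℝ (ExteriorAlgebra ℝ W)) := by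
  induction hP using Submodule.pow_induction_on_left' with
  | algebraMap r => simp
  | add P Q i hP hQ h h' => rw [map_add]; exact Submodule.add_mem _ h h'
  | mem_mul u hu i P hP h =>
    obtain ⟨w, rfl⟩ := hu
    rw [derivExt_ι_mul]
    refine Submodule.add_mem _ ?_ ?_
    · exact ι_mul_mem (T w) hP
    · exact ι_mul_mem w h

end DerivExt

section Smooth

variable {E : Type*} [NormedAddCommGroup E] [NormedSpace ℝ E] [FiniteDimensional ℝ E]
  {M : Type*} [TopologicalSpace M] [ChartedSpace E M] [T2Space M] [IsManifold 𝓘(ℝ, E) ∞ M]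
  {F : Type*} [NormedAddCommGroup F] [NormedSpace ℝ F] [FiniteDimensional ℝ F]
  {V : M → Type*} [TopologicalSpace (TotalSpace F V)] [∀ x, TopologicalSpace (V x)]
  [∀ x, AddCommGroup (V x)] [∀ x, Module ℝ (V x)] [FiberBundle F V] [VectorBundle ℝ F V]
  [ContMDiffVectorBundle ∞ F V 𝓘(ℝ, E)]

/-- The derivation of `Γ(∧^• A)` that extends a bundle endomorphism of `A`. -/
def homDeriv (T : HomSec E F V F V) : ExtSec E F V →ₗ[ℝ] ExtSec E F V where
  toFun P := ⟨fun x => derivExt (T.1 x) (P.1 x), fun e _ x hx => by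
    obtain ⟨U, χ, s, hUo, hxU, hUe, -, hχ, hs, -⟩ := exists_frame (E := E) x e hx
    let T' : M → F →ₗ[ℝ] F := fun y =>
      e.linearMapAt ℝ y ∘ₗ T.1 y ∘ₗ e.symmₗ ℝ y
    have hT' : SmoothAt E T' x := by
      let b := finBasis ℝ F
      have h1 : ∀ i, SmoothAt E (fun y => e.linearMapAt ℝ y (T.app (s i) y)) x := fun i =>
        smoothAt_of_contMDiffAt ((contMDiffAt_sec_iff e hx).1 (T.app (s i)).contMDiff.contMDiffAt)
      refine (SmoothAt.sum (s := Finset.univ) (x := x) fun i _ => (h1 i).linear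
        (LinearMap.smulRightₗ (b.coord i) : F →ₗ[ℝ] F →ₗ[ℝ] F)).congr ?_
      filter_upwards [hUo.mem_nhds hxU] with y hy
      refine b.ext fun j => ?_
      have h2 : e.symmₗ ℝ y (b j) = s j y := by
        rw [← hs y hy j]
        exact Trivialization.symmₗ_linearMapAt (R := ℝ) e (hUe hy) (s j y)
      simp [T', h2, Finsupp.single_apply]
    have h := hT'.bilin (P.2 e x hx) (LinearMap.mk₂ ℝ (fun T w => derivExt T w)
      derivExt_add derivExt_smul (fun T w w' => map_add _ w w') (fun r T w => map_smul _ r w))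
    refine h.congr ?_
    filter_upwards [hUo.mem_nhds hxU] with y hy
    refine derivExt_natural _ _ _ (fun w => ?_) _
    simp only [T', LinearMap.comp_apply]
    rw [Trivialization.symmₗ_linearMapAt (R := ℝ) e (hUe hy) w]⟩
  map_add' P Q := ExtSec.val_ext (fun x => map_add _ _ _)
  map_smul' r P := ExtSec.val_ext (fun x => (derivExt (T.1 x)).map_smul r (P.1 x))

end Smooth

/-! ### The jet Lie algebroid -/

section Jet

variable {E : Type*} [NormedAddCommGroup E] [NormedSpace ℝ E] [FiniteDimensional ℝ E]
  {M : Type*} [TopologicalSpace M] [ChartedSpace E M] [T2Space M] [IsManifold 𝓘(ℝ, E) ∞ M]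
  {F : Type*} [NormedAddCommGroup F] [NormedSpace ℝ F] [FiniteDimensional ℝ F]
  {V : M → Type*} [TopologicalSpace (TotalSpace F V)] [∀ x, TopologicalSpace (V x)]
  [∀ x, AddCommGroup (V x)] [∀ x, Module ℝ (V x)] [FiberBundle F V] [VectorBundle ℝ F V]
  [ContMDiffVectorBundle ∞ F V 𝓘(ℝ, E)]

theorem isManifold_two : IsManifold 𝓘(ℝ, E) (minSmoothness ℝ 2) M := by
  rw [minSmoothness_of_isRCLikeNormedField]
  infer_instance

/-- The Lie bracket of vector fields. -/
def vfBracket (X Y : VecField E M) : VecField E M :=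
  ⟨fun x => VectorField.mlieBracket 𝓘(ℝ, E) X Y x,
    have := isManifold_two (E := E) (M := M)
    have : IsManifold 𝓘(ℝ, E) (((⊤ : ℕ∞) : WithTop ℕ∞) + 1) M := ‹IsManifold 𝓘(ℝ, E) ∞ M›
    ContDiff.mlieBracket_vectorField (m := ⊤) (n := ⊤) X.contMDiff Y.contMDiff (by simp)⟩

variable (E F V) in
/-- The space `Γ(Hom(TM, A)) = Γ(T^*M ⊗ A)`. -/
abbrev TA := HomSec E E (fun x : M => TangentSpace 𝓘(ℝ, E) x) F V

theorem vfBracket_add (X Y Z : VecField E M) :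
    vfBracket X (Y + Z) = vfBracket X Y + vfBracket X Z := by
  have := isManifold_two (E := E) (M := M)
  ext x
  exact VectorField.mlieBracket_add_right (V := X)
    (Y.contMDiff.mdifferentiableAt (by simp)) (Z.contMDiff.mdifferentiableAt (by simp))

theorem vfBracket_smul (X Y : VecField E M) (f : SmoothFn E M) :
    vfBracket X (f • Y) = f • vfBracket X Y + lieD X f • Y := by
  have := isManifold_two (E := E) (M := M)
  ext x
  rw [add_comm]
  exact VectorField.mlieBracket_smul_right (V := X)
    (f.contMDiff.mdifferentiableAt (by simp)) (Y.contMDiff.mdifferentiableAt (by simp))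

variable (A : LieAlgebroid E F V)

theorem exists_lieHom (u : Sec E F V) (K : TA E F V) :
    ∃ T : TA E F V, ∀ X : VecField E M,
      T.app X = A.bracket u (K.app X) - K.app (vfBracket (A.anchor.app u) X) := by
  let Φ : VecField E M →ₗ[SmoothFn E M] Sec E F V :=
    { toFun := fun X => A.bracket u (K.app X) - K.app (vfBracket (A.anchor.app u) X)
      map_add' := fun X Y => by
        rw [vfBracket_add, HomSec.app_add, HomSec.app_add, map_add]; abel
      map_smul' := fun f X => by
        rw [vfBracket_smul, HomSec.app_add, HomSec.app_smul, HomSec.app_smul, HomSec.app_smul,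
          A.leibniz, RingHom.id_apply, smul_sub]
        abel }
  exact exists_hom Φ

/-- The Lie derivative `L_u K` of a section of `Hom(TM, A)`:
`(L_u K)(X) = [u, K(X)] - K([ρ(u), X])`. -/
def lieHom (u : Sec E F V) (K : TA E F V) : TA E F V :=
  (exists_lieHom A u K).choose

theorem lieHom_app (u : Sec E F V) (K : TA E F V) (X : VecField E M) :
    (lieHom A u K).app X = A.bracket u (K.app X) - K.app (vfBracket (A.anchor.app u) X) :=
  (exists_lieHom A u K).choose_spec X

end Jet

/-! ### Signs and contractions in exterior algebras -/

section Alg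

variable {W : Type*} [AddCommGroup W] [Module ℝ W]

/-- The contraction `ι_d P` of a covector with a multivector. -/
def contr (d : Dual ℝ W) : ExteriorAlgebra ℝ W →ₗ[ℝ] ExteriorAlgebra ℝ W :=
  CliffordAlgebra.contractLeft (Q := (0 : QuadraticForm ℝ W)) d

theorem contr_algebraMap (d : Dual ℝ W) (r : ℝ) : contr d (algebraMap ℝ _ r) = 0 :=
  CliffordAlgebra.contractLeft_algebraMap _ d r

theorem contr_ι (d : Dual ℝ W) (w : W) :
    contr d (ExteriorAlgebra.ι ℝ w) = algebraMap ℝ _ (d w) :=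
  CliffordAlgebra.contractLeft_ι _ d w

theorem contr_ι_mul (d : Dual ℝ W) (w : W) (P : ExteriorAlgebra ℝ W) :
    contr d (ExteriorAlgebra.ι ℝ w * P) = d w • P - ExteriorAlgebra.ι ℝ w * contr d P :=
  CliffordAlgebra.contractLeft_ι_mul (Q := (0 : QuadraticForm ℝ W)) d w P

theorem neg_one_zpow_add_one (n : ℤ) : (-1 : ℝ) ^ (n + 1) = -(-1 : ℝ) ^ n := by
  rw [zpow_add_one₀ (by norm_num)]; ring

theorem contr_zero_deg (d : Dual ℝ W) {P : ExteriorAlgebra ℝ W}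
    (hP : P ∈ (⋀[ℝ]^0 W : Submodule ℝ (ExteriorAlgebra ℝ W))) : contr d P = 0 := by
  change P ∈ LinearMap.range (ExteriorAlgebra.ι ℝ) ^ 0 at hP
  rw [pow_zero, Submodule.mem_one] at hP
  obtain ⟨r, rfl⟩ := hP
  exact contr_algebraMap d r

theorem contr_mem (d : Dual ℝ W) (k : ℕ) {P : ExteriorAlgebra ℝ W}
    (hP : P ∈ (⋀[ℝ]^(k + 1) W : Submodule ℝ (ExteriorAlgebra ℝ W))) :
    contr d P ∈ (⋀[ℝ]^k W : Submodule ℝ (ExteriorAlgebra ℝ W)) := by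
  suffices h : ∀ n, P ∈ (⋀[ℝ]^n W : Submodule ℝ (ExteriorAlgebra ℝ W)) →
      (n = 0 ∧ contr d P = 0) ∨
        ∃ m, n = m + 1 ∧ contr d P ∈ (⋀[ℝ]^m W : Submodule ℝ (ExteriorAlgebra ℝ W)) by
    rcases h _ hP with ⟨h, -⟩ | ⟨m, h, h'⟩
    · omega
    · obtain rfl : k = m := by omega
      exact h'
  clear hP
  intro n hP
  induction hP using Submodule.pow_induction_on_left' with
  | algebraMap r => exact Or.inl ⟨rfl, contr_algebraMap d r⟩
  | add P Q i hP hQ h h' =>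
    rcases h with ⟨h0, h⟩ | ⟨m, h0, h⟩
    · rcases h' with ⟨h0', h'⟩ | ⟨m', h0', h'⟩
      · exact Or.inl ⟨h0, by rw [map_add, h, h', add_zero]⟩
      · omega
    · rcases h' with ⟨h0', h'⟩ | ⟨m', h0', h'⟩
      · omega
      · obtain rfl : m = m' := by omega
        exact Or.inr ⟨m, h0, by rw [map_add]; exact Submodule.add_mem _ h h'⟩
  | mem_mul u hu i P hP h =>
    obtain ⟨w, rfl⟩ := hu
    refine Or.inr ⟨i, rfl, ?_⟩
    rw [contr_ι_mul]
    refine Submodule.sub_mem _ (Submodule.smul_mem _ _ hP) ?_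
    rcases h with ⟨h0, h⟩ | ⟨m, rfl, h⟩
    · rw [h, mul_zero]; exact Submodule.zero_mem _
    · exact ι_mul_mem w h

theorem deg_mul_mem {p q : ℕ} {P Q : ExteriorAlgebra ℝ W}
    (hP : P ∈ (⋀[ℝ]^p W : Submodule ℝ (ExteriorAlgebra ℝ W)))
    (hQ : Q ∈ (⋀[ℝ]^q W : Submodule ℝ (ExteriorAlgebra ℝ W))) :
    P * Q ∈ (⋀[ℝ]^(p + q) W : Submodule ℝ (ExteriorAlgebra ℝ W)) := by
  change _ ∈ LinearMap.range (ExteriorAlgebra.ι ℝ) ^ (p + q)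
  rw [pow_add]; exact Submodule.mul_mem_mul hP hQ

theorem ι_mem_one (w : W) :
    ExteriorAlgebra.ι ℝ w ∈ (⋀[ℝ]^1 W : Submodule ℝ (ExteriorAlgebra ℝ W)) := by
  change _ ∈ LinearMap.range (ExteriorAlgebra.ι ℝ) ^ 1
  rw [pow_one]; exact ⟨w, rfl⟩

theorem ι_mul_comm_deg (w : W) {q : ℕ} {Q : ExteriorAlgebra ℝ W}
    (hQ : Q ∈ (⋀[ℝ]^q W : Submodule ℝ (ExteriorAlgebra ℝ W))) :
    ExteriorAlgebra.ι ℝ w * Q = (-1 : ℝ) ^ (q : ℤ) • (Q * ExteriorAlgebra.ι ℝ w) := by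
  induction hQ using Submodule.pow_induction_on_left' with
  | algebraMap r => simp [Algebra.commutes]
  | add P Q i hP hQ h h' => rw [mul_add, h, h', add_mul, smul_add]
  | mem_mul u hu i P hP h =>
    obtain ⟨v, rfl⟩ := hu
    rw [ι_mul_ι_mul_swap, h, Nat.succ_eq_add_one, Nat.cast_add, Nat.cast_one,
      neg_one_zpow_add_one, mul_smul_comm, neg_smul, mul_assoc]

/-- Graded commutativity. -/
theorem mul_comm_deg {p q : ℕ} {P Q : ExteriorAlgebra ℝ W}
    (hP : P ∈ (⋀[ℝ]^p W : Submodule ℝ (ExteriorAlgebra ℝ W)))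
    (hQ : Q ∈ (⋀[ℝ]^q W : Submodule ℝ (ExteriorAlgebra ℝ W))) :
    P * Q = (-1 : ℝ) ^ ((p : ℤ) * q) • (Q * P) := by
  induction hP using Submodule.pow_induction_on_left' with
  | algebraMap r => simp [Algebra.commutes]
  | add P P' i hP hP' h h' => rw [add_mul, h, h', mul_add, smul_add]
  | mem_mul u hu i P hP h =>
    obtain ⟨v, rfl⟩ := hu
    rw [mul_assoc, h, mul_smul_comm, ← mul_assoc, ι_mul_comm_deg v hQ, smul_mul_assoc, mul_assoc,
      smul_smul, ← zpow_add₀ (by norm_num)]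
    congr 2
    push_cast; ring

/-- The contraction with a covector is a graded derivation. -/
theorem contr_mul (d : Dual ℝ W) {p : ℕ} {P : ExteriorAlgebra ℝ W} (Q : ExteriorAlgebra ℝ W)
    (hP : P ∈ (⋀[ℝ]^p W : Submodule ℝ (ExteriorAlgebra ℝ W))) :
    contr d (P * Q) = contr d P * Q + (-1 : ℝ) ^ (p : ℤ) • (P * contr d Q) := by
  induction hP using Submodule.pow_induction_on_left' with
  | algebraMap r => simp [contr_algebraMap, ← Algebra.smul_def]
  | add P P' i hP hP' h h' => simp only [add_mul, map_add, h, h', smul_add]; abel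
  | mem_mul u hu i P hP h =>
    obtain ⟨v, rfl⟩ := hu
    rw [mul_assoc, contr_ι_mul, h, contr_ι_mul, Nat.succ_eq_add_one, Nat.cast_add, Nat.cast_one,
      neg_one_zpow_add_one]
    simp only [mul_add, sub_mul, mul_smul_comm, smul_mul_assoc, mul_assoc, neg_smul]
    abel

/-! The bracket formula on 1-jets of multivector fields. -/

variable {n : ℕ} (b : Basis (Fin n) ℝ W) (c : Fin n → Fin n → W)

/-- The Schouten bracket in a frame `b` with structure functions `c`, as a function of the values
`P`, `Q` and the derivatives `dP`, `dQ` along the anchors of the frame. Here `ε` is the sign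
`(-1)^{p-1}` for `P` of degree `p`. -/
def locBr (P : ExteriorAlgebra ℝ W) (dP : Fin n → ExteriorAlgebra ℝ W)
    (Q : ExteriorAlgebra ℝ W) (dQ : Fin n → ExteriorAlgebra ℝ W) : ExteriorAlgebra ℝ W :=
  (∑ j, CliffordAlgebra.involute (Q := (0 : QuadraticForm ℝ W)) (contr (b.coord j) P) * dQ j) -
  (∑ i, dP i * contr (b.coord i) Q) -
  ∑ i, ∑ j, ExteriorAlgebra.ι ℝ (c i j) * (contr (b.coord j) P * contr (b.coord i) Q)

theorem involute_deg {p : ℕ} {P : ExteriorAlgebra ℝ W}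
    (hP : P ∈ (⋀[ℝ]^p W : Submodule ℝ (ExteriorAlgebra ℝ W))) :
    CliffordAlgebra.involute (Q := (0 : QuadraticForm ℝ W)) P = (-1 : ℝ) ^ (p : ℤ) • P := by
  induction hP using Submodule.pow_induction_on_left' with
  | algebraMap r =>
    rw [Nat.cast_zero, zpow_zero, one_smul]
    exact (CliffordAlgebra.involute (Q := (0 : QuadraticForm ℝ W))).commutes r
  | add P P' i hP hP' h h' => rw [map_add, h, h', smul_add]
  | mem_mul u hu i P hP h =>
    obtain ⟨v, rfl⟩ := hu
    have : CliffordAlgebra.involute (Q := (0 : QuadraticForm ℝ W)) (ExteriorAlgebra.ι ℝ v) =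
      -ExteriorAlgebra.ι ℝ v := CliffordAlgebra.involute_ι v
    rw [map_mul, this, h, Nat.succ_eq_add_one, Nat.cast_add, Nat.cast_one, neg_one_zpow_add_one,
      neg_smul, mul_smul_comm, neg_mul, smul_neg]

theorem involute_contr (d : Dual ℝ W) {p : ℕ} {P : ExteriorAlgebra ℝ W}
    (hP : P ∈ (⋀[ℝ]^p W : Submodule ℝ (ExteriorAlgebra ℝ W))) :
    CliffordAlgebra.involute (Q := (0 : QuadraticForm ℝ W)) (contr d P) =
      (-1 : ℝ) ^ ((p : ℤ) - 1) • contr d P := by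
  rcases p with _ | p
  · rw [contr_zero_deg d hP, map_zero, smul_zero]
  · rw [involute_deg (contr_mem d p hP)]; congr 2; push_cast; ring

theorem contr_mul_comm (d : Dual ℝ W) {p q : ℕ} {P Q : ExteriorAlgebra ℝ W}
    (hP : P ∈ (⋀[ℝ]^p W : Submodule ℝ (ExteriorAlgebra ℝ W)))
    (hQ : Q ∈ (⋀[ℝ]^q W : Submodule ℝ (ExteriorAlgebra ℝ W))) :
    contr d P * Q = (-1 : ℝ) ^ (((p : ℤ) - 1) * q) • (Q * contr d P) := by
  rcases p with _ | p
  · rw [contr_zero_deg d hP]; simp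
  · rw [mul_comm_deg (contr_mem d p hP) hQ]; congr 2; push_cast; ring

theorem contr_mul_contr_comm (d d' : Dual ℝ W) {p q : ℕ} {P Q : ExteriorAlgebra ℝ W}
    (hP : P ∈ (⋀[ℝ]^p W : Submodule ℝ (ExteriorAlgebra ℝ W)))
    (hQ : Q ∈ (⋀[ℝ]^q W : Submodule ℝ (ExteriorAlgebra ℝ W))) :
    contr d P * contr d' Q = (-1 : ℝ) ^ (((p : ℤ) - 1) * (q - 1)) • (contr d' Q * contr d P) := by
  rcases q with _ | q
  · rw [contr_zero_deg d' hQ]; simp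
  · rw [contr_mul_comm d hP (contr_mem d' q hQ)]; congr 2; push_cast; ring

theorem neg_one_zpow_eq {m n k : ℤ} (h : m = n + 2 * k) : (-1 : ℝ) ^ m = (-1 : ℝ) ^ n := by
  rw [h, zpow_add₀ (by norm_num), zpow_mul]; norm_num

theorem locBr_deg {p q r : ℕ} (h : p + q = r + 1) {P Q : ExteriorAlgebra ℝ W}
    {dP dQ : Fin n → ExteriorAlgebra ℝ W}
    (hP : P ∈ (⋀[ℝ]^p W : Submodule ℝ (ExteriorAlgebra ℝ W)))
    (hQ : Q ∈ (⋀[ℝ]^q W : Submodule ℝ (ExteriorAlgebra ℝ W)))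
    (hdP : ∀ i, dP i ∈ (⋀[ℝ]^p W : Submodule ℝ (ExteriorAlgebra ℝ W)))
    (hdQ : ∀ i, dQ i ∈ (⋀[ℝ]^q W : Submodule ℝ (ExteriorAlgebra ℝ W))) :
    locBr b c P dP Q dQ ∈ (⋀[ℝ]^r W : Submodule ℝ (ExteriorAlgebra ℝ W)) := by
  refine Submodule.sub_mem _ (Submodule.sub_mem _ ?_ ?_) ?_
  · refine Submodule.sum_mem _ fun j _ => ?_
    rw [involute_contr _ hP, smul_mul_assoc]
    refine Submodule.smul_mem _ _ ?_
    rcases p with _ | p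
    · rw [contr_zero_deg _ hP, zero_mul]; exact Submodule.zero_mem _
    · obtain rfl : r = p + q := by omega
      exact deg_mul_mem (contr_mem _ p hP) (hdQ j)
  · refine Submodule.sum_mem _ fun j _ => ?_
    rcases q with _ | q
    · rw [contr_zero_deg _ hQ, mul_zero]; exact Submodule.zero_mem _
    · obtain rfl : r = p + q := by omega
      exact deg_mul_mem (hdP j) (contr_mem _ q hQ)
  · refine Submodule.sum_mem _ fun i _ => Submodule.sum_mem _ fun j _ => ?_
    rcases p with _ | p
    · rw [contr_zero_deg _ hP, zero_mul, mul_zero]; exact Submodule.zero_mem _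
    rcases q with _ | q
    · rw [contr_zero_deg _ hQ, mul_zero, mul_zero]; exact Submodule.zero_mem _
    · obtain rfl : r = p + q + 1 := by omega
      exact ι_mul_mem _ (deg_mul_mem (contr_mem _ p hP) (contr_mem _ q hQ))

theorem locBr_swap {p q : ℕ} (hc : ∀ i j, c i j = -c j i) {P Q : ExteriorAlgebra ℝ W}
    {dP dQ : Fin n → ExteriorAlgebra ℝ W}
    (hP : P ∈ (⋀[ℝ]^p W : Submodule ℝ (ExteriorAlgebra ℝ W)))
    (hQ : Q ∈ (⋀[ℝ]^q W : Submodule ℝ (ExteriorAlgebra ℝ W)))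
    (hdP : ∀ i, dP i ∈ (⋀[ℝ]^p W : Submodule ℝ (ExteriorAlgebra ℝ W)))
    (hdQ : ∀ i, dQ i ∈ (⋀[ℝ]^q W : Submodule ℝ (ExteriorAlgebra ℝ W))) :
    locBr b c P dP Q dQ =
      -(-1 : ℝ) ^ (((p : ℤ) - 1) * ((q : ℤ) - 1)) • locBr b c Q dQ P dP := by
  set σ := (-1 : ℝ) ^ (((p : ℤ) - 1) * ((q : ℤ) - 1)) with hσ
  have hσσ : σ * σ = 1 := by
    rw [hσ, ← zpow_add₀ (by norm_num)]
    exact (neg_one_zpow_eq (n := 0) (k := ((p : ℤ) - 1) * ((q : ℤ) - 1)) (by ring)).trans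
      (zpow_zero _)
  have h1 : ∀ j, CliffordAlgebra.involute (Q := (0 : QuadraticForm ℝ W)) (contr (b.coord j) P) *
      dQ j = σ • (dQ j * contr (b.coord j) P) := fun j => by
    rw [involute_contr _ hP, smul_mul_assoc, contr_mul_comm _ hP (hdQ j), smul_smul,
      ← zpow_add₀ (by norm_num)]
    congr 1
    exact neg_one_zpow_eq (k := (p : ℤ) - 1) (by ring)
  have h2 : ∀ i, dP i * contr (b.coord i) Q = σ • (CliffordAlgebra.involute
      (Q := (0 : QuadraticForm ℝ W)) (contr (b.coord i) Q) * dP i) := fun i => by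
    rw [involute_contr _ hQ, smul_mul_assoc, contr_mul_comm _ hQ (hdP i), smul_smul, smul_smul,
      ← zpow_add₀ (by norm_num), ← zpow_add₀ (by norm_num)]
    conv_lhs => rw [← one_smul ℝ (dP i * contr (b.coord i) Q)]
    congr 1
    exact ((neg_one_zpow_eq (n := 0) (k := ((q : ℤ) - 1) * p) (by ring)).trans
      (zpow_zero _)).symm
  have h3 : ∀ i j, ExteriorAlgebra.ι ℝ (c i j) * (contr (b.coord j) P * contr (b.coord i) Q) =
      -σ • (ExteriorAlgebra.ι ℝ (c j i) * (contr (b.coord i) Q * contr (b.coord j) P)) :=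
    fun i j => by
      rw [contr_mul_contr_comm _ _ hP hQ, hc i j]
      simp only [map_neg, neg_mul, mul_smul_comm, neg_smul, smul_neg, hσ]
  unfold locBr
  simp only [h1, h2, h3]
  rw [Finset.sum_comm (f := fun i j => -σ • (ExteriorAlgebra.ι ℝ (c j i) *
    (contr (b.coord i) Q * contr (b.coord j) P)))]
  simp only [← Finset.smul_sum, smul_sub, neg_smul, Finset.sum_neg_distrib]
  abel

theorem locBr_mul {p q : ℕ} {P Q : ExteriorAlgebra ℝ W} (R : ExteriorAlgebra ℝ W)
    {dP dQ : Fin n → ExteriorAlgebra ℝ W} (dR : Fin n → ExteriorAlgebra ℝ W)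
    (hP : P ∈ (⋀[ℝ]^p W : Submodule ℝ (ExteriorAlgebra ℝ W)))
    (hQ : Q ∈ (⋀[ℝ]^q W : Submodule ℝ (ExteriorAlgebra ℝ W)))
    (hdP : ∀ i, dP i ∈ (⋀[ℝ]^p W : Submodule ℝ (ExteriorAlgebra ℝ W))) :
    locBr b c P dP (Q * R) (fun i => dQ i * R + Q * dR i) =
      locBr b c P dP Q dQ * R +
        (-1 : ℝ) ^ ((q : ℤ) * ((p : ℤ) - 1)) • (Q * locBr b c P dP R dR) := by
  set σ := (-1 : ℝ) ^ ((q : ℤ) * ((p : ℤ) - 1)) with hσ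
  have h1 : ∀ j, CliffordAlgebra.involute (Q := (0 : QuadraticForm ℝ W)) (contr (b.coord j) P) *
      (dQ j * R + Q * dR j) =
      CliffordAlgebra.involute (Q := (0 : QuadraticForm ℝ W)) (contr (b.coord j) P) * dQ j * R +
      σ • (Q * (CliffordAlgebra.involute (Q := (0 : QuadraticForm ℝ W)) (contr (b.coord j) P) *
        dR j)) := fun j => by
    rw [involute_contr _ hP, mul_add, ← mul_assoc, ← mul_assoc]
    congr 1
    simp only [smul_mul_assoc, mul_smul_comm]
    rw [contr_mul_comm _ hP hQ, smul_mul_assoc, mul_assoc, smul_comm, hσ,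
      mul_comm (q : ℤ) ((p : ℤ) - 1)]
  have h2 : ∀ i, dP i * contr (b.coord i) (Q * R) = dP i * contr (b.coord i) Q * R +
      σ • (Q * (dP i * contr (b.coord i) R)) := fun i => by
    rw [contr_mul _ R hQ, mul_add, ← mul_assoc, mul_smul_comm, ← mul_assoc,
      mul_comm_deg (hdP i) hQ, smul_mul_assoc, smul_smul, ← zpow_add₀ (by norm_num), mul_assoc Q]
    congr 2
    exact neg_one_zpow_eq (k := q) (by ring)
  have h3 : ∀ i j, ExteriorAlgebra.ι ℝ (c i j) * (contr (b.coord j) P *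
      contr (b.coord i) (Q * R)) =
      ExteriorAlgebra.ι ℝ (c i j) * (contr (b.coord j) P * contr (b.coord i) Q) * R +
      σ • (Q * (ExteriorAlgebra.ι ℝ (c i j) * (contr (b.coord j) P * contr (b.coord i) R))) :=
    fun i j => by
      rw [contr_mul _ R hQ, mul_add, mul_add, mul_assoc, mul_assoc, mul_smul_comm, mul_smul_comm]
      congr 1
      rw [← mul_assoc (contr _ P), contr_mul_comm _ hP hQ, smul_mul_assoc, mul_smul_comm,
        smul_smul, ← mul_assoc _ (Q * _), ← mul_assoc _ Q, ι_mul_comm_deg _ hQ, ]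
      simp only [smul_mul_assoc, smul_smul, mul_assoc]
      congr 1
      rw [hσ, ← zpow_add₀ (by norm_num), ← zpow_add₀ (by norm_num)]
      exact neg_one_zpow_eq (k := q) (by ring)
  unfold locBr
  simp only [h1, h2, h3, Finset.sum_add_distrib, ← Finset.smul_sum, ← Finset.mul_sum,
    ← Finset.sum_mul, mul_sub, sub_mul, smul_sub]
  abel

end Alg

/-! ### The Schouten bracket: local construction -/

section LieD

variable {E : Type*} [NormedAddCommGroup E] [NormedSpace ℝ E]
  {M : Type*} [TopologicalSpace M] [ChartedSpace E M] [IsManifold 𝓘(ℝ, E) ∞ M]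

theorem fn_sum_apply {ι : Type*} (s : Finset ι) (f : ι → SmoothFn E M) (x : M) :
    (∑ i ∈ s, f i) x = ∑ i ∈ s, f i x := by
  classical
  induction s using Finset.induction_on with
  | empty => rfl
  | insert a s ha ih => rw [Finset.sum_insert ha, Finset.sum_insert ha, ← ih]; rfl

theorem fn_smul_apply (r : ℝ) (f : SmoothFn E M) (x : M) : (r • f) x = r * f x := rfl

theorem fn_mul_apply (f g : SmoothFn E M) (x : M) : (f * g) x = f x * g x := rfl

theorem fn_add_apply (f g : SmoothFn E M) (x : M) : (f + g) x = f x + g x := rfl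

theorem lieD_add (X : VecField E M) (f g : SmoothFn E M) :
    lieD X (f + g) = lieD X f + lieD X g := by
  ext x; simp [dAt_add]

theorem lieD_mul (X : VecField E M) (f g : SmoothFn E M) :
    lieD X (f * g) = f * lieD X g + g * lieD X f := by
  ext x; simp [dAt_mul]

theorem lieD_smul (X : VecField E M) (r : ℝ) (f : SmoothFn E M) :
    lieD X (r • f) = r • lieD X f := by
  ext x
  have hf := f.contMDiff.mdifferentiableAt (x := x) (by simp)
  have := DFunLike.congr_fun (hf.hasMFDerivAt.const_smul r).mfderiv (X x)
  simpa [dAt] using! this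

/-- `lieD` as a linear map. -/
def lieDₗ (X : VecField E M) : SmoothFn E M →ₗ[ℝ] SmoothFn E M where
  toFun := lieD X
  map_add' := lieD_add X
  map_smul' := lieD_smul X

theorem lieD_sum (X : VecField E M) {ι : Type*} (s : Finset ι) (f : ι → SmoothFn E M) :
    lieD X (∑ i ∈ s, f i) = ∑ i ∈ s, lieD X (f i) := map_sum (lieDₗ X) f s

theorem lieD_congr (X : VecField E M) {f g : SmoothFn E M} {x : M}
    (h : ∀ᶠ y in 𝓝 x, f y = g y) : lieD X f x = lieD X g x := by
  simp [dAt_congr h]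

end LieD

section Local

variable {E : Type*} [NormedAddCommGroup E] [NormedSpace ℝ E] [FiniteDimensional ℝ E]
  {M : Type*} [TopologicalSpace M] [ChartedSpace E M] [T2Space M] [IsManifold 𝓘(ℝ, E) ∞ M]
  {F : Type*} [NormedAddCommGroup F] [NormedSpace ℝ F] [FiniteDimensional ℝ F]
  {V : M → Type*} [TopologicalSpace (TotalSpace F V)] [∀ x, TopologicalSpace (V x)]
  [∀ x, AddCommGroup (V x)] [∀ x, Module ℝ (V x)] [FiberBundle F V] [VectorBundle ℝ F V]
  [ContMDiffVectorBundle ∞ F V 𝓘(ℝ, E)]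

variable (E F V) in
/-- A local trivialization with a cut-off function and global sections that form the
corresponding frame on the open set `U`. -/
structure Frm where
  /-- The trivialization. -/
  e : Trivialization F (π F V)
  mem : MemTrivializationAtlas e
  /-- The open set. -/
  U : Set M
  /-- The cut-off function. -/
  χ : SmoothFn E M
  /-- The sections. -/
  s : Fin (finrank ℝ F) → Sec E F V
  isOpen : IsOpen U
  sub : U ⊆ e.baseSet
  supp : tsupport χ ⊆ e.baseSet
  χ_one : ∀ y ∈ U, χ y = 1
  frame : ∀ y ∈ U, ∀ i, e.linearMapAt ℝ y (s i y) = finBasis ℝ F i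
  span : ∀ t : Sec E F V, ∃ c : Fin (finrank ℝ F) → SmoothFn E M, χ • t = ∑ i, c i • s i

attribute [instance] Frm.mem

theorem exists_frm (x : M) : ∃ φ : Frm E F V, x ∈ φ.U := by
  obtain ⟨U, χ, s, h1, h2, h3, h4, h5, h6, h7⟩ := exists_frame (E := E) x
    (trivializationAt F V x) (mem_baseSet_trivializationAt F V x)
  exact ⟨⟨_, inferInstance, U, χ, s, h1, h3, h4, h5, h6, h7⟩, h2⟩

namespace Frm

variable (φ : Frm E F V)

/-- A multivector section read in the trivialization. -/
def loc (P : ExtSec E F V) (y : M) : ExteriorAlgebra ℝ F :=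
  ExteriorAlgebra.map (φ.e.linearMapAt ℝ y) (P.1 y)

theorem loc_add (P Q : ExtSec E F V) (y : M) : φ.loc (P + Q) y = φ.loc P y + φ.loc Q y := by
  simp [loc]

theorem loc_smul (r : ℝ) (P : ExtSec E F V) (y : M) : φ.loc (r • P) y = r • φ.loc P y := by
  simp [loc]

theorem loc_mul (P Q : ExtSec E F V) (y : M) : φ.loc (P * Q) y = φ.loc P y * φ.loc Q y := by
  simp [loc]

theorem map_mem {W W' : Type*} [AddCommGroup W] [Module ℝ W] [AddCommGroup W'] [Module ℝ W']
    (g : W →ₗ[ℝ] W') {k : ℕ} {P : ExteriorAlgebra ℝ W}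
    (hP : P ∈ (⋀[ℝ]^k W : Submodule ℝ (ExteriorAlgebra ℝ W))) :
    ExteriorAlgebra.map g P ∈ (⋀[ℝ]^k W' : Submodule ℝ (ExteriorAlgebra ℝ W')) := by
  induction hP using Submodule.pow_induction_on_left' with
  | algebraMap r =>
    rw [AlgHom.commutes]
    change _ ∈ LinearMap.range (ExteriorAlgebra.ι ℝ) ^ 0
    rw [pow_zero, Submodule.mem_one]
    exact ⟨r, rfl⟩
  | add P P' i hP hP' h h' => rw [map_add]; exact Submodule.add_mem _ h h'
  | mem_mul u hu i P hP h =>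
    obtain ⟨v, rfl⟩ := hu
    rw [map_mul, ExteriorAlgebra.map_apply_ι]
    exact ι_mul_mem _ h

/-- A linear coordinate of `loc P`, cut off. -/
def coordFn (l : Dual ℝ (ExteriorAlgebra ℝ F)) (P : ExtSec E F V) : SmoothFn E M :=
  ⟨fun y => φ.χ y • (l (φ.loc P y) : ℝ), contMDiff_of_tsupport fun y hy =>
    φ.χ.contMDiff.contMDiffAt.smul (P.2 φ.e y (φ.supp (tsupport_smul_subset_left _ _ hy)) l)⟩

theorem coordFn_apply {y : M} (hy : y ∈ φ.U) (l : Dual ℝ (ExteriorAlgebra ℝ F))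
    (P : ExtSec E F V) : φ.coordFn l P y = l (φ.loc P y) := by
  change φ.χ y • l (φ.loc P y) = l (φ.loc P y)
  rw [φ.χ_one y hy, one_smul]

theorem coordFn_add (l : Dual ℝ (ExteriorAlgebra ℝ F)) (P Q : ExtSec E F V) :
    φ.coordFn l (P + Q) = φ.coordFn l P + φ.coordFn l Q := by
  ext y
  change φ.χ y • l _ = φ.χ y • l _ + φ.χ y • l _
  rw [loc_add, map_add, smul_add]

theorem coordFn_smul (l : Dual ℝ (ExteriorAlgebra ℝ F)) (r : ℝ) (P : ExtSec E F V) :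
    φ.coordFn l (r • P) = r • φ.coordFn l P := by
  ext y
  change φ.χ y • l _ = r • φ.χ y • l _
  rw [loc_smul, map_smul, smul_comm]

theorem coordFn_eq (l : Dual ℝ (ExteriorAlgebra ℝ F)) (P : ExtSec E F V) :
    φ.coordFn l P = ∑ a, l (finBasis ℝ (ExteriorAlgebra ℝ F) a) •
      φ.coordFn ((finBasis ℝ (ExteriorAlgebra ℝ F)).coord a) P := by
  ext y
  have h : (∑ a, l (finBasis ℝ (ExteriorAlgebra ℝ F) a) •
      φ.coordFn ((finBasis ℝ (ExteriorAlgebra ℝ F)).coord a) P) y =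
      ∑ a, l (finBasis ℝ (ExteriorAlgebra ℝ F) a) *
      (φ.χ y * (finBasis ℝ (ExteriorAlgebra ℝ F)).coord a (φ.loc P y)) := by
    rw [fn_sum_apply]; rfl
  rw [h]
  change φ.χ y • l _ = _
  conv_lhs => rw [← (finBasis ℝ (ExteriorAlgebra ℝ F)).sum_repr (φ.loc P y)]
  simp only [map_sum, map_smul, smul_eq_mul, Finset.mul_sum, Basis.coord_apply]
  exact Finset.sum_congr rfl fun a _ => by ring

/-- The componentwise derivative of a multivector section in the trivialization. -/
def dloc (X : VecField E M) (P : ExtSec E F V) (y : M) : ExteriorAlgebra ℝ F :=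
  ∑ a, lieD X (φ.coordFn ((finBasis ℝ (ExteriorAlgebra ℝ F)).coord a) P) y •
    finBasis ℝ (ExteriorAlgebra ℝ F) a

theorem apply_dloc (X : VecField E M) (P : ExtSec E F V) (y : M)
    (l : Dual ℝ (ExteriorAlgebra ℝ F)) : l (φ.dloc X P y) = lieD X (φ.coordFn l P) y := by
  rw [coordFn_eq φ l P, lieD_sum, fn_sum_apply]
  simp only [dloc, map_sum, map_smul, lieD_smul, smul_eq_mul]
  refine Finset.sum_congr rfl fun a _ => ?_
  rw [mul_comm]; rfl

theorem dloc_add (X : VecField E M) (P Q : ExtSec E F V) (y : M) :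
    φ.dloc X (P + Q) y = φ.dloc X P y + φ.dloc X Q y := by
  simp only [dloc, coordFn_add, lieD_add, ← Finset.sum_add_distrib, ← add_smul]; rfl

theorem dloc_smul (X : VecField E M) (r : ℝ) (P : ExtSec E F V) (y : M) :
    φ.dloc X (r • P) y = r • φ.dloc X P y := by
  simp only [dloc, coordFn_smul, lieD_smul, Finset.smul_sum, smul_smul]; rfl

theorem eq_of_dual {W : Type*} [AddCommGroup W] [Module ℝ W] {w w' : W}
    (h : ∀ l : Dual ℝ W, l w = l w') : w = w' :=
  (forall_dual_apply_eq_zero_iff ℝ (w - w')).1 (fun l => by rw [map_sub, h l, sub_self])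
    |> sub_eq_zero.1

theorem dual_mul (l : Dual ℝ (ExteriorAlgebra ℝ F)) (P Q : ExteriorAlgebra ℝ F) :
    l (P * Q) = ∑ a, ∑ a', l (finBasis ℝ (ExteriorAlgebra ℝ F) a *
      finBasis ℝ (ExteriorAlgebra ℝ F) a') * ((finBasis ℝ (ExteriorAlgebra ℝ F)).coord a P *
      (finBasis ℝ (ExteriorAlgebra ℝ F)).coord a' Q) := by
  conv_lhs => rw [← (finBasis ℝ (ExteriorAlgebra ℝ F)).sum_repr P,
    ← (finBasis ℝ (ExteriorAlgebra ℝ F)).sum_repr Q]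
  simp only [Finset.sum_mul, Finset.mul_sum, map_sum, smul_mul_assoc, mul_smul_comm, map_smul,
    smul_eq_mul, Basis.coord_apply]
  rw [Finset.sum_comm]
  exact Finset.sum_congr rfl fun a _ => Finset.sum_congr rfl fun a' _ => by ring

theorem dloc_mul (X : VecField E M) (P Q : ExtSec E F V) {y : M} (hy : y ∈ φ.U) :
    φ.dloc X (P * Q) y = φ.dloc X P y * φ.loc Q y + φ.loc P y * φ.dloc X Q y := by
  refine eq_of_dual fun l => ?_
  let b := finBasis ℝ (ExteriorAlgebra ℝ F)
  have h : ∀ z ∈ φ.U, φ.coordFn l (P * Q) z = (∑ a, ∑ a', l (b a * b a') •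
      (φ.coordFn (b.coord a) P * φ.coordFn (b.coord a') Q) : SmoothFn E M) z := fun z hz => by
    simp only [fn_sum_apply, fn_smul_apply, fn_mul_apply, φ.coordFn_apply hz, loc_mul]
    exact dual_mul l _ _
  rw [apply_dloc, lieD_congr X (Filter.eventually_of_mem (φ.isOpen.mem_nhds hy) h)]
  simp only [lieD_sum, lieD_smul, lieD_mul, fn_sum_apply, fn_smul_apply, fn_add_apply,
    fn_mul_apply, map_add, φ.coordFn_apply hy]
  rw [dual_mul l (φ.dloc X P y), dual_mul l (φ.loc P y), ← Finset.sum_add_distrib]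
  refine Finset.sum_congr rfl fun a _ => ?_
  rw [← Finset.sum_add_distrib]
  refine Finset.sum_congr rfl fun a' _ => ?_
  simp only [apply_dloc, b]
  ring

theorem loc_mem {k : ℕ} {P : ExtSec E F V} (hP : P ∈ extDeg E F V k) (y : M) :
    φ.loc P y ∈ (⋀[ℝ]^k F : Submodule ℝ (ExteriorAlgebra ℝ F)) := map_mem _ (hP y)

theorem dloc_mem (X : VecField E M) {k : ℕ} {P : ExtSec E F V} (hP : P ∈ extDeg E F V k) (y : M) :
    φ.dloc X P y ∈ (⋀[ℝ]^k F : Submodule ℝ (ExteriorAlgebra ℝ F)) := by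
  by_contra hn
  obtain ⟨l, hl, hl'⟩ := Submodule.exists_le_ker_of_notMem hn
  rw [apply_dloc] at hl
  apply hl
  have : φ.coordFn l P = 0 := by
    ext z
    change φ.χ z • l (φ.loc P z) = 0
    rw [LinearMap.mem_ker.1 (hl' (φ.loc_mem hP z)), smul_zero]
  rw [this]
  exact congrArg (fun f : SmoothFn E M => f y) (map_zero (lieDₗ X))

end Frm

end Local

section Local2

variable {E : Type*} [NormedAddCommGroup E] [NormedSpace ℝ E] [FiniteDimensional ℝ E]
  {M : Type*} [TopologicalSpace M] [ChartedSpace E M] [T2Space M] [IsManifold 𝓘(ℝ, E) ∞ M]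
  {F : Type*} [NormedAddCommGroup F] [NormedSpace ℝ F] [FiniteDimensional ℝ F]
  {V : M → Type*} [TopologicalSpace (TotalSpace F V)] [∀ x, TopologicalSpace (V x)]
  [∀ x, AddCommGroup (V x)] [∀ x, Module ℝ (V x)] [FiberBundle F V] [VectorBundle ℝ F V]
  [ContMDiffVectorBundle ∞ F V 𝓘(ℝ, E)]

namespace LieAlgebroid

variable (A : LieAlgebroid E F V)

theorem bracket_swap (u v : Sec E F V) : A.bracket u v = -A.bracket v u := by
  have h := A.bracket_self (u + v)
  simp only [map_add, LinearMap.add_apply, A.bracket_self, zero_add, add_zero] at h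
  exact eq_neg_of_add_eq_zero_right h

theorem leibniz_left (u : Sec E F V) (f : SmoothFn E M) (v : Sec E F V) :
    A.bracket (f • u) v = f • A.bracket u v - lieD (A.anchor.app v) f • u := by
  rw [bracket_swap, A.leibniz, A.bracket_swap u v, smul_neg]; abel

theorem bracket_cut (u v : Sec E F V) (χ : SmoothFn E M) {x : M} (h : ∀ᶠ y in 𝓝 x, χ y = 1) :
    A.bracket (χ • u) (χ • v) x = A.bracket u v x := by
  have h0 : ∀ X : VecField E M, lieD X χ x = 0 := fun X => by
    rw [lieD_apply, dAt_congr (g := 1) h, dAt_one]; rfl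
  rw [A.leibniz, A.leibniz_left]
  simp [h0, h.self_of_nhds]

end LieAlgebroid

/-- A linear map to sections evaluated on a `C^∞`-combination. -/
theorem sec_smul_sum_apply {ι : Type*} (t : Finset ι) (f : ι → SmoothFn E M) (s : ι → Sec E F V)
    (x : M) : (∑ i ∈ t, f i • s i) x = ∑ i ∈ t, f i x • s i x := by
  rw [sec_sum_apply]; rfl

namespace Frm

variable (φ : Frm E F V) (A : LieAlgebroid E F V)

/-- The structure functions of the frame. -/
def str (y : M) (i j : Fin (finrank ℝ F)) : F :=
  φ.e.linearMapAt ℝ y (A.bracket (φ.s i) (φ.s j) y)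

theorem str_swap (y : M) (i j : Fin (finrank ℝ F)) : φ.str A y i j = -φ.str A y j i := by
  unfold str
  rw [A.bracket_swap (φ.s i)]
  simp

/-- The derivatives of `loc P` along the anchors of the frame. -/
def dl (P : ExtSec E F V) (y : M) (i : Fin (finrank ℝ F)) : ExteriorAlgebra ℝ F :=
  φ.dloc (A.anchor.app (φ.s i)) P y

/-- The local Schouten bracket. -/
def br (P Q : ExtSec E F V) (y : M) : ExteriorAlgebra ℝ F :=
  locBr (finBasis ℝ F) (φ.str A y) (φ.loc P y) (φ.dl A P y) (φ.loc Q y) (φ.dl A Q y)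

theorem smooth_loc (P : ExtSec E F V) {y : M} (hy : y ∈ φ.U) : SmoothAt E (φ.loc P) y :=
  P.2 φ.e y (φ.sub hy)

theorem smooth_dl (P : ExtSec E F V) (i : Fin (finrank ℝ F)) (y : M) :
    SmoothAt E (fun z => φ.dl A P z i) y := by
  unfold dl dloc
  exact SmoothAt.sum fun a _ => SmoothAt.smul
    (lieD (A.anchor.app (φ.s i)) (φ.coordFn _ P)).contMDiff.contMDiffAt (SmoothAt.const _)

theorem smooth_str (i j : Fin (finrank ℝ F)) {y : M} (hy : y ∈ φ.U) :
    SmoothAt E (fun z => φ.str A z i j) y :=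
  smoothAt_of_contMDiffAt ((contMDiffAt_sec_iff φ.e (φ.sub hy)).1
    (A.bracket (φ.s i) (φ.s j)).contMDiff.contMDiffAt)

theorem smooth_mul {G G' : M → ExteriorAlgebra ℝ F} {y : M} (h : SmoothAt E G y)
    (h' : SmoothAt E G' y) : SmoothAt E (fun z => G z * G' z) y :=
  h.bilin h' (LinearMap.mul ℝ _)

theorem smooth_sub {G G' : M → ExteriorAlgebra ℝ F} {y : M} (h : SmoothAt E G y)
    (h' : SmoothAt E G' y) : SmoothAt E (fun z => G z - G' z) y := by
  simpa only [sub_eq_add_neg] using! h.add (h'.linear (-LinearMap.id))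

theorem smooth_br (P Q : ExtSec E F V) {y : M} (hy : y ∈ φ.U) : SmoothAt E (φ.br A P Q) y := by
  refine smooth_sub (smooth_sub ?_ ?_) ?_
  · exact SmoothAt.sum fun j _ => smooth_mul (((φ.smooth_loc P hy).linear _).linear
      (CliffordAlgebra.involute (Q := (0 : QuadraticForm ℝ F))).toLinearMap)
      (φ.smooth_dl A Q j y)
  · exact SmoothAt.sum fun j _ => smooth_mul (φ.smooth_dl A P j y)
      ((φ.smooth_loc Q hy).linear _)
  · exact SmoothAt.sum fun i _ => SmoothAt.sum fun j _ => smooth_mul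
      ((φ.smooth_str A i j hy).linear _)
      (smooth_mul ((φ.smooth_loc P hy).linear _) ((φ.smooth_loc Q hy).linear _))

theorem br_add_left (P P' Q : ExtSec E F V) (y : M) :
    φ.br A (P + P') Q y = φ.br A P Q y + φ.br A P' Q y := by
  simp only [br, locBr, dl, loc_add, dloc_add, map_add, add_mul, mul_add, Finset.sum_add_distrib]
  abel

theorem br_add_right (P Q Q' : ExtSec E F V) (y : M) :
    φ.br A P (Q + Q') y = φ.br A P Q y + φ.br A P Q' y := by
  simp only [br, locBr, dl, loc_add, dloc_add, map_add, mul_add, Finset.sum_add_distrib]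
  abel

theorem br_smul_left (r : ℝ) (P Q : ExtSec E F V) (y : M) :
    φ.br A (r • P) Q y = r • φ.br A P Q y := by
  simp only [br, locBr, dl, loc_smul, dloc_smul, map_smul, smul_mul_assoc, mul_smul_comm,
    ← Finset.smul_sum, smul_sub]

theorem br_smul_right (r : ℝ) (P Q : ExtSec E F V) (y : M) :
    φ.br A P (r • Q) y = r • φ.br A P Q y := by
  simp only [br, locBr, dl, loc_smul, dloc_smul, map_smul, mul_smul_comm,
    ← Finset.smul_sum, smul_sub]

theorem symm_basis {y : M} (hy : y ∈ φ.U) (i : Fin (finrank ℝ F)) :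
    φ.e.symmₗ ℝ y (finBasis ℝ F i) = φ.s i y := by
  rw [← φ.frame y hy i]
  exact Trivialization.symmₗ_linearMapAt (R := ℝ) φ.e (φ.sub hy) (φ.s i y)

/-- Coordinate changes are smooth. -/
theorem smooth_change (e : Trivialization F (π F V)) [MemTrivializationAtlas e] {x : M}
    (hx : x ∈ e.baseSet) (hx' : x ∈ φ.U) :
    SmoothAt E (fun y => e.linearMapAt ℝ y ∘ₗ φ.e.symmₗ ℝ y) x := by
  let b := finBasis ℝ F
  have h1 : ∀ i, SmoothAt E (fun y => e.linearMapAt ℝ y (φ.s i y)) x := fun i =>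
    smoothAt_of_contMDiffAt ((contMDiffAt_sec_iff e hx).1 (φ.s i).contMDiff.contMDiffAt)
  refine (SmoothAt.sum (s := Finset.univ) (x := x) fun i _ => (h1 i).linear
    (LinearMap.smulRightₗ (b.coord i) : F →ₗ[ℝ] F →ₗ[ℝ] F)).congr ?_
  filter_upwards [φ.isOpen.mem_nhds hx'] with y hy
  refine b.ext fun j => ?_
  simp [b, φ.symm_basis hy, Finsupp.single_apply]

theorem smooth_map {G : M → F →ₗ[ℝ] F} {w : M → ExteriorAlgebra ℝ F} {x : M}
    (hG : SmoothAt E G x) (hw : SmoothAt E w x) :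
    SmoothAt E (fun y => ExteriorAlgebra.map (G y) (w y)) x := by
  have h : ∀ w₀ : ExteriorAlgebra ℝ F, SmoothAt E (fun y => ExteriorAlgebra.map (G y) w₀) x := by
    intro w₀
    induction w₀ using ext_induction with
    | algebraMap r => simpa using SmoothAt.const (E := E) (x := x) (algebraMap ℝ _ r)
    | add P Q h h' => simpa only [map_add] using h.add h'
    | ι_mul P v h =>
      simp only [map_mul, ExteriorAlgebra.map_apply_ι]
      exact smooth_mul ((hG.linear (LinearMap.applyₗ v)).linear _) h
  have := SmoothAt.sum (s := Finset.univ) (x := x) fun a _ => SmoothAt.smul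
    (hw ((finBasis ℝ (ExteriorAlgebra ℝ F)).coord a)) (h (finBasis ℝ (ExteriorAlgebra ℝ F) a))
  refine this.congr (Filter.Eventually.of_forall fun y => ?_)
  conv_lhs => rw [← (finBasis ℝ (ExteriorAlgebra ℝ F)).sum_repr (w y)]
  simp only [map_sum, map_smul, Basis.coord_apply]

/-- The local bracket, cut off by a function `θ` with support in `U`. -/
def wbr (θ : SmoothFn E M) (hθ : tsupport θ ⊆ φ.U) (P Q : ExtSec E F V) : ExtSec E F V :=
  ⟨fun y => θ y • ExteriorAlgebra.map (φ.e.symmₗ ℝ y) (φ.br A P Q y), fun e _ x hx => by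
    by_cases hxs : x ∈ tsupport θ
    · have hU := hθ hxs
      have := SmoothAt.smul θ.contMDiff.contMDiffAt
        (smooth_map (φ.smooth_change e hx hU) (φ.smooth_br A P Q hU))
      refine this.congr (Filter.Eventually.of_forall fun y => ?_)
      rw [map_smul, ← AlgHom.comp_apply, ExteriorAlgebra.map_comp_map]
    · refine (SmoothAt.const (0 : ExteriorAlgebra ℝ F)).congr ?_
      filter_upwards [(isClosed_tsupport θ).isOpen_compl.mem_nhds hxs] with y hy
      rw [image_eq_zero_of_notMem_tsupport hy, zero_smul, map_zero]⟩

theorem wbr_val (θ : SmoothFn E M) (hθ : tsupport θ ⊆ φ.U) (P Q : ExtSec E F V) (y : M) :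
    (φ.wbr A θ hθ P Q).1 y = θ y • ExteriorAlgebra.map (φ.e.symmₗ ℝ y) (φ.br A P Q y) := rfl

theorem add_val (P Q : ExtSec E F V) (y : M) : (P + Q).1 y = P.1 y + Q.1 y := rfl

theorem rsmul_val (r : ℝ) (P : ExtSec E F V) (y : M) : (r • P).1 y = r • P.1 y := rfl

theorem mul_val (P Q : ExtSec E F V) (y : M) : (P * Q).1 y = P.1 y * Q.1 y := rfl

/-- The cut-off local bracket as a bilinear map. -/
def wbrₗ (θ : SmoothFn E M) (hθ : tsupport θ ⊆ φ.U) :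
    ExtSec E F V →ₗ[ℝ] ExtSec E F V →ₗ[ℝ] ExtSec E F V :=
  LinearMap.mk₂ ℝ (φ.wbr A θ hθ)
    (fun P P' Q => ExtSec.val_ext (fun y => by
      rw [add_val]; simp only [wbr_val]
      rw [br_add_left, map_add, smul_add]))
    (fun r P Q => ExtSec.val_ext (fun y => by
      rw [rsmul_val]; simp only [wbr_val]
      rw [br_smul_left, map_smul, smul_comm]))
    (fun P Q Q' => ExtSec.val_ext (fun y => by
      rw [add_val]; simp only [wbr_val]
      rw [br_add_right, map_add, smul_add]))
    (fun r P Q => ExtSec.val_ext (fun y => by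
      rw [rsmul_val]; simp only [wbr_val]
      rw [br_smul_right, map_smul, smul_comm]))

theorem map_loc {y : M} (hy : y ∈ φ.U) (P : ExtSec E F V) :
    ExteriorAlgebra.map (φ.e.symmₗ ℝ y) (φ.loc P y) = P.1 y := by
  unfold loc
  rw [← AlgHom.comp_apply, ExteriorAlgebra.map_comp_map]
  have : φ.e.symmₗ ℝ y ∘ₗ φ.e.linearMapAt ℝ y = LinearMap.id := LinearMap.ext fun v =>
    Trivialization.symmₗ_linearMapAt (R := ℝ) φ.e (φ.sub hy) v
  rw [this, ExteriorAlgebra.map_id]; rfl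

theorem loc_ofFn (f : SmoothFn E M) (y : M) : φ.loc (ofFn f) y = algebraMap ℝ _ (f y) := by
  simp [loc, ofFn]

theorem loc_ofSec (u : Sec E F V) (y : M) :
    φ.loc (ofSec u) y = ExteriorAlgebra.ι ℝ (φ.e.linearMapAt ℝ y (u y)) := by
  simp [loc, ofSec]

theorem dloc_ofFn (X : VecField E M) (f : SmoothFn E M) {y : M} (hy : y ∈ φ.U) :
    φ.dloc X (ofFn f) y = algebraMap ℝ _ (lieD X f y) := by
  refine eq_of_dual fun l => ?_
  have h : ∀ z ∈ φ.U, φ.coordFn l (ofFn f) z = (l 1 • f : SmoothFn E M) z := fun z hz => by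
    rw [φ.coordFn_apply hz, loc_ofFn, Algebra.algebraMap_eq_smul_one, map_smul, fn_smul_apply,
      smul_eq_mul, mul_comm]
  rw [apply_dloc, lieD_congr X (Filter.eventually_of_mem (φ.isOpen.mem_nhds hy) h), lieD_smul,
    fn_smul_apply, Algebra.algebraMap_eq_smul_one, map_smul, smul_eq_mul, mul_comm]

theorem eq_sum {u : Sec E F V} {c : Fin (finrank ℝ F) → SmoothFn E M}
    (hc : φ.χ • u = ∑ i, c i • φ.s i) {y : M} (hy : y ∈ φ.U) : u y = ∑ i, c i y • φ.s i y := by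
  have := congrArg (fun t : Sec E F V => t y) hc
  simpa only [smul_sec_apply, φ.χ_one y hy, one_smul, sec_smul_sum_apply] using this

theorem coord_eq {u : Sec E F V} {c : Fin (finrank ℝ F) → SmoothFn E M}
    (hc : φ.χ • u = ∑ i, c i • φ.s i) {y : M} (hy : y ∈ φ.U) :
    φ.e.linearMapAt ℝ y (u y) = ∑ i, c i y • finBasis ℝ F i := by
  rw [φ.eq_sum hc hy]
  simp [φ.frame y hy]

theorem dloc_ofSec (X : VecField E M) {u : Sec E F V} {c : Fin (finrank ℝ F) → SmoothFn E M}
    (hc : φ.χ • u = ∑ i, c i • φ.s i) {y : M} (hy : y ∈ φ.U) :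
    φ.dloc X (ofSec u) y = ∑ i, lieD X (c i) y • ExteriorAlgebra.ι ℝ (finBasis ℝ F i) := by
  refine eq_of_dual fun l => ?_
  have h : ∀ z ∈ φ.U, φ.coordFn l (ofSec u) z =
      (∑ i, l (ExteriorAlgebra.ι ℝ (finBasis ℝ F i)) • c i : SmoothFn E M) z := fun z hz => by
    rw [φ.coordFn_apply hz, loc_ofSec, φ.coord_eq hc hz, fn_sum_apply]
    simp only [map_sum, map_smul, smul_eq_mul, fn_smul_apply]
    exact Finset.sum_congr rfl fun i _ => mul_comm _ _
  rw [apply_dloc, lieD_congr X (Filter.eventually_of_mem (φ.isOpen.mem_nhds hy) h), lieD_sum,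
    fn_sum_apply]
  simp only [map_sum, map_smul, smul_eq_mul, lieD_smul, fn_smul_apply]
  exact Finset.sum_congr rfl fun i _ => mul_comm _ _

theorem involute_algebraMap (r : ℝ) : CliffordAlgebra.involute (Q := (0 : QuadraticForm ℝ F))
    (algebraMap ℝ (ExteriorAlgebra ℝ F) r) = algebraMap ℝ _ r :=
  (CliffordAlgebra.involute (Q := (0 : QuadraticForm ℝ F))).commutes r

theorem br_fn_fn (f g : SmoothFn E M) (y : M) : φ.br A (ofFn f) (ofFn g) y = 0 := by
  simp [br, locBr, loc_ofFn, contr_algebraMap]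

theorem br_sec_fn (u : Sec E F V) (f : SmoothFn E M) {y : M} (hy : y ∈ φ.U) :
    φ.br A (ofSec u) (ofFn f) y = φ.loc (ofFn (lieD (A.anchor.app u) f)) y := by
  obtain ⟨c, hc⟩ := φ.span u
  have h1 := φ.coord_eq hc hy
  simp only [br, locBr, loc_ofFn, contr_algebraMap, mul_zero, Finset.sum_const_zero, sub_zero,
    loc_ofSec, contr_ι, involute_algebraMap, dl, φ.dloc_ofFn _ f hy, ← map_mul, ← map_sum]
  congr 1
  simp only [lieD_apply, HomSec.app_apply]
  conv_rhs => rw [φ.eq_sum hc hy]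
  simp [h1, Finsupp.single_apply]

theorem br_sec_sec (u v : Sec E F V) {y : M} (hy : y ∈ φ.U) :
    φ.br A (ofSec u) (ofSec v) y = φ.loc (ofSec (A.bracket u v)) y := by
  obtain ⟨c, hc⟩ := φ.span u
  obtain ⟨d, hd⟩ := φ.span v
  have h1 : ∀ i, (finBasis ℝ F).coord i (φ.e.linearMapAt ℝ y (u y)) = c i y := fun i => by
    rw [φ.coord_eq hc hy]; simp [Finsupp.single_apply]
  have h2 : ∀ i, (finBasis ℝ F).coord i (φ.e.linearMapAt ℝ y (v y)) = d i y := fun i => by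
    rw [φ.coord_eq hd hy]; simp [Finsupp.single_apply]
  have h3 : A.bracket u v y = ∑ i, ∑ j, (c i y • d j y • A.bracket (φ.s i) (φ.s j) y +
      c i y • lieD (A.anchor.app (φ.s i)) (d j) y • φ.s j y -
      d j y • lieD (A.anchor.app (φ.s j)) (c i) y • φ.s i y) := by
    rw [← A.bracket_cut u v φ.χ (Filter.eventually_of_mem (φ.isOpen.mem_nhds hy) φ.χ_one), hc, hd]
    simp only [map_sum, LinearMap.sum_apply, sec_sum_apply]
    rw [Finset.sum_comm]
    refine Finset.sum_congr rfl fun i _ => Finset.sum_congr rfl fun j _ => ?_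
    rw [A.leibniz, A.leibniz_left]
    have h4 : lieD (A.anchor.app (c i • φ.s i)) (d j) y =
        c i y * lieD (A.anchor.app (φ.s i)) (d j) y := by
      simp
    simp only [ContMDiffSection.coe_add, ContMDiffSection.coe_sub, Pi.add_apply, Pi.sub_apply,
      smul_sec_apply, h4, smul_sub, mul_smul]
    rw [smul_comm (d j y) (c i y)]
    abel
  have hr : ∀ (w : ExteriorAlgebra ℝ F) (r : ℝ), w * algebraMap ℝ _ r = r • w := fun w r => by
    rw [← Algebra.commutes, ← Algebra.smul_def]
  have hl : φ.loc (ofSec (A.bracket u v)) y =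
      ∑ i, ∑ j, (c i y • d j y • ExteriorAlgebra.ι ℝ (φ.str A y i j) +
      c i y • lieD (A.anchor.app (φ.s i)) (d j) y • ExteriorAlgebra.ι ℝ (finBasis ℝ F j) -
      d j y • lieD (A.anchor.app (φ.s j)) (c i) y • ExteriorAlgebra.ι ℝ (finBasis ℝ F i)) := by
    rw [loc_ofSec, h3]
    simp only [map_sum, map_add, map_sub, map_smul, φ.frame y hy, str]
  rw [hl]
  have ht : ∀ i j, ExteriorAlgebra.ι ℝ (φ.str A y i j) *
      (d i y • algebraMap ℝ (ExteriorAlgebra ℝ F) (c j y)) =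
      -(c j y • d i y • ExteriorAlgebra.ι ℝ (φ.str A y j i)) := fun i j => by
    rw [mul_smul_comm, hr, φ.str_swap, map_neg, smul_neg, smul_neg, smul_comm]
  simp only [br, locBr, loc_ofSec, contr_ι, involute_algebraMap, dl, φ.dloc_ofSec _ hc hy,
    φ.dloc_ofSec _ hd hy, h1, h2, ht, hr, ← Algebra.smul_def, Finset.sum_add_distrib,
    Finset.sum_sub_distrib, Finset.smul_sum, Finset.sum_neg_distrib]
  rw [Finset.sum_comm (f := fun i j => c j y • d i y • ExteriorAlgebra.ι ℝ (φ.str A y j i)),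
    Finset.sum_comm (f := fun i j => d i y • lieD (A.anchor.app (φ.s i)) (c j) y •
      ExteriorAlgebra.ι ℝ (finBasis ℝ F j))]
  abel

end Frm

end Local2

/-! ### The Schouten bracket -/

section Schouten

variable {E : Type*} [NormedAddCommGroup E] [NormedSpace ℝ E] [FiniteDimensional ℝ E]
  {M : Type*} [TopologicalSpace M] [ChartedSpace E M] [T2Space M] [IsManifold 𝓘(ℝ, E) ∞ M]
  {F : Type*} [NormedAddCommGroup F] [NormedSpace ℝ F] [FiniteDimensional ℝ F]
  {V : M → Type*} [TopologicalSpace (TotalSpace F V)] [∀ x, TopologicalSpace (V x)]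
  [∀ x, AddCommGroup (V x)] [∀ x, Module ℝ (V x)] [FiberBundle F V] [VectorBundle ℝ F V]
  [ContMDiffVectorBundle ∞ F V 𝓘(ℝ, E)]

/-- The axioms of the Schouten bracket on `Γ(∧^• A)`: a bilinear bracket of degree `-1` that
extends the Lie bracket of sections and the action of sections on functions, is graded
skew-symmetric, and is a graded derivation of the exterior product. -/
structure IsSchouten (A : LieAlgebroid E F V)
    (B : ExtSec E F V →ₗ[ℝ] ExtSec E F V →ₗ[ℝ] ExtSec E F V) : Prop where
  fn_fn : ∀ f g : SmoothFn E M, B (ofFn f) (ofFn g) = 0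
  sec_fn : ∀ (u : Sec E F V) (f : SmoothFn E M),
    B (ofSec u) (ofFn f) = ofFn (lieD (A.anchor.app u) f)
  sec_sec : ∀ u v : Sec E F V, B (ofSec u) (ofSec v) = ofSec (A.bracket u v)
  deg : ∀ p q r : ℕ, p + q = r + 1 → ∀ P ∈ extDeg E F V p, ∀ Q ∈ extDeg E F V q,
    B P Q ∈ extDeg E F V r
  swap : ∀ p q : ℕ, ∀ P ∈ extDeg E F V p, ∀ Q ∈ extDeg E F V q,
    B P Q = -(-1 : ℝ) ^ (((p : ℤ) - 1) * ((q : ℤ) - 1)) • B Q P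
  mul : ∀ p q : ℕ, ∀ P ∈ extDeg E F V p, ∀ Q ∈ extDeg E F V q, ∀ R : ExtSec E F V,
    B P (Q * R) = B P Q * R + (-1 : ℝ) ^ ((q : ℤ) * ((p : ℤ) - 1)) • (Q * B P R)

/-- The axioms of the Schouten bracket hold up to the factor `θ`. -/
structure IsSchoutenW (A : LieAlgebroid E F V) (θ : SmoothFn E M)
    (B : ExtSec E F V →ₗ[ℝ] ExtSec E F V →ₗ[ℝ] ExtSec E F V) : Prop where
  supp : ∀ P Q x, θ x = 0 → (B P Q).1 x = 0
  fn_fn : ∀ f g : SmoothFn E M, B (ofFn f) (ofFn g) = 0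
  sec_fn : ∀ (u : Sec E F V) (f : SmoothFn E M) (x : M),
    (B (ofSec u) (ofFn f)).1 x = θ x • (ofFn (F := F) (V := V) (lieD (A.anchor.app u) f)).1 x
  sec_sec : ∀ (u v : Sec E F V) (x : M),
    (B (ofSec u) (ofSec v)).1 x = θ x • (ofSec (A.bracket u v)).1 x
  deg : ∀ p q r : ℕ, p + q = r + 1 → ∀ P ∈ extDeg E F V p, ∀ Q ∈ extDeg E F V q,
    B P Q ∈ extDeg E F V r
  swap : ∀ p q : ℕ, ∀ P ∈ extDeg E F V p, ∀ Q ∈ extDeg E F V q,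
    B P Q = -(-1 : ℝ) ^ (((p : ℤ) - 1) * ((q : ℤ) - 1)) • B Q P
  mul : ∀ p q : ℕ, ∀ P ∈ extDeg E F V p, ∀ Q ∈ extDeg E F V q, ∀ R : ExtSec E F V,
    B P (Q * R) = B P Q * R + (-1 : ℝ) ^ ((q : ℤ) * ((p : ℤ) - 1)) • (Q * B P R)

theorem Frm.wbr_schouten (φ : Frm E F V) (A : LieAlgebroid E F V) (θ : SmoothFn E M)
    (hθ : tsupport θ ⊆ φ.U) : IsSchoutenW A θ (φ.wbrₗ A θ hθ) := by
  have hv : ∀ P Q y, (φ.wbrₗ A θ hθ P Q).1 y =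
    θ y • ExteriorAlgebra.map (φ.e.symmₗ ℝ y) (φ.br A P Q y) := fun P Q y => rfl
  have h0 : ∀ y, θ y = 0 ∨ y ∈ φ.U := fun y => by
    by_cases h : θ y = 0
    · exact Or.inl h
    · exact Or.inr (hθ (subset_tsupport _ h))
  refine ⟨fun P Q x hx => ?_, fun f g => ExtSec.val_ext (fun y => ?_), fun u f y => ?_,
    fun u v y => ?_, fun p q r h P hP Q hQ y => ?_, fun p q P hP Q hQ => ?_,
    fun p q P hP Q hQ R => ?_⟩
  · rw [hv, hx, zero_smul]
  · rw [hv, φ.br_fn_fn, map_zero, smul_zero]; rfl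
  · rcases h0 y with h | hy
    · rw [hv, h, zero_smul, zero_smul]
    · rw [hv, φ.br_sec_fn A u f hy, φ.map_loc hy]
  · rcases h0 y with h | hy
    · rw [hv, h, zero_smul, zero_smul]
    · rw [hv, φ.br_sec_sec A u v hy, φ.map_loc hy]
  · rw [hv]
    exact Submodule.smul_mem _ _ (Frm.map_mem _ (locBr_deg _ _ h (φ.loc_mem hP y)
      (φ.loc_mem hQ y) (fun i => φ.dloc_mem _ hP y) (fun i => φ.dloc_mem _ hQ y)))
  · refine ExtSec.val_ext (fun y => ?_)
    rw [Frm.rsmul_val, hv, hv]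
    have : φ.br A P Q y = _ := locBr_swap _ _ (φ.str_swap A y) (φ.loc_mem hP y)
      (φ.loc_mem hQ y) (fun i => φ.dloc_mem _ hP y) (fun i => φ.dloc_mem _ hQ y)
    rw [this, map_smul, smul_comm]; rfl
  · refine ExtSec.val_ext (fun y => ?_)
    rw [Frm.add_val, Frm.rsmul_val, Frm.mul_val, Frm.mul_val, hv, hv, hv]
    rcases h0 y with h | hy
    · simp [h]
    · have : φ.br A P (Q * R) y = φ.br A P Q y * φ.loc R y +
          (-1 : ℝ) ^ ((q : ℤ) * ((p : ℤ) - 1)) • (φ.loc Q y * φ.br A P R y) := by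
        have h1 : φ.dl A (Q * R) y = fun i => φ.dl A Q y i * φ.loc R y + φ.loc Q y * φ.dl A R y i :=
          funext fun i => φ.dloc_mul _ Q R hy
        unfold Frm.br
        rw [φ.loc_mul, h1]
        exact locBr_mul _ _ _ _ (φ.loc_mem hP y) (φ.loc_mem hQ y) (fun i => φ.dloc_mem _ hP y)
      rw [this, map_add, map_smul, map_mul, map_mul, φ.map_loc hy, φ.map_loc hy, smul_add,
        smul_mul_assoc, mul_smul_comm, smul_comm (θ y)]

theorem exists_schouten [SigmaCompactSpace M] (A : LieAlgebroid E F V) :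
    ∃ B, IsSchouten A B := by
  choose φ hφ using fun x : M => exists_frm (E := E) (F := F) (V := V) x
  obtain ⟨θ, hθ⟩ := SmoothPartitionOfUnity.exists_isSubordinate 𝓘(ℝ, E) (s := Set.univ)
    isClosed_univ (fun x : M => (φ x).U) (fun x => (φ x).isOpen)
    (fun x _ => Set.mem_iUnion.2 ⟨x, hφ x⟩)
  let B : M → ExtSec E F V →ₗ[ℝ] ExtSec E F V →ₗ[ℝ] ExtSec E F V := fun i =>
    (φ i).wbrₗ A (θ i) (hθ i)
  have hB : ∀ i, IsSchoutenW A (θ i) (B i) := fun i => (φ i).wbr_schouten A (θ i) (hθ i)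
  have key : ∀ x : M, ∃ I : Finset M, ∀ᶠ y in 𝓝 x, ∀ i ∉ I, θ i y = 0 := fun x => by
    refine ⟨θ.fintsupport x, ?_⟩
    filter_upwards [θ.eventually_finsupport_subset x] with y hy i hi
    by_contra h
    exact hi (hy (θ.mem_finsupport y |>.2 h))
  have hsum : ∀ (P Q : ExtSec E F V) (I : Finset M) (y : M), (∀ i ∉ I, θ i y = 0) →
      ∑ᶠ i, (B i P Q).1 y = ∑ i ∈ I, (B i P Q).1 y := fun P Q I y h => by
    refine finsum_eq_sum_of_support_subset _ fun i hi => ?_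
    by_contra hn
    exact hi ((hB i).supp P Q y (h i hn))
  let G : ExtSec E F V → ExtSec E F V → ExtSec E F V := fun P Q =>
    ⟨fun y => ∑ᶠ i, (B i P Q).1 y, fun e _ x hx => by
      obtain ⟨I, hI⟩ := key x
      refine (SmoothAt.sum (s := I) fun i _ => (B i P Q).2 e x hx).congr ?_
      filter_upwards [hI] with y hy
      rw [hsum P Q I y hy, map_sum]⟩
  have hG : ∀ y, ∃ I : Finset M, (∑ i ∈ I, θ i y = 1) ∧
      ∀ P Q, (G P Q).1 y = ∑ i ∈ I, (B i P Q).1 y := fun y => by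
    obtain ⟨I, hI⟩ := key y
    refine ⟨I, ?_, fun P Q => hsum P Q I y hI.self_of_nhds⟩
    rw [← θ.sum_eq_one (Set.mem_univ y)]
    refine (finsum_eq_sum_of_support_subset _ fun i hi => ?_).symm
    by_contra hn
    exact hi (hI.self_of_nhds i hn)
  let BB : ExtSec E F V →ₗ[ℝ] ExtSec E F V →ₗ[ℝ] ExtSec E F V := LinearMap.mk₂ ℝ G
    (fun P P' Q => ExtSec.val_ext (fun y => by
      obtain ⟨I, -, h⟩ := hG y
      rw [Frm.add_val, h, h, h, ← Finset.sum_add_distrib]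
      simp only [map_add, LinearMap.add_apply, Frm.add_val]))
    (fun r P Q => ExtSec.val_ext (fun y => by
      obtain ⟨I, -, h⟩ := hG y
      rw [Frm.rsmul_val, h, h, Finset.smul_sum]
      simp only [map_smul, LinearMap.smul_apply, Frm.rsmul_val]))
    (fun P P' Q => ExtSec.val_ext (fun y => by
      obtain ⟨I, -, h⟩ := hG y
      rw [Frm.add_val, h, h, h, ← Finset.sum_add_distrib]
      simp only [map_add, Frm.add_val]))
    (fun r P Q => ExtSec.val_ext (fun y => by
      obtain ⟨I, -, h⟩ := hG y
      rw [Frm.rsmul_val, h, h, Finset.smul_sum]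
      simp only [map_smul, Frm.rsmul_val]))
  have hBB : ∀ P Q : ExtSec E F V, BB P Q = G P Q := fun P Q => rfl
  refine ⟨BB, fun f g => ?_, fun u f => ?_, fun u v => ?_, fun p q r hpq P hP Q hQ y => ?_,
    fun p q P hP Q hQ => ?_, fun p q P hP Q hQ R => ?_⟩
  · refine ExtSec.val_ext (fun y => ?_)
    obtain ⟨I, -, h⟩ := hG y
    rw [hBB, h]
    exact Finset.sum_eq_zero fun i _ => by rw [(hB i).fn_fn]; rfl
  · refine ExtSec.val_ext (fun y => ?_)
    obtain ⟨I, h1, h⟩ := hG y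
    rw [hBB, h, Finset.sum_congr rfl fun i _ => (hB i).sec_fn u f y, ← Finset.sum_smul, h1,
      one_smul]
  · refine ExtSec.val_ext (fun y => ?_)
    obtain ⟨I, h1, h⟩ := hG y
    rw [hBB, h, Finset.sum_congr rfl fun i _ => (hB i).sec_sec u v y, ← Finset.sum_smul, h1,
      one_smul]
  · obtain ⟨I, h1, h⟩ := hG y
    rw [hBB, h]
    exact Submodule.sum_mem _ fun i _ => (hB i).deg p q r hpq P hP Q hQ y
  · refine ExtSec.val_ext (fun y => ?_)
    obtain ⟨I, h1, h⟩ := hG y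
    rw [hBB, hBB, Frm.rsmul_val, h, h, Finset.smul_sum]
    exact Finset.sum_congr rfl fun i _ => by
      rw [(hB i).swap p q P hP Q hQ, Frm.rsmul_val]
  · refine ExtSec.val_ext (fun y => ?_)
    obtain ⟨I, h1, h⟩ := hG y
    rw [hBB, hBB, hBB, Frm.add_val, Frm.rsmul_val, Frm.mul_val, Frm.mul_val, h, h, h,
      Finset.sum_mul, Finset.mul_sum, Finset.smul_sum, ← Finset.sum_add_distrib]
    exact Finset.sum_congr rfl fun i _ => by
      rw [(hB i).mul p q P hP Q hQ R, Frm.add_val, Frm.rsmul_val, Frm.mul_val, Frm.mul_val]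

/-- The Schouten bracket on `Γ(∧^• A)`. -/
def schouten [SigmaCompactSpace M] (A : LieAlgebroid E F V) :
    ExtSec E F V →ₗ[ℝ] ExtSec E F V →ₗ[ℝ] ExtSec E F V :=
  (exists_schouten A).choose

theorem schouten_spec [SigmaCompactSpace M] (A : LieAlgebroid E F V) :
    IsSchouten A (schouten A) :=
  (exists_schouten A).choose_spec

end Schouten

/-! ### Cohomology in degree one -/

section Cohomology

variable {R : Type*} [CommRing R] [Algebra ℝ R]
  {B : Type*} [AddCommGroup B] [Module R B]
  {N : Type*} [AddCommGroup N] [Module ℝ N] [Module R N] [IsScalarTower ℝ R N]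

/-- The quotient of a space `S` by those of its elements which lie in `T`. -/
def SubQuot {X : Type*} [AddCommGroup X] [Module ℝ X] (S T : Submodule ℝ X) : Type _ :=
  ↥S ⧸ T.comap S.subtype

section SubQuot

variable {X : Type*} [AddCommGroup X] [Module ℝ X] (S T : Submodule ℝ X)

instance : AddCommGroup (SubQuot S T) :=
  inferInstanceAs (AddCommGroup (↥S ⧸ T.comap S.subtype))

instance : Module ℝ (SubQuot S T) :=
  inferInstanceAs (Module ℝ (↥S ⧸ T.comap S.subtype))

/-- The class of an element. -/
def SubQuot.mk : ↥S →ₗ[ℝ] SubQuot S T := (T.comap S.subtype).mkQ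

end SubQuot

/-- The space of `1`-cocycles of a Lie algebroid, with values in a module. Here `B` is the space of
sections of the Lie algebroid, `br` is its bracket, `N` is the space of sections of the module, and
`nab b` is the action of `b` on `N`. -/
def cocycles (R : Type*) [CommRing R] [Algebra ℝ R]
    {B : Type*} [AddCommGroup B] [Module R B]
    {N : Type*} [AddCommGroup N] [Module ℝ N] [Module R N] [IsScalarTower ℝ R N]
    (br : B → B → B) (nab : B → N →ₗ[ℝ] N) : Submodule ℝ (B →ₗ[R] N) where
  carrier := {l | ∀ a b, l (br a b) = nab a (l b) - nab b (l a)}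
  add_mem' {l l'} h h' a b := by
    simp only [LinearMap.add_apply, h a b, h' a b, map_add]; abel
  zero_mem' a b := by simp
  smul_mem' r l h a b := by
    simp only [LinearMap.smul_apply, h a b, map_smul, smul_sub]

/-- The space of `1`-coboundaries `b ↦ nab b n`. -/
def coboundaries (R : Type*) [CommRing R] [Algebra ℝ R]
    {B : Type*} [AddCommGroup B] [Module R B]
    {N : Type*} [AddCommGroup N] [Module ℝ N] [Module R N] [IsScalarTower ℝ R N]
    (nab : B → N →ₗ[ℝ] N) : Submodule ℝ (B →ₗ[R] N) where
  carrier := {l | ∃ n, ∀ b, l b = nab b n}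
  add_mem' := by
    rintro l l' ⟨n, h⟩ ⟨n', h'⟩
    exact ⟨n + n', fun b => by rw [LinearMap.add_apply, h, h', map_add]⟩
  zero_mem' := ⟨0, fun b => by simp⟩
  smul_mem' := by
    rintro r l ⟨n, h⟩
    exact ⟨r • n, fun b => by rw [LinearMap.smul_apply, h, map_smul]⟩

/-- The pull-back of cohomology classes along a morphism `i`. -/
def pullback {B' : Type*} [AddCommGroup B'] [Module R B']
    {br : B → B → B} {nab : B → N →ₗ[ℝ] N} {br' : B' → B' → B'} {nab' : B' → N →ₗ[ℝ] N}
    (i : B' →ₗ[R] B) (hbr : ∀ a b, i (br' a b) = br (i a) (i b))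
    (hnab : ∀ a n, nab' a n = nab (i a) n) :
    SubQuot (cocycles R br nab) (coboundaries R nab) →ₗ[ℝ]
      SubQuot (cocycles R br' nab') (coboundaries R nab') :=
  Submodule.mapQ _ _
    { toFun := fun l => ⟨l.1 ∘ₗ i, fun a b => by
        simp only [LinearMap.comp_apply, hbr, hnab]; exact l.2 _ _⟩
      map_add' := fun l l' => rfl
      map_smul' := fun r l => rfl }
    (by
      rintro l ⟨n, hn⟩
      exact ⟨n, fun b => (hn (i b)).trans (hnab b n).symm⟩)

end Cohomology

/-! ### The jet Lie algebroid and its isotropy -/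

section Jet

variable {E : Type*} [NormedAddCommGroup E] [NormedSpace ℝ E] [FiniteDimensional ℝ E]
  {M : Type*} [TopologicalSpace M] [ChartedSpace E M] [T2Space M] [IsManifold 𝓘(ℝ, E) ∞ M]
  {F : Type*} [NormedAddCommGroup F] [NormedSpace ℝ F] [FiniteDimensional ℝ F]
  {V : M → Type*} [TopologicalSpace (TotalSpace F V)] [∀ x, TopologicalSpace (V x)]
  [∀ x, AddCommGroup (V x)] [∀ x, Module ℝ (V x)] [FiberBundle F V] [VectorBundle ℝ F V]
  [ContMDiffVectorBundle ∞ F V 𝓘(ℝ, E)]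

/-- The section `df ⊗ u` of `T^*M ⊗ A`. -/
def dTensor (f : SmoothFn E M) (u : Sec E F V) : TA E F V :=
  ⟨fun x => (dAt f x).smulRight (u x), fun X => (lieD X f • u).contMDiff⟩

/-- The space `Γ(𝔍A)` of sections of the first jet bundle of `A`, in its canonical decomposition
`Γ(𝔍A) = j¹Γ(A) ⊕ Γ(T^*M ⊗ A)` as a real vector space: the pair `(u, H)` stands for `j¹u + H`. -/
def JetSec (E : Type*) [NormedAddCommGroup E] [NormedSpace ℝ E]
    {M : Type*} [TopologicalSpace M] [ChartedSpace E M] [IsManifold 𝓘(ℝ, E) ∞ M]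
    (F : Type*) [NormedAddCommGroup F] [NormedSpace ℝ F]
    (V : M → Type*) [TopologicalSpace (TotalSpace F V)] [∀ x, TopologicalSpace (V x)]
    [∀ x, AddCommGroup (V x)] [∀ x, Module ℝ (V x)] [FiberBundle F V] [VectorBundle ℝ F V] :=
  Sec E F V × TA E F V

namespace JetSec

instance : AddCommGroup (JetSec E F V) := inferInstanceAs (AddCommGroup (Sec E F V × TA E F V))

instance : Module ℝ (JetSec E F V) := inferInstanceAs (Module ℝ (Sec E F V × TA E F V))

/-- The `C^∞(M)`-module structure, determined by `j¹(fu) = f j¹u + df ⊗ u`. -/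
instance : SMul (SmoothFn E M) (JetSec E F V) :=
  ⟨fun f a => (f • a.1, f • a.2 - dTensor f a.1)⟩

theorem smul_def (f : SmoothFn E M) (a : JetSec E F V) :
    f • a = (f • a.1, f • a.2 - dTensor f a.1) := rfl

theorem hom_ext {T T' : TA E F V} (h : ∀ x v, T.1 x v = T'.1 x v) : T = T' :=
  Subtype.ext (funext fun x => LinearMap.ext (h x))

theorem hom_smul_val (f : SmoothFn E M) (T : TA E F V) (x : M) (v : TangentSpace 𝓘(ℝ, E) x) :
    (f • T).1 x v = f x • T.1 x v := rfl

theorem hom_sub_val (T T' : TA E F V) (x : M) (v : TangentSpace 𝓘(ℝ, E) x) :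
    (T - T').1 x v = T.1 x v - T'.1 x v := rfl

theorem hom_add_val (T T' : TA E F V) (x : M) (v : TangentSpace 𝓘(ℝ, E) x) :
    (T + T').1 x v = T.1 x v + T'.1 x v := rfl

theorem hom_zero_val (x : M) (v : TangentSpace 𝓘(ℝ, E) x) : (0 : TA E F V).1 x v = 0 := rfl

theorem dTensor_val (f : SmoothFn E M) (u : Sec E F V) (x : M) (v : TangentSpace 𝓘(ℝ, E) x) :
    (dTensor f u).1 x v = dAt f x v • u x := rfl

instance : Module (SmoothFn E M) (JetSec E F V) where
  one_smul a := Prod.ext (one_smul _ _) (hom_ext fun x v => by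
    rw [smul_def, hom_sub_val, hom_smul_val, dTensor_val, dAt_one]
    simp)
  mul_smul f g a := Prod.ext (mul_smul _ _ _) (hom_ext fun x v => by
    change (f x * g x) • a.2.1 x v - dAt (f * g) x v • a.1 x =
      f x • (g x • a.2.1 x v - dAt g x v • a.1 x) - dAt f x v • (g x • a.1 x)
    rw [dAt_mul]
    simp only [LinearMap.add_apply, LinearMap.smul_apply, smul_sub, mul_smul,
      add_smul, smul_eq_mul]
    rw [smul_comm (g x)]
    abel)
  smul_zero f := Prod.ext (smul_zero _) (hom_ext fun x v => by
    simp only [smul_def, hom_sub_val, hom_smul_val, dTensor_val]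
    change f x • (0 : V x) - dAt f x v • (0 : V x) = 0
    simp)
  smul_add f a b := Prod.ext (smul_add _ _ _) (hom_ext fun x v => by
    change f x • (a.2.1 x v + b.2.1 x v) - dAt f x v • (a.1 x + b.1 x) =
      (f x • a.2.1 x v - dAt f x v • a.1 x) + (f x • b.2.1 x v - dAt f x v • b.1 x)
    rw [smul_add, smul_add]; abel)
  add_smul f g a := Prod.ext (add_smul _ _ _) (hom_ext fun x v => by
    change (f x + g x) • a.2.1 x v - dAt (f + g) x v • a.1 x =
      (f x • a.2.1 x v - dAt f x v • a.1 x) + (g x • a.2.1 x v - dAt g x v • a.1 x)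
    rw [dAt_add, LinearMap.add_apply, add_smul, add_smul]; abel)
  zero_smul a := Prod.ext (zero_smul _ _) (hom_ext fun x v => by
    change (0 : ℝ) • a.2.1 x v - dAt 0 x v • a.1 x = 0
    have : dAt (0 : SmoothFn E M) x = 0 := by
      have h := dAt_add (0 : SmoothFn E M) 0 x
      rw [add_zero] at h
      exact left_eq_add.1 h
    rw [this]; simp)

/-- The jet prolongation `j¹ : Γ(A) → Γ(𝔍A)`. -/
def j1 (u : Sec E F V) : JetSec E F V := (u, 0)

/-- The inclusion `i : 𝔥 = Hom(TM, A) → 𝔍A`. -/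
def incl : TA E F V →ₗ[SmoothFn E M] JetSec E F V where
  toFun H := (0, H)
  map_add' H K := Prod.ext (add_zero _).symm rfl
  map_smul' f H := Prod.ext (smul_zero _).symm (hom_ext fun x v => by
    change f x • H.1 x v = f x • H.1 x v - dAt f x v • (0 : V x)
    rw [smul_zero, sub_zero])

theorem eq_j1_add_incl (a : JetSec E F V) : a = j1 a.1 + incl a.2 :=
  Prod.ext (add_zero _).symm (zero_add _).symm

theorem j1_smul (f : SmoothFn E M) (u : Sec E F V) :
    j1 (f • u) = f • j1 u + incl (dTensor f u) :=
  Prod.ext (add_zero _).symm (hom_ext fun x v => by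
    change (0 : V x) = (f x • (0 : V x) - dAt f x v • u x) + dAt f x v • u x
    simp)

end JetSec

theorem homSec_ext {F' : Type*} [NormedAddCommGroup F'] [NormedSpace ℝ F']
    {V' : M → Type*} [TopologicalSpace (TotalSpace F' V')] [∀ x, TopologicalSpace (V' x)]
    [∀ x, AddCommGroup (V' x)] [∀ x, Module ℝ (V' x)] [FiberBundle F' V'] [VectorBundle ℝ F' V']
    {T T' : HomSec E F V F' V'} (h : ∀ s, T.app s = T'.app s) : T = T' := by
  refine Subtype.ext (funext fun x => LinearMap.ext fun v => ?_)
  obtain ⟨φ, hφ⟩ := exists_frm (E := E) (F := F) (V := V) x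
  have hv : v = ∑ i, (finBasis ℝ F).coord i (φ.e.linearMapAt ℝ x v) • φ.s i x := by
    conv_lhs => rw [← Trivialization.symmₗ_linearMapAt (R := ℝ) φ.e (φ.sub hφ) v,
      ← (finBasis ℝ F).sum_repr (φ.e.linearMapAt ℝ x v)]
    simp only [map_sum, map_smul, φ.symm_basis hφ, Basis.coord_apply]
  rw [hv]
  simp only [map_sum, map_smul]
  refine Finset.sum_congr rfl fun i _ => ?_
  congr 1
  exact congrArg (fun s : Sec E F' V' => s x) (h (φ.s i))

variable (A : LieAlgebroid E F V)

/-- The composition `H ∘ ρ ∘ K` of sections of `Hom(TM, A)` through the anchor. -/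
def anchorComp (H K : TA E F V) : TA E F V :=
  ⟨fun x => H.1 x ∘ₗ A.anchor.1 x ∘ₗ K.1 x, fun X => (H.app (A.anchor.app (K.app X))).contMDiff⟩

/-- The endomorphism `H ∘ ρ` of `A`. -/
def compAnchor (H : TA E F V) : HomSec E F V F V :=
  ⟨fun x => H.1 x ∘ₗ A.anchor.1 x, fun u => (H.app (A.anchor.app u)).contMDiff⟩

/-- The Lie bracket of the bundle of isotropy jet Lie algebras `𝔥 = Hom(TM, A)`:
`[H, K] = K ∘ ρ ∘ H - H ∘ ρ ∘ K`. -/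
def isoBracket (H K : TA E F V) : TA E F V := anchorComp A K H - anchorComp A H K

/-- The Lie bracket of the jet Lie algebroid `𝔍A`: it satisfies `[j¹u, j¹v] = j¹[u, v]` and
`[j¹u, K] = L_u K`, and restricts to the bracket of `𝔥`. -/
def jetBracket (a b : JetSec E F V) : JetSec E F V :=
  (A.bracket a.1 b.1, lieHom A a.1 b.2 - lieHom A b.1 a.2 + isoBracket A a.2 b.2)

theorem lieHom_zero (K : TA E F V) : lieHom A 0 K = 0 := by
  refine homSec_ext fun X => ?_
  rw [lieHom_app]
  have h1 : A.anchor.app 0 = 0 := by ext x; simp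
  have h2 : vfBracket (0 : VecField E M) X = 0 := by
    ext x
    exact congrFun (VectorField.mlieBracket_zero_left) x
  rw [map_zero, h1, h2]
  ext x
  simp

theorem incl_bracket (H K : TA E F V) :
    JetSec.incl (isoBracket A H K) = jetBracket A (JetSec.incl H) (JetSec.incl K) := by
  refine Prod.ext ?_ ?_
  · change 0 = A.bracket 0 0
    simp
  · change _ = lieHom A 0 K - lieHom A 0 H + isoBracket A H K
    rw [lieHom_zero, lieHom_zero, sub_zero, zero_add]; rfl

theorem ofSec_zero : ofSec (0 : Sec E F V) = 0 := ExtSec.val_ext (fun x => by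
  change ExteriorAlgebra.ι ℝ (0 : V x) = 0
  exact map_zero _)

variable [SigmaCompactSpace M]

/-- The adjoint action of `𝔍A` on multivector sections: `j¹u` acts by the Schouten bracket with
`u`, and `H ∈ Γ(𝔥)` acts by the derivation that extends `-H ∘ ρ : A → A`. -/
def adAux (a : JetSec E F V) : ExtSec E F V →ₗ[ℝ] ExtSec E F V :=
  schouten A (ofSec a.1) - homDeriv (compAnchor A a.2)

theorem homDeriv_mem (T : HomSec E F V F V) (k : ℕ) {w : ExtSec E F V} (hw : w ∈ extDeg E F V k) :
    homDeriv T w ∈ extDeg E F V k := fun x => derivExt_mem _ k (hw x)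

theorem adAux_mem (k : ℕ) (a : JetSec E F V) {w : ExtSec E F V} (hw : w ∈ extDeg E F V k) :
    adAux A a w ∈ extDeg E F V k :=
  Submodule.sub_mem _ ((schouten_spec A).deg 1 k k (add_comm _ _) _ (fun x => ι_mem_one _) _ hw)
    (homDeriv_mem _ k hw)

/-- The adjoint action of `𝔍A` on `∧^k A`. -/
def jetAd (k : ℕ) (a : JetSec E F V) : extDeg E F V k →ₗ[ℝ] extDeg E F V k where
  toFun w := ⟨adAux A a w.1, adAux_mem A k a w.2⟩
  map_add' w w' := Subtype.ext (map_add (adAux A a) w.1 w'.1)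
  map_smul' r w := Subtype.ext ((adAux A a).map_smul r w.1)

/-- The adjoint action of `𝔥` on `∧^k A`: `H` acts by the derivation that extends `-H ∘ ρ`. -/
def isoAd (k : ℕ) (H : TA E F V) : extDeg E F V k →ₗ[ℝ] extDeg E F V k where
  toFun w := ⟨-homDeriv (compAnchor A H) w.1, Submodule.neg_mem _ (homDeriv_mem _ k w.2)⟩
  map_add' w w' := Subtype.ext (by
    change -homDeriv (compAnchor A H) (w.1 + w'.1) = _
    rw [map_add, neg_add]; rfl)
  map_smul' r w := Subtype.ext (by
    change -homDeriv (compAnchor A H) (r • w.1) = _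
    rw [map_smul, ← smul_neg]; rfl)

/-- The `1`-cocycles `Z^1(𝔍A, ∧^k A)`. -/
abbrev Z1Jet (k : ℕ) : Submodule ℝ (JetSec E F V →ₗ[SmoothFn E M] extDeg E F V k) :=
  cocycles (SmoothFn E M) (N := ↥(extDeg E F V k)) (jetBracket A) (jetAd A k)

/-- The `1`-coboundaries `B^1(𝔍A, ∧^k A)`. -/
abbrev B1Jet (k : ℕ) : Submodule ℝ (JetSec E F V →ₗ[SmoothFn E M] extDeg E F V k) :=
  coboundaries (SmoothFn E M) (N := ↥(extDeg E F V k)) (jetAd A k)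

/-- The `1`-cocycles `Z^1(𝔥, ∧^k A)`. -/
abbrev Z1Iso (k : ℕ) : Submodule ℝ (TA E F V →ₗ[SmoothFn E M] extDeg E F V k) :=
  cocycles (SmoothFn E M) (N := ↥(extDeg E F V k)) (isoBracket A) (isoAd A k)

/-- The `1`-coboundaries `B^1(𝔥, ∧^k A)`. -/
abbrev B1Iso (k : ℕ) : Submodule ℝ (TA E F V →ₗ[SmoothFn E M] extDeg E F V k) :=
  coboundaries (SmoothFn E M) (N := ↥(extDeg E F V k)) (isoAd A k)

/-- The first cohomology `H^1(𝔍A, ∧^k A)`. -/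
abbrev H1Jet (k : ℕ) : Type _ :=
  SubQuot (X := JetSec E F V →ₗ[SmoothFn E M] extDeg E F V k) (Z1Jet A k) (B1Jet A k)

/-- The first cohomology `H^1(𝔥, ∧^k A)`. -/
abbrev H1Iso (k : ℕ) : Type _ :=
  SubQuot (X := TA E F V →ₗ[SmoothFn E M] extDeg E F V k) (Z1Iso A k) (B1Iso A k)

/-- The restriction map `i^* : H^1(𝔍A, ∧^k A) → H^1(𝔥, ∧^k A)`. -/
def istar (k : ℕ) : H1Jet A k →ₗ[ℝ] H1Iso A k :=
  pullback JetSec.incl (incl_bracket A) fun H w => Subtype.ext (by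
    change -homDeriv (compAnchor A H) w.1 =
      schouten A (ofSec 0) w.1 - homDeriv (compAnchor A H) w.1
    rw [ofSec_zero, map_zero, LinearMap.zero_apply, zero_sub])

end Jet

/-! ### Tensors with values in `TM ⊗ ∧^• A`, at a point -/

section TensorAlg

variable {U W : Type*} [AddCommGroup U] [Module ℝ U] [AddCommGroup W] [Module ℝ W]

/-- The contraction `ι_ξ : U ⊗ ∧^• W → ∧^• W` of a covector with the first factor. -/
def contrL (ξ : Dual ℝ U) : U ⊗[ℝ] ExteriorAlgebra ℝ W →ₗ[ℝ] ExteriorAlgebra ℝ W :=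
  (TensorProduct.lid ℝ (ExteriorAlgebra ℝ W)).toLinearMap ∘ₗ
    LinearMap.rTensor (ExteriorAlgebra ℝ W) ξ

theorem contrL_tmul (ξ : Dual ℝ U) (X : U) (P : ExteriorAlgebra ℝ W) :
    contrL ξ (X ⊗ₜ[ℝ] P) = ξ X • P := by
  simp [contrL]

variable (U W) in
/-- The subspace `U ⊗ ∧^m W` of `U ⊗ ∧^• W`. -/
def tensorDeg (m : ℕ) : Submodule ℝ (U ⊗[ℝ] ExteriorAlgebra ℝ W) :=
  LinearMap.range (LinearMap.lTensor U (⋀[ℝ]^m W : Submodule ℝ (ExteriorAlgebra ℝ W)).subtype)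

/-- The map `H ⊗ id : U ⊗ ∧^• W → ∧^• W`, `X ⊗ P ↦ H(X) ∧ P`. -/
def applyFirst (H : U →ₗ[ℝ] W) : U ⊗[ℝ] ExteriorAlgebra ℝ W →ₗ[ℝ] ExteriorAlgebra ℝ W :=
  TensorProduct.lift (LinearMap.mul ℝ (ExteriorAlgebra ℝ W) ∘ₗ ExteriorAlgebra.ι ℝ ∘ₗ H)

theorem applyFirst_tmul (H : U →ₗ[ℝ] W) (X : U) (P : ExteriorAlgebra ℝ W) :
    applyFirst H (X ⊗ₜ[ℝ] P) = ExteriorAlgebra.ι ℝ (H X) * P := by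
  simp [applyFirst]

theorem lTensor_mulLeft_add (a b : W) (t : U ⊗[ℝ] ExteriorAlgebra ℝ W) :
    LinearMap.lTensor U (LinearMap.mulLeft ℝ (ExteriorAlgebra.ι ℝ a + ExteriorAlgebra.ι ℝ b)) t =
      LinearMap.lTensor U (LinearMap.mulLeft ℝ (ExteriorAlgebra.ι ℝ a)) t +
      LinearMap.lTensor U (LinearMap.mulLeft ℝ (ExteriorAlgebra.ι ℝ b)) t := by
  have : LinearMap.mulLeft ℝ (ExteriorAlgebra.ι ℝ a + ExteriorAlgebra.ι ℝ b) =
    LinearMap.mulLeft ℝ (ExteriorAlgebra.ι ℝ a) + LinearMap.mulLeft ℝ (ExteriorAlgebra.ι ℝ b) :=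
    LinearMap.ext fun x => add_mul _ _ x
  rw [this, LinearMap.lTensor_add, LinearMap.add_apply]

theorem lTensor_mulLeft_smul (c : ℝ) (a : W) (t : U ⊗[ℝ] ExteriorAlgebra ℝ W) :
    LinearMap.lTensor U (LinearMap.mulLeft ℝ (c • ExteriorAlgebra.ι ℝ a)) t =
      c • LinearMap.lTensor U (LinearMap.mulLeft ℝ (ExteriorAlgebra.ι ℝ a)) t := by
  have : LinearMap.mulLeft ℝ (c • ExteriorAlgebra.ι ℝ a) =
    c • LinearMap.mulLeft ℝ (ExteriorAlgebra.ι ℝ a) :=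
    LinearMap.ext fun x => smul_mul_assoc c _ x
  rw [this, LinearMap.lTensor_smul, LinearMap.smul_apply]

/-- The operator `D_r : ∧^• W → U ⊗ ∧^• W` attached to a linear map `r : W → U`, that is, the
restriction to `∧^• W` of the derivation of `∧^• (U ⊕ W)` which extends `(X, w) ↦ (r w, 0)`
(with `X ∧ P ∈ ∧^• (U ⊕ W)` written as `X ⊗ P`). It is characterized by `opD_one` and
`opD_ι_mul`. -/
def opD (r : W →ₗ[ℝ] U) : ExteriorAlgebra ℝ W →ₗ[ℝ] U ⊗[ℝ] ExteriorAlgebra ℝ W :=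
  CliffordAlgebra.foldr' (0 : QuadraticForm ℝ W)
    (LinearMap.mk₂ ℝ
      (fun (w : W) (p : ExteriorAlgebra ℝ W × U ⊗[ℝ] ExteriorAlgebra ℝ W) =>
        r w ⊗ₜ[ℝ] p.1 -
          LinearMap.lTensor U (LinearMap.mulLeft ℝ (ExteriorAlgebra.ι ℝ w)) p.2)
      (fun a b p => by
        simp only [map_add, TensorProduct.add_tmul, lTensor_mulLeft_add]
        abel)
      (fun c a p => by
        simp only [map_smul, TensorProduct.smul_tmul', lTensor_mulLeft_smul, smul_sub])
      (fun a p q => by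
        simp only [Prod.fst_add, Prod.snd_add, map_add, TensorProduct.tmul_add]; abel)
      (fun c a p => by
        simp only [Prod.smul_fst, Prod.smul_snd, map_smul, TensorProduct.tmul_smul, smul_sub]))
    (fun w P fP => by
      simp only [LinearMap.mk₂_apply, map_sub, LinearMap.lTensor_tmul, LinearMap.mulLeft_apply]
      have h : LinearMap.lTensor U (LinearMap.mulLeft ℝ (ExteriorAlgebra.ι ℝ w))
          (LinearMap.lTensor U (LinearMap.mulLeft ℝ (ExteriorAlgebra.ι ℝ w)) fP) = 0 := by
        rw [← LinearMap.lTensor_comp_apply, ← LinearMap.mulLeft_mul, ExteriorAlgebra.ι_sq_zero]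
        simp
      change r w ⊗ₜ[ℝ] (ExteriorAlgebra.ι ℝ w * P) - (r w ⊗ₜ[ℝ] (ExteriorAlgebra.ι ℝ w * P) -
        LinearMap.lTensor U (LinearMap.mulLeft ℝ (ExteriorAlgebra.ι ℝ w))
          (LinearMap.lTensor U (LinearMap.mulLeft ℝ (ExteriorAlgebra.ι ℝ w)) fP)) = _
      rw [h]
      simp)
    0

theorem opD_one (r : W →ₗ[ℝ] U) : opD r 1 = 0 := by
  unfold opD
  rw [← map_one (algebraMap ℝ _)]
  exact (CliffordAlgebra.foldr'_algebraMap _ _ _ _ _).trans (smul_zero _)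

theorem opD_ι_mul (r : W →ₗ[ℝ] U) (w : W) (P : ExteriorAlgebra ℝ W) :
    opD r (ExteriorAlgebra.ι ℝ w * P) = r w ⊗ₜ[ℝ] P -
      LinearMap.lTensor U (LinearMap.mulLeft ℝ (ExteriorAlgebra.ι ℝ w)) (opD r P) := by
  unfold opD
  exact CliffordAlgebra.foldr'_ι_mul _ _ _ _ _ _

/-- The identity `ι_ξ (D_r τ) = ι_{r^* ξ} τ`. -/
theorem contrL_opD (r : W →ₗ[ℝ] U) (ξ : Dual ℝ U) (P : ExteriorAlgebra ℝ W) :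
    contrL ξ (opD r P) = contr (ξ ∘ₗ r) P := by
  have key : ∀ (w : W) (t : U ⊗[ℝ] ExteriorAlgebra ℝ W),
      contrL ξ (LinearMap.lTensor U (LinearMap.mulLeft ℝ (ExteriorAlgebra.ι ℝ w)) t) =
      ExteriorAlgebra.ι ℝ w * contrL ξ t := fun w t => by
    induction t using TensorProduct.induction_on with
    | zero => simp
    | tmul X P => simp [contrL_tmul]
    | add t t' h h' => simp only [map_add, h, h', mul_add]
  induction P using ext_induction with
  | algebraMap c =>
    rw [contr_algebraMap, Algebra.algebraMap_eq_smul_one, map_smul, opD_one, smul_zero, map_zero]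
  | add P Q h h' => rw [map_add, map_add, map_add, h, h']
  | ι_mul P w h =>
    rw [opD_ι_mul, map_sub, contrL_tmul, key, h, contr_ι_mul]; rfl

end TensorAlg

section Main

variable {E : Type*} [NormedAddCommGroup E] [NormedSpace ℝ E] [FiniteDimensional ℝ E]
  {M : Type*} [TopologicalSpace M] [ChartedSpace E M] [T2Space M] [IsManifold 𝓘(ℝ, E) ∞ M]
  {F : Type*} [NormedAddCommGroup F] [NormedSpace ℝ F] [FiniteDimensional ℝ F]
  {V : M → Type*} [TopologicalSpace (TotalSpace F V)] [∀ x, TopologicalSpace (V x)]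
  [∀ x, AddCommGroup (V x)] [∀ x, Module ℝ (V x)] [FiberBundle F V] [VectorBundle ℝ F V]
  [ContMDiffVectorBundle ∞ F V 𝓘(ℝ, E)]
  (A : LieAlgebroid E F V)

/-! ### Compatible tensors -/

variable (E V) in
/-- Arbitrary families `x ↦ ϖ_x ∈ T_xM ⊗ ∧^• A_x`. -/
abbrev TensorFam : Type _ :=
  ∀ x : M, TangentSpace 𝓘(ℝ, E) x ⊗[ℝ] ExteriorAlgebra ℝ (V x)

/-- The space of `ρ`-compatible `k`-tensors: smooth sections `ϖ` of `TM ⊗ ∧^{k-1} A` with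
`ι_{ρ^*ξ} ι_η ϖ = -ι_{ρ^*η} ι_ξ ϖ` for all covectors `ξ`, `η`. Smoothness of `ϖ` is tested by the
contractions `ι_{df} ϖ`, which determine the components of `ϖ` in coordinates. -/
def compatTensors (k : ℕ) : Submodule ℝ (TensorFam E V) where
  carrier := {ϖ | (∀ x, ϖ x ∈ tensorDeg (TangentSpace 𝓘(ℝ, E) x) (V x) (k - 1)) ∧
    (∀ f : SmoothFn E M, IsSmoothExt E F (fun x => contrL (dAt f x) (ϖ x))) ∧
    ∀ (x : M) (ξ η : Dual ℝ (TangentSpace 𝓘(ℝ, E) x)),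
      contr (ξ ∘ₗ A.anchor.1 x) (contrL η (ϖ x)) = -contr (η ∘ₗ A.anchor.1 x) (contrL ξ (ϖ x))}
  add_mem' := by
    rintro ϖ ϖ' ⟨h1, h2, h3⟩ ⟨h1', h2', h3'⟩
    refine ⟨fun x => Submodule.add_mem _ (h1 x) (h1' x), fun f => ?_, fun x ξ η => ?_⟩
    · exact ((funext fun x => map_add (contrL (dAt f x)) (ϖ x) (ϖ' x) :
        (fun x => contrL (dAt f x) ((ϖ + ϖ') x)) = _) ▸ (h2 f).add (h2' f))
    · rw [Pi.add_apply, map_add, map_add, map_add, map_add, h3 x ξ η, h3' x ξ η, neg_add]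
  zero_mem' := by
    refine ⟨fun x => Submodule.zero_mem _, fun f => ?_, fun x ξ η => ?_⟩
    · simpa only [Pi.zero_apply, map_zero] using! Subalgebra.zero_mem (extSections E F V)
    · simp only [Pi.zero_apply, map_zero, neg_zero]
  smul_mem' := by
    rintro r ϖ ⟨h1, h2, h3⟩
    refine ⟨fun x => Submodule.smul_mem _ _ (h1 x), fun f => ?_, fun x ξ η => ?_⟩
    · exact ((funext fun x => map_smul (contrL (dAt f x)) r (ϖ x) :
        (fun x => contrL (dAt f x) ((r • ϖ) x)) = _) ▸ (h2 f).smul r)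
    · rw [Pi.smul_apply, map_smul, map_smul, map_smul, map_smul, h3 x ξ η, smul_neg]

/-- The space of tensors `D_ρ τ` with `τ ∈ Γ(∧^k A)`. -/
def exactTensors (k : ℕ) : Submodule ℝ (TensorFam E V) where
  carrier := {ϖ | ∃ τ ∈ extDeg E F V k, ∀ x, ϖ x = opD (A.anchor.1 x) (τ.1 x)}
  add_mem' := by
    rintro ϖ ϖ' ⟨τ, hτ, h⟩ ⟨τ', hτ', h'⟩
    exact ⟨τ + τ', Submodule.add_mem _ hτ hτ', fun x => by
      rw [Pi.add_apply, h, h', ← map_add]; rfl⟩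
  zero_mem' := ⟨0, Submodule.zero_mem _, fun x => (map_zero (opD (A.anchor.1 x))).symm⟩
  smul_mem' := by
    rintro r ϖ ⟨τ, hτ, h⟩
    exact ⟨r • τ, fun x => Submodule.smul_mem _ r (hτ x), fun x => by
      rw [Pi.smul_apply, h, ← map_smul]; rfl⟩

/-- The reduced space `R^k_ρ`: the `ρ`-compatible `k`-tensors modulo the exact ones. -/
abbrev RedTensors (k : ℕ) : Type _ :=
  SubQuot (compatTensors A k) (exactTensors A k)

/-! ### Differentials -/

variable [SigmaCompactSpace M]

/-- The space of `k`-differentials on `A` (for `k ≥ 1`): the linear operators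
`δ : Γ(∧^• A) → Γ(∧^{• + k - 1} A)` that are graded derivations of the exterior product and of the
Schouten bracket. -/
def differentials (k : ℕ) : Submodule ℝ (ExtSec E F V →ₗ[ℝ] ExtSec E F V) where
  carrier := {δ | (∀ p, ∀ P ∈ extDeg E F V p, δ P ∈ extDeg E F V (p + (k - 1))) ∧
    (∀ p, ∀ P ∈ extDeg E F V p, ∀ Q,
      δ (P * Q) = δ P * Q + (-1 : ℝ) ^ (((k : ℤ) - 1) * p) • (P * δ Q)) ∧
    ∀ p, ∀ P ∈ extDeg E F V p, ∀ Q, δ (schouten A P Q) =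
      schouten A (δ P) Q + (-1 : ℝ) ^ (((k : ℤ) - 1) * ((p : ℤ) - 1)) • schouten A P (δ Q)}
  add_mem' := by
    rintro δ δ' ⟨h1, h2, h3⟩ ⟨h1', h2', h3'⟩
    refine ⟨fun p P hP => Submodule.add_mem _ (h1 p P hP) (h1' p P hP), fun p P hP Q => ?_,
      fun p P hP Q => ?_⟩
    · simp only [LinearMap.add_apply, h2 p P hP, h2' p P hP, add_mul, mul_add, smul_add]; abel
    · simp only [LinearMap.add_apply, h3 p P hP, h3' p P hP, map_add, smul_add]; abel
  zero_mem' := by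
    refine ⟨fun p P hP => Submodule.zero_mem _, fun p P hP Q => ?_, fun p P hP Q => ?_⟩ <;> simp
  smul_mem' := by
    rintro r δ ⟨h1, h2, h3⟩
    refine ⟨fun p P hP x => Submodule.smul_mem _ r (h1 p P hP x), fun p P hP Q => ?_,
      fun p P hP Q => ?_⟩
    · simp only [LinearMap.smul_apply, h2 p P hP, smul_add, smul_mul_assoc, mul_smul_comm]
      rw [smul_comm r]
    · simp only [LinearMap.smul_apply, h3 p P hP, smul_add, map_smul]
      rw [smul_comm r]

/-- The space of exact operators `[τ, ·]` with `τ ∈ Γ(∧^k A)`. -/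
def exactDifferentials (k : ℕ) : Submodule ℝ (ExtSec E F V →ₗ[ℝ] ExtSec E F V) where
  carrier := {δ | ∃ τ ∈ extDeg E F V k, δ = schouten A τ}
  add_mem' := by
    rintro δ δ' ⟨τ, hτ, rfl⟩ ⟨τ', hτ', rfl⟩
    exact ⟨τ + τ', Submodule.add_mem _ hτ hτ', (map_add _ _ _).symm⟩
  zero_mem' := ⟨0, Submodule.zero_mem _, (map_zero _).symm⟩
  smul_mem' := by
    rintro r δ ⟨τ, hτ, rfl⟩
    exact ⟨r • τ, fun x => Submodule.smul_mem _ r (hτ x), (map_smul _ _ _).symm⟩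

/-- The reduced space `R^k_diff`: the `k`-differentials modulo the exact ones. -/
abbrev RedDiff (k : ℕ) : Type _ :=
  SubQuot (differentials A k) (exactDifferentials A k)

/-! ### Characteristic pairs -/

variable {A} in
/-- The bundle map `m : 𝔥 → ∧^k A` is `μ_ϖ : H ↦ (H ⊗ id) ϖ`. -/
def IsMu {k : ℕ} (ϖ : TensorFam E V) (m : TA E F V →ₗ[SmoothFn E M] extDeg E F V k) : Prop :=
  ∀ (H : TA E F V) (x : M), (m H).1.1 x = applyFirst (H.1 x) (ϖ x)

/-- The pair `(χ, ϖ)` is a `k`-characteristic pair, and `δ` is the `k`-differential that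
corresponds to it: the restriction of `χ` to `𝔥` is `μ_ϖ`, and `δ(u) = χ(j¹u)`,
`δ(f) = (-1)^{k-1} ι_{df} ϖ` on sections `u` of `A` and functions `f`. -/
structure IsCharPair (k : ℕ) (δ : differentials A k) (χ : Z1Jet A k) (ϖ : compatTensors A k) :
    Prop where
  restrict : IsMu ϖ.1 (χ.1 ∘ₗ JetSec.incl)
  sec : ∀ u : Sec E F V, δ.1 (ofSec u) = (χ.1 (JetSec.j1 u)).1
  fn : ∀ (f : SmoothFn E M) (x : M),
    (δ.1 (ofFn f)).1 x = (-1 : ℝ) ^ (k - 1) • contrL (dAt f x) (ϖ.1 x)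

end Main

end

end LieAlgd

/-!
A differential `δ` is a derivation, so it is determined by its values on functions and on sections
of `A`. On functions it is a derivation `C^∞(M) → Γ(∧^{k-1} A)`, hence given by a tensor `ϖ`
(`exists_charPair`); on sections it satisfies `δ(f u) = δ(f) ∧ u + f δ(u)`, which says precisely
that `(u, H) ↦ δ(u) + μ_ϖ(H)` is `C^∞(M)`-linear on sections of the jet bundle (`jetMap`).
Conversely, a pair of such values extends to a derivation of the exterior product, first in a local
frame and then, by uniqueness, globally (`DerData.exists_isDer`).

What remains is to match the compatibility with the brackets. For an operator that derives the
product, the failure to derive the Schouten bracket is graded antisymmetric and is itself a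
derivation in each argument, so it vanishes once it does on the pairs `(f, g)`, `(u, f)` and
`(u, v)` of generators (`isBrDer_of_generators`). The pair `(f, g)` gives the `ρ`-compatibility of
`ϖ`. The pairs `(u, v)` give the cocycle identity on `j¹u`, `j¹v`. The pairs `(u, f)` give the
identity `IsSymbCompat`, which becomes the cocycle identity on `j¹u` and `df ⊗ v` after
multiplication by `v` (`mu_lieHom`, `symbCompat_of_mu_lieHom`). The cocycle identity on two
sections of `𝔥` is pointwise multilinear algebra (`applyFirst_bracket`). Since `ϖ` has degree
`k - 1 < rank A`, an element of that degree that is killed by all products with sections of `A`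
vanishes (`eq_zero_of_ι_mul`); this permits division by `v`, and it shows that `ϖ` is determined
by `μ_ϖ` (`mu_injective`).

The passage to quotients rests on two identities: `μ_{D_ρ τ}` is the coboundary of `-τ`
(`mu_exactTensor`), and `[τ, ·]` has the characteristic pair consisting of the coboundary of `-τ`
and of `D_ρ τ` (`IsCharPair.of_exact`). With `mu_injective` they give the injectivity of `μ` and
`κ`. For the surjectivity of `β`, if `χ|_𝔥 - μ_ϖ` is the coboundary of `τ`, then
`(χ, ϖ - D_ρ τ)` is a characteristic pair (`exists_redDiff`).

Smooth functions, vector fields and sections are handled through Hadamard's lemma in coordinates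
(`exists_coords`, `IsPointDeriv.eq_sum`) and through globally defined sections that agree with a
given one near a point (`exists_isGen`).
-/

namespace LieAlgd

noncomputable section

/-! ### Hadamard's lemma on a vector space -/

section Hadamard

universe u

/-- Differentiation under the integral sign. The statement is proved for all target spaces at once,
since the derivative takes values in another space; hence the common universe. -/
theorem contDiff_radial_integral {E : Type u} [NormedAddCommGroup E] [NormedSpace ℝ E] (n : ℕ) :
    ∀ {G : Type u} [NormedAddCommGroup G] [NormedSpace ℝ G] [CompleteSpace G] {f : E → G},
      ContDiff ℝ ∞ f → HasCompactSupport f → ∀ m : ℕ,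
      ContDiff ℝ n (fun z => ∫ t in (0 : ℝ)..1, t ^ m • f (t • z)) := by
  induction n with
  | zero =>
    intro G _ _ _ f hf _ m
    have := hf.continuous
    exact contDiff_zero.2 (intervalIntegral.continuous_parametric_intervalIntegral_of_continuous'
      (by fun_prop) 0 1)
  | succ n ih =>
    intro G _ _ _ f hf hc m
    have hf' : ContDiff ℝ ∞ (fderiv ℝ f) := hf.fderiv_right (by simp)
    obtain ⟨C, hC⟩ := (hc.fderiv (𝕜 := ℝ)).exists_bound_of_continuous hf'.continuous
    have h0 := hf.continuous
    have h1 := hf'.continuous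
    refine contDiff_succ_iff_hasFDerivAt.2 ⟨_, ih hf' (hc.fderiv (𝕜 := ℝ)) (m + 1), fun z => ?_⟩
    refine intervalIntegral.hasFDerivAt_integral_of_dominated_of_fderiv_le
      (s := Set.univ) (bound := fun _ => C)
      (F' := fun z t => t ^ (m + 1) • fderiv ℝ f (t • z)) Filter.univ_mem
      (Filter.Eventually.of_forall fun y => ?_) ?_ ?_
      (Filter.Eventually.of_forall fun t ht y _ => ?_) intervalIntegrable_const
      (Filter.Eventually.of_forall fun t _ y _ => ?_)
    · exact Continuous.aestronglyMeasurable (by fun_prop)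
    · exact Continuous.intervalIntegrable (by fun_prop) _ _
    · exact Continuous.aestronglyMeasurable (by fun_prop)
    · rw [Set.uIoc_of_le zero_le_one] at ht
      rw [norm_smul, norm_pow, Real.norm_of_nonneg ht.1.le]
      calc t ^ (m + 1) * ‖fderiv ℝ f (t • y)‖ ≤ 1 * C := by
            gcongr
            · exact pow_le_one₀ ht.1.le ht.2
            · exact hC _
        _ = C := one_mul C
    · have h2 : HasFDerivAt (fun y : E => t • y) (t • ContinuousLinearMap.id ℝ E) y :=
        (hasFDerivAt_id y).const_smul t
      have h3 := (((hf.differentiable (by simp)) (t • y)).hasFDerivAt.comp y h2).const_smul (t ^ m)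
      refine h3.congr_fderiv ?_
      ext v
      simp [pow_succ, mul_smul]

/-- **Hadamard's lemma** at the origin. -/
theorem exists_hadamard {E : Type u} [NormedAddCommGroup E] [NormedSpace ℝ E] {f : E → ℝ}
    (hf : ContDiff ℝ ∞ f) (hc : HasCompactSupport f) :
    ∃ g : E → (E →L[ℝ] ℝ), ContDiff ℝ ∞ g ∧ ∀ z, f z = f 0 + g z z := by
  have hf' : ContDiff ℝ ∞ (fderiv ℝ f) := hf.fderiv_right (by simp)
  have h1 := hf'.continuous
  refine ⟨fun z => ∫ t in (0 : ℝ)..1, fderiv ℝ f (t • z), contDiff_infty.2 fun n => ?_,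
    fun z => ?_⟩
  · have := contDiff_radial_integral n hf' (hc.fderiv (𝕜 := ℝ)) 0
    simpa using this
  · have hz : ∀ t ∈ Set.uIcc (0 : ℝ) 1,
        HasDerivAt (fun t : ℝ => f (t • z)) (fderiv ℝ f (t • z) z) t := fun t _ => by
      have h2 : HasDerivAt (fun t : ℝ => t • z) z t := by
        simpa using (hasDerivAt_id t).smul_const z
      exact ((hf.differentiable (by simp)) (t • z)).hasFDerivAt.comp_hasDerivAt t h2
    have h3 := intervalIntegral.integral_eq_sub_of_hasDerivAt hz
      (Continuous.intervalIntegrable (by fun_prop) _ _)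
    rw [ContinuousLinearMap.intervalIntegral_apply
      (Continuous.intervalIntegrable (by fun_prop) _ _) z, h3]
    simp

end Hadamard

/-! ### Local coordinates and point derivations -/

section Coords

variable {E : Type*} [NormedAddCommGroup E] [NormedSpace ℝ E] [FiniteDimensional ℝ E]
  {M : Type*} [TopologicalSpace M] [ChartedSpace E M] [T2Space M] [IsManifold 𝓘(ℝ, E) ∞ M]

/-- A smooth function of the chart coordinates at `x` agrees near `x` with a global function. -/
theorem exists_chartFn (x : M) {G : E → ℝ} (hG : ContDiff ℝ ∞ G) :
    ∃ g : SmoothFn E M, ∀ᶠ y in 𝓝 x, g y = G (extChartAt 𝓘(ℝ, E) x y) := by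
  let ψ : SmoothBumpFunction 𝓘(ℝ, E) x := Nonempty.some inferInstance
  have h : ContMDiffOn 𝓘(ℝ, E) 𝓘(ℝ, ℝ) ∞ (fun y => G (extChartAt 𝓘(ℝ, E) x y))
      (chartAt E x).source := hG.contMDiff.comp_contMDiffOn (contMDiffOn_extChartAt (n := ∞))
  refine ⟨⟨_, ψ.contMDiff_smul h⟩, ?_⟩
  filter_upwards [ψ.eventuallyEq_one] with y hy
  change ψ y • G _ = _
  rw [hy, Pi.one_apply, one_smul]

/-- Every function agrees near `x` with a compactly supported smooth function of the chart
coordinates centred at `x`. -/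
theorem exists_readFn (x : M) (f : SmoothFn E M) :
    ∃ G : E → ℝ, ContDiff ℝ ∞ G ∧ HasCompactSupport G ∧
      ∀ᶠ y in 𝓝 x, f y = G (extChartAt 𝓘(ℝ, E) x y - extChartAt 𝓘(ℝ, E) x x) := by
  set e := extChartAt 𝓘(ℝ, E) x
  have hT : (fun z => z + e x) ⁻¹' e.target ∈ 𝓝 (0 : E) := by
    refine (Continuous.continuousAt (by fun_prop)).preimage_mem_nhds ?_
    rw [zero_add]
    exact extChartAt_target_mem_nhds x
  obtain ⟨r, hr, hrT⟩ := Metric.nhds_basis_closedBall.mem_iff.1 hT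
  let ψ : ContDiffBump (0 : E) := ⟨r / 2, r, half_pos hr, half_lt_self hr⟩
  have hψ : tsupport ψ ⊆ (fun z => z + e x) ⁻¹' e.target := by rw [ψ.tsupport_eq]; exact hrT
  refine ⟨fun z => ψ z • f (e.symm (z + e x)), ?_, ψ.hasCompactSupport.smul_right, ?_⟩
  · rw [← contMDiff_iff_contDiff]
    refine contMDiff_of_tsupport fun z hz => ?_
    have hz' := hψ (tsupport_smul_subset_left _ _ hz)
    have h1 : ContMDiffAt 𝓘(ℝ, E) 𝓘(ℝ, E) ∞ e.symm (z + e x) :=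
      (contMDiffOn_extChartAt_symm (n := ∞) x).contMDiffAt
        ((isOpen_extChartAt_target x).mem_nhds hz')
    have h2 : ContMDiffAt 𝓘(ℝ, E) 𝓘(ℝ, E) ∞ (fun z => z + e x) z :=
      (contDiff_id.add contDiff_const).contMDiff.contMDiffAt
    exact ψ.contDiff.contMDiff.contMDiffAt.smul
      (f.contMDiff.contMDiffAt.comp z (h1.comp z h2))
  · have hcont : Filter.Tendsto (fun y => e y - e x) (𝓝 x) (𝓝 0) := by
      rw [← sub_self (e x)]
      exact ((continuousAt_extChartAt (I := 𝓘(ℝ, E)) x).sub continuousAt_const).tendsto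
    have h1 : ∀ᶠ y in 𝓝 x, ψ (e y - e x) = 1 := hcont.eventually ψ.eventuallyEq_one
    filter_upwards [h1, extChartAt_source_mem_nhds (I := 𝓘(ℝ, E)) x] with y hy hys
    rw [hy, one_smul, sub_add_cancel, e.left_inv hys]

variable (E) in
/-- Coordinate functions `f` and vector fields `X` on `M` that are a coordinate system and its
coordinate frame on an open set `U`. -/
structure Coords (M : Type*) [TopologicalSpace M] [ChartedSpace E M]
    [IsManifold 𝓘(ℝ, E) ∞ M] where
  /-- The open set. -/
  U : Set M
  /-- The coordinate functions. -/
  f : Fin (finrank ℝ E) → SmoothFn E M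
  /-- The coordinate vector fields. -/
  X : Fin (finrank ℝ E) → VecField E M
  isOpen : IsOpen U
  dual : ∀ y ∈ U, ∀ i j, dAt (f i) y (X j y) = if i = j then 1 else 0
  span : ∀ y ∈ U, ∀ v : TangentSpace 𝓘(ℝ, E) y, ∑ i, dAt (f i) y v • X i y = v

/-- Hadamard's lemma holds in the coordinates `c` at the point `x`. -/
def Coords.IsCentred (c : Coords E M) (x : M) : Prop :=
  x ∈ c.U ∧ ∀ f : SmoothFn E M, ∃ g : Fin (finrank ℝ E) → SmoothFn E M,
    ∀ᶠ y in 𝓝 x, f y = f x + ∑ i, (c.f i y - c.f i x) * g i y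

theorem exists_coords (x : M) : ∃ c : Coords E M, c.IsCentred x := by
  let V := fun x : M => TangentSpace 𝓘(ℝ, E) x
  let b := finBasis ℝ E
  set e := extChartAt 𝓘(ℝ, E) x with he
  have hb : ∀ i, ∃ f : SmoothFn E M, ∀ᶠ y in 𝓝 x, f y = b.coord i (e y) := fun i =>
    exists_chartFn x (G := b.coord i) (LinearMap.toContinuousLinearMap (b.coord i)).contDiff
  choose f hf using hb
  obtain ⟨U, -, X, hUo, hxU, hUe, -, -, hX, -⟩ := exists_frame (E := E) x
    (trivializationAt E V x) (mem_baseSet_trivializationAt E V x)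
  obtain ⟨U', hU', hUo', hxU'⟩ := eventually_nhds_iff.1 (Filter.eventually_all.2 hf)
  have hd : ∀ y ∈ U ∩ U', ∀ (v : V y) i, dAt (f i) y v =
      b.coord i ((trivializationAt E V x).linearMapAt ℝ y v) := by
    intro y hy v i
    have hys : y ∈ (chartAt E x).source := by
      simpa [V] using! hUe hy.1
    have h1 : (f i : M → ℝ) =ᶠ[𝓝 y]
        (LinearMap.toContinuousLinearMap (b.coord i) : E → ℝ) ∘ e := by
      filter_upwards [hUo'.mem_nhds hy.2] with z hz
      exact hU' z hz i
    have h2 : MDifferentiableAt 𝓘(ℝ, E) 𝓘(ℝ, E) e y := mdifferentiableAt_extChartAt hys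
    have h3 := ((LinearMap.toContinuousLinearMap (b.coord i)).hasMFDerivAt
      (x := e y)).comp y h2.hasMFDerivAt
    have h4 := (h3.congr_of_eventuallyEq h1).mfderiv
    have h5 := TangentBundle.continuousLinearMapAt_trivializationAt (I := 𝓘(ℝ, E)) hys
    have h6 : (trivializationAt E V x).linearMapAt ℝ y v = mfderiv 𝓘(ℝ, E) 𝓘(ℝ, E) e y v :=
      DFunLike.congr_fun h5 v
    rw [h6]
    exact DFunLike.congr_fun h4 v
  refine ⟨⟨U ∩ U', f, X, hUo.inter hUo', fun y hy i j => ?_, fun y hy v => ?_⟩, ⟨hxU, hxU'⟩,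
    fun g => ?_⟩
  · rw [hd y hy, hX y hy.1, b.coord_apply, b.repr_self, Finsupp.single_apply]
    simp only [eq_comm]
  · simp only [hd y hy]
    have h1 : ∀ i, X i y = (trivializationAt E V x).symmₗ ℝ y (b i) := fun i => by
      rw [← hX y hy.1 i]
      exact (Trivialization.symmₗ_linearMapAt (R := ℝ) _ (hUe hy.1) _).symm
    simp only [h1, ← map_smul, ← map_sum, Basis.coord_apply, b.sum_repr]
    exact Trivialization.symmₗ_linearMapAt (R := ℝ) _ (hUe hy.1) _
  · obtain ⟨G, hG, hGc, hgG⟩ := exists_readFn x g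
    obtain ⟨D, hD, hGD⟩ := exists_hadamard hG hGc
    have hi : ∀ i, ∃ h : SmoothFn E M, ∀ᶠ y in 𝓝 x, h y = D (e y - e x) (b i) := fun i =>
      exists_chartFn x (G := fun z => D (z - e x) (b i))
        ((hD.comp (contDiff_id.sub contDiff_const)).clm_apply contDiff_const)
    choose h hh using hi
    refine ⟨h, ?_⟩
    filter_upwards [hgG, Filter.eventually_all.2 hh, Filter.eventually_all.2 hf] with y h1 h2 h3
    have h0 : g x = G 0 := by simpa using! hgG.self_of_nhds
    rw [h1, hGD, ← h0]
    congr 1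
    have h4 : e y - e x = ∑ i, (f i y - f i x) • b i := by
      conv_lhs => rw [← b.sum_repr (e y - e x)]
      refine Finset.sum_congr rfl fun i _ => ?_
      rw [h3 i, (hf i).self_of_nhds, ← map_sub, Basis.coord_apply]
    conv_lhs => rw [h4]
    rw [map_sum]
    refine Finset.sum_congr rfl fun i _ => ?_
    rw [map_smul, ← h4, smul_eq_mul, h2 i]

theorem exists_bump (x : M) {U : Set M} (hU : U ∈ 𝓝 x) :
    ∃ ψ : SmoothFn E M, (∀ᶠ y in 𝓝 x, ψ y = 1) ∧ ∀ y ∉ U, ψ y = 0 := by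
  obtain ⟨ψ, -, hψ⟩ := (SmoothBumpFunction.nhds_basis_tsupport (I := 𝓘(ℝ, E)) x).mem_iff.1 hU
  exact ⟨⟨ψ, ψ.contMDiff⟩, ψ.eventuallyEq_one,
    fun y hy => image_eq_zero_of_notMem_tsupport fun h => hy (hψ h)⟩

theorem dAt_smul (r : ℝ) (f : SmoothFn E M) (x : M) : dAt (r • f) x = r • dAt f x := by
  have hf := f.contMDiff.mdifferentiableAt (x := x) (by simp)
  ext v
  have := DFunLike.congr_fun (hf.hasMFDerivAt.const_smul r).mfderiv v
  simpa [dAt] using! this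

/-- A derivation of `C^∞(M)` at the point `x`, with values in a vector space. -/
def IsPointDeriv {W : Type*} [AddCommGroup W] [Module ℝ W] (x : M)
    (T : SmoothFn E M →ₗ[ℝ] W) : Prop :=
  ∀ f g, T (f * g) = f x • T g + g x • T f

/-- The derivation `f ↦ d_x f (v)`. -/
def dAtₗ (x : M) (v : TangentSpace 𝓘(ℝ, E) x) : SmoothFn E M →ₗ[ℝ] ℝ where
  toFun f := dAt f x v
  map_add' f g := by rw [dAt_add]; rfl
  map_smul' r f := by rw [dAt_smul]; rfl

theorem isPointDeriv_dAtₗ (x : M) (v : TangentSpace 𝓘(ℝ, E) x) : IsPointDeriv x (dAtₗ x v) :=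
  fun f g => by
    change dAt (f * g) x v = f x • dAt g x v + g x • dAt f x v
    rw [dAt_mul]; rfl

namespace IsPointDeriv

variable {W : Type*} [AddCommGroup W] [Module ℝ W] {x : M} {T : SmoothFn E M →ₗ[ℝ] W}

theorem map_one (h : IsPointDeriv x T) : T 1 = 0 := by
  have := h 1 1
  rw [mul_one] at this
  simpa using! this

theorem congr (h : IsPointDeriv x T) {f g : SmoothFn E M} (hfg : ∀ᶠ y in 𝓝 x, f y = g y) :
    T f = T g := by
  obtain ⟨ψ, hψ, hψ'⟩ := exists_bump (E := E) x hfg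
  have h0 : ψ * (f - g) = 0 := by
    ext y
    change ψ y * (f y - g y) = 0
    by_cases hy : f y = g y
    · rw [hy, sub_self, mul_zero]
    · rw [hψ' y hy, zero_mul]
  have h1 := h ψ (f - g)
  have h2 : (f - g) x = 0 := sub_eq_zero.2 hfg.self_of_nhds
  rw [h0, map_zero, h2, zero_smul, add_zero, hψ.self_of_nhds, one_smul, map_sub] at h1
  exact (sub_eq_zero.1 h1.symm)

theorem eq_sum_of_hadamard (h : IsPointDeriv x T) {ι : Type*} [Fintype ι] {f : SmoothFn E M}
    {c g : ι → SmoothFn E M} (hg : ∀ᶠ y in 𝓝 x, f y = f x + ∑ i, (c i y - c i x) * g i y) :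
    T f = ∑ i, g i x • T (c i) := by
  have h1 : ∀ y, (1 : SmoothFn E M) y = 1 := fun y => rfl
  have h0 : ∀ i y, (c i - c i x • (1 : SmoothFn E M)) y = c i y - c i x := fun i y => by
    change c i y - c i x * 1 = _
    rw [mul_one]
  have hg' : ∀ᶠ y in 𝓝 x, f y =
      (f x • (1 : SmoothFn E M) + ∑ i, (c i - c i x • 1) * g i : SmoothFn E M) y := by
    filter_upwards [hg] with y hy
    rw [hy, fn_add_apply, fn_sum_apply, fn_smul_apply, h1, mul_one]
    simp only [fn_mul_apply, h0]
  rw [h.congr hg', map_add, map_smul, h.map_one, smul_zero, zero_add, map_sum]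
  refine Finset.sum_congr rfl fun i _ => ?_
  rw [h, h0, sub_self, zero_smul, zero_add, map_sub, map_smul, h.map_one, smul_zero, sub_zero]

/-- A derivation at a point is a directional derivative. -/
theorem eq_sum (h : IsPointDeriv x T) {c : Coords E M} (hc : c.IsCentred x) (f : SmoothFn E M) :
    T f = ∑ i, dAt f x (c.X i x) • T (c.f i) := by
  obtain ⟨hx, hH⟩ := hc
  obtain ⟨g, hg⟩ := hH f
  rw [h.eq_sum_of_hadamard hg]
  refine Finset.sum_congr rfl fun j _ => ?_
  congr 1
  have h1 : ∀ i, dAtₗ x (c.X j x) (c.f i) = if i = j then 1 else 0 := fun i => c.dual x hx i j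
  have := (isPointDeriv_dAtₗ x (c.X j x)).eq_sum_of_hadamard hg
  simp only [h1, smul_eq_mul, mul_ite, mul_one, mul_zero, Finset.sum_ite_eq', Finset.mem_univ,
    if_true] at this
  exact this.symm

end IsPointDeriv

end Coords

/-! ### Graded derivations of the algebra of multivector sections -/

section Derivations

variable {E : Type*} [NormedAddCommGroup E] [NormedSpace ℝ E] [FiniteDimensional ℝ E]
  {M : Type*} [TopologicalSpace M] [ChartedSpace E M] [T2Space M] [IsManifold 𝓘(ℝ, E) ∞ M]
  {F : Type*} [NormedAddCommGroup F] [NormedSpace ℝ F] [FiniteDimensional ℝ F]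
  {V : M → Type*} [TopologicalSpace (TotalSpace F V)] [∀ x, TopologicalSpace (V x)]
  [∀ x, AddCommGroup (V x)] [∀ x, Module ℝ (V x)] [FiberBundle F V] [VectorBundle ℝ F V]
  [ContMDiffVectorBundle ∞ F V 𝓘(ℝ, E)]

theorem ofFn_mem (f : SmoothFn E M) : (ofFn f : ExtSec E F V) ∈ extDeg E F V 0 := fun x => by
  change _ ∈ LinearMap.range (ExteriorAlgebra.ι ℝ) ^ 0
  rw [pow_zero, Submodule.mem_one]
  exact ⟨f x, rfl⟩

theorem ofSec_mem (u : Sec E F V) : ofSec u ∈ extDeg E F V 1 := fun x => ι_mem_one _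

theorem ofFn_val (f : SmoothFn E M) (x : M) :
    (ofFn f : ExtSec E F V).1 x = algebraMap ℝ _ (f x) := rfl

theorem ofSec_val (u : Sec E F V) (x : M) : (ofSec u).1 x = ExteriorAlgebra.ι ℝ (u x) := rfl

theorem ofFn_mul (f g : SmoothFn E M) : (ofFn (f * g) : ExtSec E F V) = ofFn f * ofFn g :=
  map_mul (algebraMap (SmoothFn E M) (ExtSec E F V)) f g

theorem ofFn_add (f g : SmoothFn E M) : (ofFn (f + g) : ExtSec E F V) = ofFn f + ofFn g :=
  map_add (algebraMap (SmoothFn E M) (ExtSec E F V)) f g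

theorem ofFn_rsmul (r : ℝ) (f : SmoothFn E M) : (ofFn (r • f) : ExtSec E F V) = r • ofFn f :=
  ExtSec.val_ext fun x => by
    rw [ExtSec.rsmul_val, ofFn_val, ofFn_val, fn_smul_apply, map_mul, ← Algebra.smul_def]

theorem fn_smul_eq (f : SmoothFn E M) (P : ExtSec E F V) : f • P = ofFn f * P :=
  Algebra.smul_def f P

theorem ofFn_mul_ofSec (f : SmoothFn E M) (u : Sec E F V) :
    ofFn f * ofSec u = ofSec (f • u) := ExtSec.val_ext fun x => by
  rw [ExtSec.mul_val, ofFn_val, ofSec_val, ofSec_val, smul_sec_apply, map_smul, Algebra.smul_def]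

theorem ofFn_comm (f : SmoothFn E M) (P : ExtSec E F V) : ofFn f * P = P * ofFn f :=
  Algebra.commutes f P

theorem ofSec_add (u v : Sec E F V) : ofSec (u + v) = ofSec u + ofSec v :=
  ExtSec.val_ext fun x => map_add (ExteriorAlgebra.ι ℝ) (u x) (v x)

theorem ofSec_rsmul (r : ℝ) (u : Sec E F V) : ofSec (r • u) = r • ofSec u :=
  ExtSec.val_ext fun x => map_smul (ExteriorAlgebra.ι ℝ) r (u x)

/-- The sums of products `f u₁ ∧ ⋯ ∧ uₚ` of functions and sections of `A`, of mixed degrees. -/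
inductive IsGen : ExtSec E F V → Prop
  | fn (f : SmoothFn E M) : IsGen (ofFn f)
  | add (P Q : ExtSec E F V) : IsGen P → IsGen Q → IsGen (P + Q)
  | sec_mul (u : Sec E F V) (P : ExtSec E F V) : IsGen P → IsGen (ofSec u * P)

namespace IsGen

theorem fn_mul (f : SmoothFn E M) {P : ExtSec E F V} (h : IsGen P) : IsGen (ofFn f * P) := by
  induction h with
  | fn g => rw [← ofFn_mul]; exact fn _
  | add P Q _ _ h h' => rw [mul_add]; exact add _ _ h h'
  | sec_mul u P h _ => rw [← mul_assoc, ofFn_mul_ofSec]; exact sec_mul _ _ h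

theorem zero : IsGen (0 : ExtSec E F V) := by
  have : (0 : ExtSec E F V) = ofFn 0 := (map_zero (algebraMap (SmoothFn E M) (ExtSec E F V))).symm
  rw [this]; exact fn 0

theorem sum {ι : Type*} (s : Finset ι) (P : ι → ExtSec E F V) (h : ∀ i, IsGen (P i)) :
    IsGen (∑ i ∈ s, P i) := by
  classical
  induction s using Finset.induction_on with
  | empty => exact zero
  | insert a s ha ih => rw [Finset.sum_insert ha]; exact add _ _ (h a) ih

end IsGen

theorem ext_sum_val {ι : Type*} (s : Finset ι) (P : ι → ExtSec E F V) (x : M) :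
    (∑ i ∈ s, P i).1 x = ∑ i ∈ s, (P i).1 x := by
  classical
  induction s using Finset.induction_on with
  | empty => rfl
  | insert a s ha ih => rw [Finset.sum_insert ha, Finset.sum_insert ha, ← ih]; rfl

/-- A constant multivector in a frame extends to a global section generated by sections. -/
theorem Frm.exists_const (φ : Frm E F V) (w : ExteriorAlgebra ℝ F) :
    ∃ Q : ExtSec E F V, IsGen Q ∧ ∀ y ∈ φ.U, φ.loc Q y = w := by
  induction w using ext_induction with
  | algebraMap r =>
    refine ⟨ofFn (r • 1), IsGen.fn _, fun y _ => ?_⟩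
    rw [φ.loc_ofFn, fn_smul_apply]
    exact congrArg _ (mul_one r)
  | add P Q h h' =>
    obtain ⟨P', hP, hP'⟩ := h
    obtain ⟨Q', hQ, hQ'⟩ := h'
    exact ⟨P' + Q', hP.add _ _ hQ, fun y hy => by rw [φ.loc_add, hP' y hy, hQ' y hy]⟩
  | ι_mul P w h =>
    obtain ⟨P', hP, hP'⟩ := h
    refine ⟨ofSec (∑ i, (finBasis ℝ F).coord i w • φ.s i) * P', hP.sec_mul _ _, fun y hy => ?_⟩
    rw [φ.loc_mul, hP' y hy, φ.loc_ofSec, sec_sum_apply]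
    congr 2
    simp only [ContMDiffSection.coe_smul, Pi.smul_apply, map_sum, map_smul, φ.frame y hy]
    exact (finBasis ℝ F).sum_repr w

/-- Locally, functions and sections of `A` generate the multivector sections. -/
theorem exists_isGen (P : ExtSec E F V) (x : M) :
    ∃ Q : ExtSec E F V, IsGen Q ∧ ∀ᶠ y in 𝓝 x, P.1 y = Q.1 y := by
  obtain ⟨φ, hφ⟩ := exists_frm (E := E) (F := F) (V := V) x
  let b := finBasis ℝ (ExteriorAlgebra ℝ F)
  choose R hR hR' using fun a => φ.exists_const (b a)
  refine ⟨∑ a, ofFn (φ.coordFn (b.coord a) P) * R a, IsGen.sum _ _ fun a => (hR a).fn_mul _,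
    Filter.eventually_of_mem (φ.isOpen.mem_nhds hφ) fun y hy => ?_⟩
  rw [ext_sum_val]
  have h1 : ∀ a, (R a).1 y = ExteriorAlgebra.map (φ.e.symmₗ ℝ y) (b a) := fun a => by
    rw [← hR' a y hy, φ.map_loc hy]
  simp only [ExtSec.mul_val, ofFn_val, ← Algebra.smul_def, φ.coordFn_apply hy, h1]
  rw [← φ.map_loc hy]
  conv_lhs => rw [← b.sum_repr (φ.loc P y)]
  simp only [map_sum, map_smul, Basis.coord_apply]

/-- A graded derivation of `Γ(∧^• A)` at the point `x`, of degree `ε`. -/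
def IsDerAt (x : M) (ε : ℤ) (Z : ExtSec E F V →ₗ[ℝ] ExteriorAlgebra ℝ (V x)) : Prop :=
  ∀ q, ∀ Q ∈ extDeg E F V q, ∀ R,
    Z (Q * R) = Z Q * R.1 x + (-1 : ℝ) ^ (ε * q) • (Q.1 x * Z R)

namespace IsDerAt

variable {x : M} {ε : ℤ} {Z Z' : ExtSec E F V →ₗ[ℝ] ExteriorAlgebra ℝ (V x)}

theorem congr (h : IsDerAt x ε Z) {P Q : ExtSec E F V} (hPQ : ∀ᶠ y in 𝓝 x, P.1 y = Q.1 y) :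
    Z P = Z Q := by
  obtain ⟨ψ, hψ, hψ'⟩ := exists_bump (E := E) x hPQ
  have h0 : ofFn ψ * (P - Q) = 0 := ExtSec.val_ext fun y => by
    rw [ExtSec.mul_val, ofFn_val, ExtSec.sub_val, ExtSec.zero_val]
    by_cases hy : P.1 y = Q.1 y
    · rw [hy, sub_self, mul_zero]
    · rw [hψ' y hy, map_zero, zero_mul]
  have h1 := h 0 _ (ofFn_mem ψ) (P - Q)
  rw [h0, map_zero, ExtSec.sub_val, hPQ.self_of_nhds, sub_self, mul_zero, zero_add, ofFn_val,
    hψ.self_of_nhds, map_one, one_mul, Nat.cast_zero, mul_zero, zpow_zero, one_smul, map_sub] at h1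
  exact sub_eq_zero.1 h1.symm

/-- Graded derivations are determined by their values on functions and on sections of `A`. -/
theorem ext (h : IsDerAt x ε Z) (h' : IsDerAt x ε Z') (hfn : ∀ f, Z (ofFn f) = Z' (ofFn f))
    (hsec : ∀ u, Z (ofSec u) = Z' (ofSec u)) (P : ExtSec E F V) : Z P = Z' P := by
  obtain ⟨Q, hQ, hPQ⟩ := exists_isGen P x
  rw [h.congr hPQ, h'.congr hPQ]
  clear hPQ
  induction hQ with
  | fn f => exact hfn f
  | add P Q _ _ h1 h2 => rw [map_add, map_add, h1, h2]
  | sec_mul u P _ h1 => rw [h 1 _ (ofSec_mem u), h' 1 _ (ofSec_mem u), h1, hsec]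

end IsDerAt

variable (E F V) in
/-- The evaluation of multivector sections at a point. -/
def evalExt (x : M) : ExtSec E F V →ₗ[ℝ] ExteriorAlgebra ℝ (V x) where
  toFun P := P.1 x
  map_add' P Q := rfl
  map_smul' r P := rfl

/-- A graded derivation of the algebra `Γ(∧^• A)`, of degree `ε`. -/
def IsDer (ε : ℤ) (D : ExtSec E F V →ₗ[ℝ] ExtSec E F V) : Prop :=
  ∀ q, ∀ Q ∈ extDeg E F V q, ∀ R, D (Q * R) = D Q * R + (-1 : ℝ) ^ (ε * q) • (Q * D R)

namespace IsDer

variable {ε ε' : ℤ} {D D' : ExtSec E F V →ₗ[ℝ] ExtSec E F V}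

theorem isDerAt (h : IsDer ε D) (x : M) : IsDerAt x ε (evalExt E F V x ∘ₗ D) :=
  fun q Q hQ R => congrArg (evalExt E F V x) (h q Q hQ R)

theorem ext (h : IsDer ε D) (h' : IsDer ε D') (hfn : ∀ f, D (ofFn f) = D' (ofFn f))
    (hsec : ∀ u, D (ofSec u) = D' (ofSec u)) : D = D' :=
  LinearMap.ext fun P => ExtSec.val_ext fun x =>
    (h.isDerAt x).ext (h'.isDerAt x) (fun f => congrArg (evalExt E F V x) (hfn f))
      (fun u => congrArg (evalExt E F V x) (hsec u)) P

theorem of_eq (h : IsDer ε D) (hε : ε = ε') : IsDer ε' D := hε ▸ h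

/-- The graded commutator of graded derivations that shift the degree. -/
theorem commutator (h : IsDer ε D) (h' : IsDer ε' D')
    (hd : ∀ q, ∀ Q ∈ extDeg E F V q, D Q = 0 ∨ ∃ r : ℕ, (r : ℤ) = q + ε ∧ D Q ∈ extDeg E F V r)
    (hd' : ∀ q, ∀ Q ∈ extDeg E F V q,
      D' Q = 0 ∨ ∃ r : ℕ, (r : ℤ) = q + ε' ∧ D' Q ∈ extDeg E F V r) :
    IsDer (ε + ε') (D ∘ₗ D' - (-1 : ℝ) ^ (ε * ε') • (D' ∘ₗ D)) := by
  have key : ∀ {ε ε' : ℤ} {D D' : ExtSec E F V →ₗ[ℝ] ExtSec E F V}, IsDer ε D →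
      (∀ q, ∀ Q ∈ extDeg E F V q,
        D' Q = 0 ∨ ∃ r : ℕ, (r : ℤ) = q + ε' ∧ D' Q ∈ extDeg E F V r) →
      ∀ q, ∀ Q ∈ extDeg E F V q, ∀ R,
      D (D' Q * R) = D (D' Q) * R + (-1 : ℝ) ^ (ε * (q + ε')) • (D' Q * D R) := by
    intro ε ε' D D' h hd' q Q hQ R
    rcases hd' q Q hQ with h0 | ⟨r, hr, h0⟩
    · simp [h0]
    · rw [h r _ h0, hr]
  intro q Q hQ R
  have e1 := key h hd' q Q hQ R
  have e2 := key h' hd q Q hQ R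
  simp only [LinearMap.sub_apply, LinearMap.smul_apply, LinearMap.comp_apply, h q Q hQ R,
    h' q Q hQ R, map_add, map_smul, e1, e2, h q Q hQ (D' R), h' q Q hQ (D R), smul_add, sub_mul,
    mul_sub, smul_sub, smul_smul, smul_mul_assoc, mul_smul_comm]
  have s : (-1 : ℝ) ^ (ε * ε') * (-1) ^ (ε' * (q + ε)) = (-1) ^ (ε' * (q : ℤ)) := by
    rw [← zpow_add₀ (by norm_num)]
    exact neg_one_zpow_eq (k := ε * ε') (by ring)
  have s1 : (-1 : ℝ) ^ (ε * (q + ε')) = (-1) ^ (ε * ε') * (-1) ^ (ε * (q : ℤ)) := by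
    rw [← zpow_add₀ (by norm_num)]; congr 1; ring
  have s2 : (-1 : ℝ) ^ ((ε + ε') * (q : ℤ)) = (-1) ^ (ε' * (q : ℤ)) * (-1) ^ (ε * (q : ℤ)) := by
    rw [← zpow_add₀ (by norm_num)]; congr 1; ring
  have s3 : (-1 : ℝ) ^ (ε * ε') * ((-1) ^ (ε * (q : ℤ)) * (-1) ^ (ε' * (q : ℤ))) =
    (-1) ^ ((ε + ε') * (q : ℤ)) * (-1) ^ (ε * ε') := by rw [s2]; ring
  rw [s, s1, s2, s3, s2]
  abel

end IsDer

end Derivations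

/-! ### Multilinear algebra in a fibre -/

section Pointwise

variable {U W : Type*} [AddCommGroup U] [Module ℝ U] [AddCommGroup W] [Module ℝ W]

theorem derivExt_smulRight (ξ : Dual ℝ W) (w : W) (P : ExteriorAlgebra ℝ W) :
    derivExt (ξ.smulRight w) P = ExteriorAlgebra.ι ℝ w * contr ξ P := by
  induction P using ext_induction with
  | algebraMap r => rw [derivExt_algebraMap, contr_algebraMap, mul_zero]
  | add P Q h h' => rw [map_add, map_add, h, h', mul_add]
  | ι_mul P v h =>
    rw [derivExt_ι_mul, h, contr_ι_mul, mul_sub, LinearMap.smulRight_apply, map_smul,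
      mul_smul_comm, smul_mul_assoc, ι_mul_ι_mul_swap v w, sub_eq_add_neg]

theorem derivExt_zero (P : ExteriorAlgebra ℝ W) : derivExt (0 : W →ₗ[ℝ] W) P = 0 := by
  simpa using derivExt_smul 0 (0 : W →ₗ[ℝ] W) P

theorem derivExt_sum {ι : Type*} (s : Finset ι) (T : ι → W →ₗ[ℝ] W) (P : ExteriorAlgebra ℝ W) :
    derivExt (∑ i ∈ s, T i) P = ∑ i ∈ s, derivExt (T i) P := by
  classical
  induction s using Finset.induction_on with
  | empty => simp [derivExt_zero]
  | insert a s ha ih => rw [Finset.sum_insert ha, Finset.sum_insert ha, derivExt_add, ih]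

theorem derivExt_id {k : ℕ} {P : ExteriorAlgebra ℝ W}
    (hP : P ∈ (⋀[ℝ]^k W : Submodule ℝ (ExteriorAlgebra ℝ W))) :
    derivExt LinearMap.id P = (k : ℝ) • P := by
  induction hP using Submodule.pow_induction_on_left' with
  | algebraMap r => simp
  | add P Q i hP hQ h h' => rw [map_add, h, h', smul_add]
  | mem_mul u hu i P hP h =>
    obtain ⟨v, rfl⟩ := hu
    rw [derivExt_ι_mul, h, LinearMap.id_apply, mul_smul_comm, Nat.succ_eq_add_one]
    push_cast
    rw [add_smul, one_smul, add_comm]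

/-- A multivector of less than the top degree is determined by its products with vectors. The
reason is Euler's identity `∑ ι_{b_i} (b_i ∧ P) = (dim W - k) P` for `P` of degree `k`. -/
theorem eq_zero_of_ι_mul [FiniteDimensional ℝ W] {k : ℕ} (hk : k < finrank ℝ W)
    {P : ExteriorAlgebra ℝ W} (hP : P ∈ (⋀[ℝ]^k W : Submodule ℝ (ExteriorAlgebra ℝ W)))
    (h : ∀ w, ExteriorAlgebra.ι ℝ w * P = 0) : P = 0 := by
  let b := finBasis ℝ W
  have h1 : (LinearMap.id : W →ₗ[ℝ] W) = ∑ i, (b.coord i).smulRight (b i) :=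
    LinearMap.ext fun w => by
      simp only [LinearMap.sum_apply, LinearMap.smulRight_apply, Basis.coord_apply, b.sum_repr,
        LinearMap.id_apply]
  have h2 : ∀ i, ExteriorAlgebra.ι ℝ (b i) * contr (b.coord i) P = P := fun i => by
    have := congrArg (contr (b.coord i)) (h (b i))
    rw [contr_ι_mul, map_zero, Basis.coord_apply, b.repr_self, Finsupp.single_eq_same,
      one_smul] at this
    exact (sub_eq_zero.1 this).symm
  have h3 := derivExt_id hP
  rw [h1, derivExt_sum] at h3
  simp only [derivExt_smulRight, h2, Finset.sum_const, Finset.card_univ, Fintype.card_fin] at h3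
  rw [← Nat.cast_smul_eq_nsmul ℝ, ← sub_eq_zero, ← sub_smul, smul_eq_zero, sub_eq_zero] at h3
  rcases h3 with h3 | h3
  · exact absurd (Nat.cast_injective h3) hk.ne'
  · exact h3

theorem applyFirst_add (H K : U →ₗ[ℝ] W) (t : U ⊗[ℝ] ExteriorAlgebra ℝ W) :
    applyFirst (H + K) t = applyFirst H t + applyFirst K t := by
  induction t using TensorProduct.induction_on with
  | zero => simp
  | tmul X P => simp only [applyFirst_tmul, LinearMap.add_apply, map_add, add_mul]
  | add t t' h h' => rw [map_add, h, h', map_add, map_add]; abel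

theorem applyFirst_smul (r : ℝ) (H : U →ₗ[ℝ] W) (t : U ⊗[ℝ] ExteriorAlgebra ℝ W) :
    applyFirst (r • H) t = r • applyFirst H t := by
  induction t using TensorProduct.induction_on with
  | zero => simp
  | tmul X P => simp only [applyFirst_tmul, LinearMap.smul_apply, map_smul, smul_mul_assoc]
  | add t t' h h' => rw [map_add, h, h', map_add, smul_add]

/-- `applyFirst` as a bilinear map. -/
def applyFirstₗ : (U →ₗ[ℝ] W) →ₗ[ℝ] U ⊗[ℝ] ExteriorAlgebra ℝ W →ₗ[ℝ] ExteriorAlgebra ℝ W where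
  toFun := applyFirst
  map_add' H K := LinearMap.ext (applyFirst_add H K)
  map_smul' r H := LinearMap.ext (applyFirst_smul r H)

theorem applyFirst_zero (t : U ⊗[ℝ] ExteriorAlgebra ℝ W) :
    applyFirst (0 : U →ₗ[ℝ] W) t = 0 := LinearMap.congr_fun (map_zero applyFirstₗ) t

theorem applyFirst_sub (H K : U →ₗ[ℝ] W) (t : U ⊗[ℝ] ExteriorAlgebra ℝ W) :
    applyFirst (H - K) t = applyFirst H t - applyFirst K t :=
  LinearMap.congr_fun (map_sub applyFirstₗ H K) t

theorem applyFirst_smulRight (ξ : Dual ℝ U) (w : W) (t : U ⊗[ℝ] ExteriorAlgebra ℝ W) :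
    applyFirst (ξ.smulRight w) t = ExteriorAlgebra.ι ℝ w * contrL ξ t := by
  induction t using TensorProduct.induction_on with
  | zero => simp
  | tmul X P =>
    rw [applyFirst_tmul, contrL_tmul, LinearMap.smulRight_apply, map_smul, mul_smul_comm,
      smul_mul_assoc]
  | add t t' h h' => rw [map_add, h, h', map_add, mul_add]

theorem applyFirst_lTensor (H : U →ₗ[ℝ] W) (w : W) (t : U ⊗[ℝ] ExteriorAlgebra ℝ W) :
    applyFirst H (LinearMap.lTensor U (LinearMap.mulLeft ℝ (ExteriorAlgebra.ι ℝ w)) t) =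
      -(ExteriorAlgebra.ι ℝ w * applyFirst H t) := by
  induction t using TensorProduct.induction_on with
  | zero => simp
  | tmul X P =>
    rw [LinearMap.lTensor_tmul, LinearMap.mulLeft_apply, applyFirst_tmul, applyFirst_tmul,
      ι_mul_ι_mul_swap]
  | add t t' h h' => rw [map_add, map_add, h, h', map_add, mul_add, neg_add]

/-- The identity `(H ⊗ id) (D_r τ) = D_{H ∘ r} τ`, where `D_{H ∘ r}` is the derivation of `∧^• W`
that extends `H ∘ r`. -/
theorem applyFirst_opD (r : W →ₗ[ℝ] U) (H : U →ₗ[ℝ] W) (P : ExteriorAlgebra ℝ W) :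
    applyFirst H (opD r P) = derivExt (H ∘ₗ r) P := by
  induction P using ext_induction with
  | algebraMap c =>
    rw [derivExt_algebraMap, Algebra.algebraMap_eq_smul_one, map_smul, opD_one, smul_zero,
      map_zero]
  | add P Q h h' => rw [map_add, map_add, map_add, h, h']
  | ι_mul P w h =>
    rw [opD_ι_mul, map_sub, applyFirst_lTensor, h, derivExt_ι_mul, applyFirst_tmul, sub_neg_eq_add]
    rfl

theorem contrL_mem (ξ : Dual ℝ U) {m : ℕ} {t : U ⊗[ℝ] ExteriorAlgebra ℝ W}
    (ht : t ∈ tensorDeg U W m) :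
    contrL ξ t ∈ (⋀[ℝ]^m W : Submodule ℝ (ExteriorAlgebra ℝ W)) := by
  obtain ⟨t, rfl⟩ := ht
  induction t using TensorProduct.induction_on with
  | zero => simp
  | tmul X P =>
    rw [LinearMap.lTensor_tmul, contrL_tmul]
    exact Submodule.smul_mem _ _ P.2
  | add t t' h h' => rw [map_add, map_add]; exact Submodule.add_mem _ h h'

theorem applyFirst_mem (H : U →ₗ[ℝ] W) {m : ℕ} {t : U ⊗[ℝ] ExteriorAlgebra ℝ W}
    (ht : t ∈ tensorDeg U W m) :
    applyFirst H t ∈ (⋀[ℝ]^(m + 1) W : Submodule ℝ (ExteriorAlgebra ℝ W)) := by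
  obtain ⟨t, rfl⟩ := ht
  induction t using TensorProduct.induction_on with
  | zero => simp
  | tmul X P =>
    rw [LinearMap.lTensor_tmul, applyFirst_tmul]
    exact ι_mul_mem _ P.2
  | add t t' h h' => rw [map_add, map_add]; exact Submodule.add_mem _ h h'

theorem tmul_mem_tensorDeg (X : U) {m : ℕ} {P : ExteriorAlgebra ℝ W}
    (hP : P ∈ (⋀[ℝ]^m W : Submodule ℝ (ExteriorAlgebra ℝ W))) :
    X ⊗ₜ[ℝ] P ∈ tensorDeg U W m := ⟨X ⊗ₜ ⟨P, hP⟩, rfl⟩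

/-- A tensor is recovered from its contractions with a dual basis. -/
theorem sum_tmul_contrL {ι : Type*} [Fintype ι] {ξ : ι → Dual ℝ U} {X : ι → U}
    (h : ∀ v, ∑ i, ξ i v • X i = v) (t : U ⊗[ℝ] ExteriorAlgebra ℝ W) :
    ∑ i, X i ⊗ₜ[ℝ] contrL (ξ i) t = t := by
  induction t using TensorProduct.induction_on with
  | zero => simp
  | tmul Y P =>
    simp only [contrL_tmul, TensorProduct.tmul_smul]
    simp only [TensorProduct.smul_tmul', ← TensorProduct.sum_tmul, h]
  | add t t' h h' => simp only [map_add, TensorProduct.tmul_add, Finset.sum_add_distrib, h, h']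

theorem sum_coord_smul {ι : Type*} [Fintype ι] (b : Basis ι ℝ U) (v : U) :
    ∑ i, b.coord i v • b i = v := b.sum_repr v

variable [FiniteDimensional ℝ U]

theorem tensor_ext {t t' : U ⊗[ℝ] ExteriorAlgebra ℝ W} (h : ∀ ξ, contrL ξ t = contrL ξ t') :
    t = t' := by
  rw [← sum_tmul_contrL (sum_coord_smul (finBasis ℝ U)) t,
    ← sum_tmul_contrL (sum_coord_smul (finBasis ℝ U)) t']
  simp only [h]

theorem opD_mem (r : W →ₗ[ℝ] U) {k : ℕ} {P : ExteriorAlgebra ℝ W}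
    (hP : P ∈ (⋀[ℝ]^k W : Submodule ℝ (ExteriorAlgebra ℝ W))) :
    opD r P ∈ tensorDeg U W (k - 1) := by
  rw [← sum_tmul_contrL (sum_coord_smul (finBasis ℝ U)) (opD r P)]
  refine Submodule.sum_mem _ fun i _ => tmul_mem_tensorDeg _ ?_
  rw [contrL_opD]
  rcases k with _ | k
  · rw [contr_zero_deg _ hP]; exact Submodule.zero_mem _
  · exact contr_mem _ k hP

theorem hom_induction {p : (U →ₗ[ℝ] W) → Prop} (H : U →ₗ[ℝ] W) (zero : p 0)
    (add : ∀ H K, p H → p K → p (H + K))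
    (smulRight : ∀ (ξ : Dual ℝ U) (w : W), p (ξ.smulRight w)) : p H := by
  let b := finBasis ℝ U
  have : H = ∑ i, (b.coord i).smulRight (H (b i)) := LinearMap.ext fun v => by
    conv_lhs => rw [← b.sum_repr v]
    simp only [map_sum, map_smul, LinearMap.sum_apply, LinearMap.smulRight_apply,
      Basis.coord_apply]
  rw [this]
  exact Finset.sum_induction _ p add zero fun i _ => smulRight _ _

/-- The fibrewise form of the cocycle condition for `μ_ϖ`. -/
theorem applyFirst_bracket (r : W →ₗ[ℝ] U) {t : U ⊗[ℝ] ExteriorAlgebra ℝ W}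
    (ht : ∀ ξ η : Dual ℝ U, contr (ξ ∘ₗ r) (contrL η t) = -contr (η ∘ₗ r) (contrL ξ t))
    (H K : U →ₗ[ℝ] W) :
    applyFirst (K ∘ₗ r ∘ₗ H - H ∘ₗ r ∘ₗ K) t =
      derivExt (K ∘ₗ r) (applyFirst H t) - derivExt (H ∘ₗ r) (applyFirst K t) := by
  induction H using hom_induction with
  | zero =>
    simp only [LinearMap.comp_zero, LinearMap.zero_comp, sub_zero, applyFirst_zero, map_zero,
      derivExt_zero]
  | add H H' h h' =>
    have e : K ∘ₗ r ∘ₗ (H + H') - (H + H') ∘ₗ r ∘ₗ K =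
      (K ∘ₗ r ∘ₗ H - H ∘ₗ r ∘ₗ K) + (K ∘ₗ r ∘ₗ H' - H' ∘ₗ r ∘ₗ K) := by
        simp only [LinearMap.comp_add, LinearMap.add_comp]; abel
    rw [e, applyFirst_add, h, h', applyFirst_add, map_add, LinearMap.add_comp, derivExt_add]
    abel
  | smulRight ξ v =>
    induction K using hom_induction with
    | zero =>
      simp only [LinearMap.comp_zero, LinearMap.zero_comp, sub_zero, applyFirst_zero, map_zero,
        derivExt_zero]
    | add K K' h h' =>
      have e : (K + K') ∘ₗ r ∘ₗ ξ.smulRight v - ξ.smulRight v ∘ₗ r ∘ₗ (K + K') =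
        (K ∘ₗ r ∘ₗ ξ.smulRight v - ξ.smulRight v ∘ₗ r ∘ₗ K) +
          (K' ∘ₗ r ∘ₗ ξ.smulRight v - ξ.smulRight v ∘ₗ r ∘ₗ K') := by
        simp only [LinearMap.comp_add, LinearMap.add_comp]; abel
      rw [e, applyFirst_add, h, h', applyFirst_add, map_add, LinearMap.add_comp, derivExt_add]
      abel
    | smulRight η w =>
      have e1 : η.smulRight w ∘ₗ r ∘ₗ ξ.smulRight v = η (r v) • ξ.smulRight w :=
        LinearMap.ext fun x => by simp [smul_smul, mul_comm]
      have e2 : ξ.smulRight v ∘ₗ r ∘ₗ η.smulRight w = ξ (r w) • η.smulRight v :=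
        LinearMap.ext fun x => by simp [smul_smul, mul_comm]
      have e3 : η.smulRight w ∘ₗ r = (η ∘ₗ r).smulRight w := rfl
      have e4 : ξ.smulRight v ∘ₗ r = (ξ ∘ₗ r).smulRight v := rfl
      rw [e1, e2, e3, e4, applyFirst_sub, applyFirst_smul, applyFirst_smul, derivExt_smulRight,
        derivExt_smulRight]
      simp only [applyFirst_smulRight, contr_ι_mul, mul_sub, ht ξ η, mul_neg, LinearMap.comp_apply,
        mul_smul_comm]
      rw [ι_mul_ι_mul_swap v w]
      abel

end Pointwise

/-! ### The Schouten bracket with functions and sections -/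

section SchoutenFormulas

variable {E : Type*} [NormedAddCommGroup E] [NormedSpace ℝ E] [FiniteDimensional ℝ E]
  {M : Type*} [TopologicalSpace M] [ChartedSpace E M] [T2Space M] [IsManifold 𝓘(ℝ, E) ∞ M]
  {F : Type*} [NormedAddCommGroup F] [NormedSpace ℝ F] [FiniteDimensional ℝ F]
  {V : M → Type*} [TopologicalSpace (TotalSpace F V)] [∀ x, TopologicalSpace (V x)]
  [∀ x, AddCommGroup (V x)] [∀ x, Module ℝ (V x)] [FiberBundle F V] [VectorBundle ℝ F V]
  [ContMDiffVectorBundle ∞ F V 𝓘(ℝ, E)]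

theorem exists_ofFn {P : ExtSec E F V} (hP : P ∈ extDeg E F V 0) :
    ∃ f : SmoothFn E M, P = ofFn f := by
  have h0 : ∀ x, P.1 x = algebraMap ℝ _ (ExteriorAlgebra.algebraMapInv (P.1 x)) := fun x => by
    have := hP x
    change P.1 x ∈ LinearMap.range (ExteriorAlgebra.ι ℝ) ^ 0 at this
    rw [pow_zero, Submodule.mem_one] at this
    obtain ⟨r, hr⟩ := this
    rw [← hr, ExteriorAlgebra.algebraMap_leftInverse]
  refine ⟨⟨fun x => ExteriorAlgebra.algebraMapInv (P.1 x), fun x => ?_⟩,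
    ExtSec.val_ext fun x => h0 x⟩
  have h := P.2 (trivializationAt F V x) x (mem_baseSet_trivializationAt F V x)
    (ExteriorAlgebra.algebraMapInv (R := ℝ) (M := F)).toLinearMap
  refine h.congr_of_eventuallyEq (Filter.Eventually.of_forall fun y => ?_)
  change _ = ExteriorAlgebra.algebraMapInv (ExteriorAlgebra.map _ (P.1 y))
  conv_rhs => rw [h0 y, AlgHom.commutes, ExteriorAlgebra.algebraMap_leftInverse]

variable [SigmaCompactSpace M] (A : LieAlgebroid E F V)

theorem schouten_isDer {p : ℕ} {P : ExtSec E F V} (hP : P ∈ extDeg E F V p) :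
    IsDer ((p : ℤ) - 1) (schouten A P) := fun q Q hQ R => by
  rw [(schouten_spec A).mul p q P hP Q hQ R, mul_comm (q : ℤ)]

/-- The operator `[P, ·]` has degree `p - 1`; on functions this is negative for `p = 0`. -/
theorem schouten_shift {p : ℕ} {P : ExtSec E F V} (hP : P ∈ extDeg E F V p) (q : ℕ)
    (Q : ExtSec E F V) (hQ : Q ∈ extDeg E F V q) :
    schouten A P Q = 0 ∨
      ∃ r : ℕ, (r : ℤ) = q + ((p : ℤ) - 1) ∧ schouten A P Q ∈ extDeg E F V r := by
  rcases Nat.eq_zero_or_pos (p + q) with h | h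
  · obtain ⟨rfl, rfl⟩ : p = 0 ∧ q = 0 := by omega
    obtain ⟨f, rfl⟩ := exists_ofFn hP
    obtain ⟨g, rfl⟩ := exists_ofFn hQ
    exact Or.inl ((schouten_spec A).fn_fn f g)
  · refine Or.inr ⟨p + q - 1, by omega, (schouten_spec A).deg p q _ (by omega) P hP Q hQ⟩

/-- The pullback `ρ^* d_x f` of the differential of a function. -/
def LieAlgebroid.pullD (f : SmoothFn E M) (x : M) : Dual ℝ (V x) := dAt f x ∘ₗ A.anchor.1 x

theorem schouten_fn_left (f : SmoothFn E M) (P : ExtSec E F V) (x : M) :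
    (schouten A (ofFn f) P).1 x = -contr (A.pullD f x) (P.1 x) := by
  refine IsDerAt.ext (ε := -1) (Z := evalExt E F V x ∘ₗ schouten A (ofFn f))
    (Z' := -(contr (A.pullD f x) ∘ₗ evalExt E F V x)) ?_ ?_ ?_ ?_ P
  · exact ((schouten_isDer A (ofFn_mem f)).of_eq (by simp)).isDerAt x
  · intro q Q hQ R
    change -contr _ (Q.1 x * R.1 x) = -contr _ (Q.1 x) * R.1 x + _ • (Q.1 x * -contr _ (R.1 x))
    rw [contr_mul _ _ (hQ x), neg_add, neg_mul, mul_neg, smul_neg,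
      neg_one_zpow_eq (m := -1 * (q : ℤ)) (n := q) (k := -q) (by ring)]
  · intro g
    change (schouten A (ofFn f) (ofFn g)).1 x = -contr _ ((ofFn g : ExtSec E F V).1 x)
    rw [(schouten_spec A).fn_fn, ofFn_val, contr_algebraMap, neg_zero]; rfl
  · intro u
    change (schouten A (ofFn f) (ofSec u)).1 x = -contr _ ((ofSec u).1 x)
    rw [(schouten_spec A).swap 0 1 _ (ofFn_mem f) _ (ofSec_mem u), (schouten_spec A).sec_fn,
      ofSec_val, contr_ι]
    simp only [Nat.cast_zero, Nat.cast_one, sub_self, mul_zero, zpow_zero, neg_smul, one_smul]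
    rfl

theorem schouten_fn_right {p : ℕ} {P : ExtSec E F V} (hP : P ∈ extDeg E F V p)
    (f : SmoothFn E M) (x : M) :
    (schouten A P (ofFn f)).1 x = (-1 : ℝ) ^ ((p : ℤ) - 1) • contr (A.pullD f x) (P.1 x) := by
  rw [(schouten_spec A).swap p 0 P hP _ (ofFn_mem f), ExtSec.rsmul_val, schouten_fn_left,
    neg_smul, smul_neg, neg_neg,
    neg_one_zpow_eq (m := ((p : ℤ) - 1) * ((0 : ℕ) - 1)) (n := (p : ℤ) - 1) (k := -((p : ℤ) - 1))
      (by push_cast; ring)]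

theorem schouten_sec_right {p : ℕ} {P : ExtSec E F V} (hP : P ∈ extDeg E F V p)
    (u : Sec E F V) : schouten A P (ofSec u) = -schouten A (ofSec u) P := by
  rw [(schouten_spec A).swap p 1 P hP _ (ofSec_mem u)]
  simp

theorem schouten_sec_isDer (u : Sec E F V) : IsDer 0 (schouten A (ofSec u)) :=
  (schouten_isDer A (ofSec_mem u)).of_eq (by simp)

theorem IsDer.zero_mul {D : ExtSec E F V →ₗ[ℝ] ExtSec E F V} (h : IsDer 0 D) {q : ℕ}
    {Q : ExtSec E F V} (hQ : Q ∈ extDeg E F V q) (R : ExtSec E F V) :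
    D (Q * R) = D Q * R + Q * D R := by
  rw [h q Q hQ R, MulZeroClass.zero_mul, zpow_zero, one_smul]

theorem IsDer.fn_mul {ε : ℤ} {D : ExtSec E F V →ₗ[ℝ] ExtSec E F V} (h : IsDer ε D)
    (f : SmoothFn E M) (R : ExtSec E F V) : D (ofFn f * R) = D (ofFn f) * R + ofFn f * D R := by
  rw [h 0 _ (ofFn_mem f) R, Nat.cast_zero, mul_zero, zpow_zero, one_smul]

theorem schouten_sec_fn_mul (u : Sec E F V) (f : SmoothFn E M) (P : ExtSec E F V) :
    schouten A (ofSec u) (ofFn f * P) =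
      ofFn (lieD (A.anchor.app u) f) * P + ofFn f * schouten A (ofSec u) P := by
  rw [(schouten_sec_isDer A u).fn_mul, (schouten_spec A).sec_fn]

end SchoutenFormulas

/-! ### Compatible tensors and their cocycles -/

section Compat

variable {E : Type*} [NormedAddCommGroup E] [NormedSpace ℝ E] [FiniteDimensional ℝ E]
  {M : Type*} [TopologicalSpace M] [ChartedSpace E M] [T2Space M] [IsManifold 𝓘(ℝ, E) ∞ M]
  {F : Type*} [NormedAddCommGroup F] [NormedSpace ℝ F] [FiniteDimensional ℝ F]
  {V : M → Type*} [TopologicalSpace (TotalSpace F V)] [∀ x, TopologicalSpace (V x)]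
  [∀ x, AddCommGroup (V x)] [∀ x, Module ℝ (V x)] [FiberBundle F V] [VectorBundle ℝ F V]
  [ContMDiffVectorBundle ∞ F V 𝓘(ℝ, E)]

instance (x : M) : FiniteDimensional ℝ (TangentSpace 𝓘(ℝ, E) x) :=
  inferInstanceAs (FiniteDimensional ℝ E)

variable (F V) in
/-- The fibres of `A` are isomorphic to the model fibre. -/
def fibreEquiv (x : M) : V x ≃ₗ[ℝ] F :=
  (trivializationAt F V x).linearEquivAt ℝ x (mem_baseSet_trivializationAt F V x)

/-- Every covector is the differential of a function. -/
theorem exists_dAt_eq (x : M) (ξ : Dual ℝ (TangentSpace 𝓘(ℝ, E) x)) :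
    ∃ f : SmoothFn E M, dAt f x = ξ := by
  obtain ⟨c, hx, -⟩ := exists_coords (E := E) x
  refine ⟨∑ i, ξ (c.X i x) • c.f i, LinearMap.ext fun v => ?_⟩
  change dAtₗ x v _ = _
  rw [map_sum]
  conv_rhs => rw [← c.span x hx v, map_sum]
  refine Finset.sum_congr rfl fun i _ => ?_
  rw [map_smul, map_smul, smul_eq_mul, smul_eq_mul, mul_comm]
  rfl

theorem exists_sec_eq (x : M) (v : V x) : ∃ u : Sec E F V, u x = v := by
  obtain ⟨φ, hφ⟩ := exists_frm (E := E) (F := F) (V := V) x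
  refine ⟨∑ i, (finBasis ℝ F).coord i (φ.e.linearMapAt ℝ x v) • φ.s i, ?_⟩
  rw [sec_sum_apply]
  simp only [ContMDiffSection.coe_smul, Pi.smul_apply, ← φ.symm_basis hφ, ← map_smul, ← map_sum,
    sum_coord_smul]
  exact Trivialization.symmₗ_linearMapAt (R := ℝ) φ.e (φ.sub hφ) v

/-- In coordinates, `H = ∑ dfᵢ ⊗ H(Xᵢ)`. -/
theorem Coords.hom_eq (c : Coords E M) (H : TA E F V) {y : M} (hy : y ∈ c.U) :
    H.1 y = ∑ i, (dAt (c.f i) y).smulRight (H.app (c.X i) y) := LinearMap.ext fun v => by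
  conv_lhs => rw [← c.span y hy v]
  simp only [map_sum, map_smul, LinearMap.sum_apply, LinearMap.smulRight_apply, HomSec.app_apply]

theorem isSmoothExt_of_local {P : ∀ x, ExteriorAlgebra ℝ (V x)}
    (h : ∀ x : M, ∃ Q : ExtSec E F V, ∀ᶠ y in 𝓝 x, P y = Q.1 y) : IsSmoothExt E F P := by
  intro e _ x hx
  obtain ⟨Q, hQ⟩ := h x
  exact (Q.2 e x hx).congr (hQ.mono fun y hy => by rw [hy])

variable {A : LieAlgebroid E F V} {k : ℕ}

/-- The contraction `ι_{df} ϖ` of a compatible tensor, a multivector section. -/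
def contrFn (ϖ : compatTensors A k) (f : SmoothFn E M) : ExtSec E F V :=
  ⟨fun x => contrL (dAt f x) (ϖ.1 x), ϖ.2.2.1 f⟩

theorem contrFn_val (ϖ : compatTensors A k) (f : SmoothFn E M) (x : M) :
    (contrFn ϖ f).1 x = contrL (dAt f x) (ϖ.1 x) := rfl

theorem contrFn_mem (ϖ : compatTensors A k) (f : SmoothFn E M) :
    contrFn ϖ f ∈ extDeg E F V (k - 1) := fun x => contrL_mem _ (ϖ.2.1 x)

theorem applyFirst_eq_sum (ϖ : compatTensors A k) (H : TA E F V) (c : Coords E M) {y : M}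
    (hy : y ∈ c.U) : applyFirst (H.1 y) (ϖ.1 y) =
      (∑ i, ofSec (H.app (c.X i)) * contrFn ϖ (c.f i)).1 y := by
  rw [c.hom_eq H hy, ext_sum_val]
  change applyFirstₗ _ _ = _
  rw [map_sum, LinearMap.sum_apply]
  exact Finset.sum_congr rfl fun i _ => applyFirst_smulRight _ _ _

/-- The bundle map `μ_ϖ : 𝔥 → ∧^k A`, `H ↦ (H ⊗ id) ϖ`. -/
def mu (hk : 1 ≤ k) (ϖ : compatTensors A k) : TA E F V →ₗ[SmoothFn E M] extDeg E F V k where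
  toFun H := ⟨⟨fun x => applyFirst (H.1 x) (ϖ.1 x), isSmoothExt_of_local fun x => by
      obtain ⟨c, hx, -⟩ := exists_coords (E := E) x
      exact ⟨_, Filter.eventually_of_mem (c.isOpen.mem_nhds hx)
        fun y hy => applyFirst_eq_sum ϖ H c hy⟩⟩,
    fun x => by
      have := applyFirst_mem (H.1 x) (ϖ.2.1 x)
      rwa [Nat.sub_add_cancel hk] at this⟩
  map_add' H K := Subtype.ext <| ExtSec.val_ext fun x => applyFirst_add _ _ _
  map_smul' f H := Subtype.ext <| ExtSec.val_ext fun x => by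
    change applyFirst (f x • H.1 x) (ϖ.1 x) = (f • (_ : ExtSec E F V)).1 x
    rw [applyFirst_smul, smul_ext_apply]

theorem isMu_mu (hk : 1 ≤ k) (ϖ : compatTensors A k) : IsMu ϖ.1 (mu hk ϖ) := fun H x => rfl

theorem IsMu.eq {ϖ : TensorFam E V} {m m' : TA E F V →ₗ[SmoothFn E M] extDeg E F V k}
    (h : IsMu ϖ m) (h' : IsMu ϖ m') : m = m' :=
  LinearMap.ext fun H => Subtype.ext <| ExtSec.val_ext fun x => (h H x).trans (h' H x).symm

theorem IsMu.apply_dTensor {ϖ : compatTensors A k}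
    {m : TA E F V →ₗ[SmoothFn E M] extDeg E F V k} (h : IsMu ϖ.1 m) (f : SmoothFn E M)
    (u : Sec E F V) : (m (dTensor f u)).1 = ofSec u * contrFn ϖ f :=
  ExtSec.val_ext fun x => (h _ x).trans (applyFirst_smulRight _ _ _)

section Sigma

variable [SigmaCompactSpace M]

/-- The map `μ_ϖ` is a `1`-cocycle. -/
theorem mu_mem_cocycles (hk : 1 ≤ k) (ϖ : compatTensors A k) : mu hk ϖ ∈ Z1Iso A k := fun H K =>
  Subtype.ext <| ExtSec.val_ext fun x => by
    change applyFirst (K.1 x ∘ₗ A.anchor.1 x ∘ₗ H.1 x - H.1 x ∘ₗ A.anchor.1 x ∘ₗ K.1 x) (ϖ.1 x) =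
      -derivExt (H.1 x ∘ₗ A.anchor.1 x) (applyFirst (K.1 x) (ϖ.1 x)) -
        -derivExt (K.1 x ∘ₗ A.anchor.1 x) (applyFirst (H.1 x) (ϖ.1 x))
    rw [applyFirst_bracket _ (ϖ.2.2.2 x)]
    abel

variable (A) in
/-- The tensor `D_ρ τ`. -/
def exactTensor (τ : extDeg E F V k) : compatTensors A k :=
  ⟨fun x => opD (A.anchor.1 x) (τ.1.1 x), fun x => opD_mem _ (τ.2 x), fun f => by
    have : (fun x => contrL (dAt f x) (opD (A.anchor.1 x) (τ.1.1 x))) =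
        (-schouten A (ofFn f) τ.1).1 := funext fun x => by
      rw [contrL_opD, ExtSec.neg_val, schouten_fn_left, neg_neg]; rfl
    rw [this]
    exact ExtSec.smooth _, fun x ξ η => by
    rw [contrL_opD, contrL_opD]
    exact CliffordAlgebra.contractLeft_comm _ _ _⟩

theorem contrL_exactTensor (τ : extDeg E F V k) (f : SmoothFn E M) (x : M) :
    contrL (dAt f x) ((exactTensor A τ).1 x) = contr (A.pullD f x) (τ.1.1 x) :=
  contrL_opD _ _ _

theorem exactTensor_mem (τ : extDeg E F V k) : (exactTensor A τ).1 ∈ exactTensors A k :=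
  ⟨τ.1, τ.2, fun _ => rfl⟩

/-- The cocycle `μ_{D_ρ τ}` is the coboundary of `-τ`. -/
theorem mu_exactTensor (hk : 1 ≤ k) (τ : extDeg E F V k) (H : TA E F V) :
    mu hk (exactTensor A τ) H = isoAd A k H (-τ) := Subtype.ext <| ExtSec.val_ext fun x => by
  change applyFirst (H.1 x) (opD (A.anchor.1 x) (τ.1.1 x)) =
    -derivExt (H.1 x ∘ₗ A.anchor.1 x) (-τ.1.1 x)
  rw [applyFirst_opD, map_neg, neg_neg]

end Sigma

theorem tensorFam_ext {ϖ ϖ' : TensorFam E V}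
    (h : ∀ (f : SmoothFn E M) x, contrL (dAt f x) (ϖ x) = contrL (dAt f x) (ϖ' x)) : ϖ = ϖ' :=
  funext fun x => tensor_ext fun ξ => by
    obtain ⟨f, rfl⟩ := exists_dAt_eq x ξ
    exact h f x

theorem eq_zero_of_ofSec_mul {m : ℕ} (hm : m < finrank ℝ F) {P : ExtSec E F V}
    (hP : P ∈ extDeg E F V m) (h : ∀ u, ofSec u * P = 0) : P = 0 := ExtSec.val_ext fun x => by
  have := (fibreEquiv F V x).symm.finiteDimensional
  refine eq_zero_of_ι_mul (k := m) ?_ (hP x) fun w => ?_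
  · rwa [(fibreEquiv F V x).finrank_eq]
  · obtain ⟨u, rfl⟩ := exists_sec_eq (E := E) (F := F) x w
    exact congrArg (fun Q : ExtSec E F V => Q.1 x) (h u)

/-- A compatible tensor is determined by its cocycle, since `k ≤ rank A`. -/
theorem mu_injective (hk : 1 ≤ k) (hk' : k ≤ finrank ℝ F) {ϖ ϖ' : compatTensors A k}
    (h : mu hk ϖ = mu hk ϖ') : ϖ = ϖ' := by
  refine Subtype.ext (tensorFam_ext fun f => ?_)
  have h0 : contrFn ϖ f - contrFn ϖ' f = 0 := by
    refine eq_zero_of_ofSec_mul (m := k - 1) (by omega)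
      (Submodule.sub_mem _ (contrFn_mem ϖ f) (contrFn_mem ϖ' f)) fun u => ?_
    rw [mul_sub, ← (isMu_mu hk ϖ).apply_dTensor, ← (isMu_mu hk ϖ').apply_dTensor, h, sub_self]
  exact fun x => sub_eq_zero.1 (congrArg (fun Q : ExtSec E F V => Q.1 x) h0)

end Compat

/-! ### Lie derivatives of bundle maps -/

section LieHom

variable {E : Type*} [NormedAddCommGroup E] [NormedSpace ℝ E] [FiniteDimensional ℝ E]
  {M : Type*} [TopologicalSpace M] [ChartedSpace E M] [T2Space M] [IsManifold 𝓘(ℝ, E) ∞ M]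
  {F : Type*} [NormedAddCommGroup F] [NormedSpace ℝ F] [FiniteDimensional ℝ F]
  {V : M → Type*} [TopologicalSpace (TotalSpace F V)] [∀ x, TopologicalSpace (V x)]
  [∀ x, AddCommGroup (V x)] [∀ x, Module ℝ (V x)] [FiberBundle F V] [VectorBundle ℝ F V]
  [ContMDiffVectorBundle ∞ F V 𝓘(ℝ, E)]

theorem vfBracket_jacobi (X Y Z : VecField E M) :
    vfBracket X (vfBracket Y Z) = vfBracket (vfBracket X Y) Z + vfBracket Y (vfBracket X Z) := by
  have : IsManifold 𝓘(ℝ, E) (minSmoothness ℝ 3) M := by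
    rw [minSmoothness_of_isRCLikeNormedField]
    infer_instance
  have h : ∀ W : VecField E M, ContMDiff 𝓘(ℝ, E) (𝓘(ℝ, E).prod 𝓘(ℝ, E)) (minSmoothness ℝ 2)
      (fun x => TotalSpace.mk' E (E := fun x : M => TangentSpace 𝓘(ℝ, E) x) x (W x)) := fun W => by
    rw [minSmoothness_of_isRCLikeNormedField]
    exact W.contMDiff.of_le ENat.LEInfty.out
  ext x
  exact congrFun (VectorField.leibniz_identity_mlieBracket (h X) (h Y) (h Z)) x

/-- The bracket of vector fields is the commutator of derivations. It follows from the Jacobi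
identity for `X`, `Y` and `f Z`, where `Z` does not vanish at the given point. -/
theorem lieD_vfBracket (X Y : VecField E M) (f : SmoothFn E M) :
    lieD (vfBracket X Y) f = lieD X (lieD Y f) - lieD Y (lieD X f) := by
  -- the Jacobi identity, expanded by the Leibniz rule
  have key : ∀ Z : VecField E M,
      lieD (vfBracket X Y) f • Z = (lieD X (lieD Y f) - lieD Y (lieD X f)) • Z := fun Z => by
    have h := vfBracket_jacobi X Y (f • Z)
    simp only [vfBracket_smul, vfBracket_add, vfBracket_jacobi X Y Z] at h
    rw [sub_smul]
    simp only [smul_add] at h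
    rw [← sub_eq_zero] at h ⊢
    rw [← neg_eq_zero, ← h]
    abel
  ext x
  -- in dimension zero there is no nonvanishing `Z`, and both sides are zero
  by_cases hE : Subsingleton E
  · have : ∀ (W : VecField E M) (g : SmoothFn E M), lieD W g x = 0 := fun W g => by
      have h0 : W x = 0 := Subsingleton.elim (α := E) _ _
      rw [lieD_apply, h0, map_zero]
    change _ = lieD X (lieD Y f) x - lieD Y (lieD X f) x
    rw [this, this, this, sub_zero]
  · rw [not_subsingleton_iff_nontrivial] at hE
    obtain ⟨v, hv⟩ := exists_ne (0 : E)
    obtain ⟨Z, hZ⟩ := exists_sec_eq (E := E) (F := E)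
      (V := fun x : M => TangentSpace 𝓘(ℝ, E) x) x v
    have h := congrArg (fun W : VecField E M => W x) (key Z)
    simp only [smul_sec_apply, hZ] at h
    exact smul_left_injective ℝ hv h

variable (A : LieAlgebroid E F V)

theorem lieHom_add (u : Sec E F V) (K K' : TA E F V) :
    lieHom A u (K + K') = lieHom A u K + lieHom A u K' := by
  have h : ∀ (K K' : TA E F V) (X : VecField E M), (K + K').app X = K.app X + K'.app X :=
    fun _ _ _ => rfl
  refine homSec_ext fun X => ?_
  rw [h, lieHom_app, lieHom_app, lieHom_app, h, h, map_add]
  abel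

theorem lieHom_smul (u : Sec E F V) (f : SmoothFn E M) (K : TA E F V) :
    lieHom A u (f • K) = f • lieHom A u K + lieD (A.anchor.app u) f • K := by
  have h : ∀ (K K' : TA E F V) (X : VecField E M), (K + K').app X = K.app X + K'.app X :=
    fun _ _ _ => rfl
  have h' : ∀ (f : SmoothFn E M) (K : TA E F V) (X : VecField E M), (f • K).app X = f • K.app X :=
    fun _ _ _ => rfl
  refine homSec_ext fun X => ?_
  rw [h, h', h', lieHom_app, lieHom_app, h', h', A.leibniz, smul_sub]
  abel

/-- The Lie derivative of `df ⊗ v`. -/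
theorem lieHom_dTensor (u : Sec E F V) (f : SmoothFn E M) (v : Sec E F V) :
    lieHom A u (dTensor f v) =
      dTensor (lieD (A.anchor.app u) f) v + dTensor f (A.bracket u v) := by
  have h : ∀ (f : SmoothFn E M) (v : Sec E F V) (X : VecField E M),
      (dTensor f v).app X = lieD X f • v := fun _ _ _ => rfl
  have h' : ∀ (K K' : TA E F V) (X : VecField E M), (K + K').app X = K.app X + K'.app X :=
    fun _ _ _ => rfl
  refine homSec_ext fun X => ?_
  rw [h', lieHom_app, h, h, h, h, A.leibniz, lieD_vfBracket, sub_smul]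
  abel

/-- A `C^∞(M)`-linear map on `Γ(T^*M ⊗ A)` is determined by its values on the tensors
`df ⊗ v`. -/
theorem homLinear_ext {Φ Ψ : TA E F V →ₗ[SmoothFn E M] ExtSec E F V}
    (h : ∀ f v, Φ (dTensor f v) = Ψ (dTensor f v)) : Φ = Ψ := by
  refine LinearMap.ext fun K => ExtSec.val_ext fun x => ?_
  obtain ⟨c, hx, -⟩ := exists_coords (E := E) x
  obtain ⟨ψ, hψ, hψ'⟩ := exists_bump (E := E) x (c.isOpen.mem_nhds hx)
  have hK : ψ • K = ψ • ∑ i, dTensor (c.f i) (K.app (c.X i)) := by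
    refine Subtype.ext (funext fun y => ?_)
    rw [smul_hom_val, smul_hom_val]
    by_cases hy : y ∈ c.U
    · rw [c.hom_eq K hy]
      congr 1
      simp only [Submodule.coe_sum, Finset.sum_apply]
      rfl
    · rw [hψ' y hy, zero_smul, zero_smul]
  have h1 : ψ • Φ K = ψ • Ψ K := by
    rw [← map_smul, ← map_smul, hK]
    simp only [map_smul, map_sum, h]
  have h2 := congrArg (fun Q : ExtSec E F V => Q.1 x) h1
  simpa only [smul_ext_apply, hψ.self_of_nhds, one_smul] using h2

end LieHom

/-! ### Cocycles of the jet Lie algebroid -/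

section JetCocycle

variable {E : Type*} [NormedAddCommGroup E] [NormedSpace ℝ E] [FiniteDimensional ℝ E]
  {M : Type*} [TopologicalSpace M] [ChartedSpace E M] [T2Space M] [IsManifold 𝓘(ℝ, E) ∞ M]
  {F : Type*} [NormedAddCommGroup F] [NormedSpace ℝ F] [FiniteDimensional ℝ F]
  {V : M → Type*} [TopologicalSpace (TotalSpace F V)] [∀ x, TopologicalSpace (V x)]
  [∀ x, AddCommGroup (V x)] [∀ x, Module ℝ (V x)] [FiberBundle F V] [VectorBundle ℝ F V]
  [ContMDiffVectorBundle ∞ F V 𝓘(ℝ, E)]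

theorem ofSec_mul_comm (u : Sec E F V) {q : ℕ} {Q : ExtSec E F V} (hQ : Q ∈ extDeg E F V q) :
    ofSec u * Q = (-1 : ℝ) ^ (q : ℤ) • (Q * ofSec u) :=
  ExtSec.val_ext fun x => ι_mul_comm_deg _ (hQ x)

variable {A : LieAlgebroid E F V} {k : ℕ}

/-- The value `(-1)^{k-1} ι_{df} ϖ` on the function `f` of the differential with tensor part `ϖ`. -/
def symb (ϖ : compatTensors A k) (f : SmoothFn E M) : ExtSec E F V :=
  (-1 : ℝ) ^ (k - 1) • contrFn ϖ f

theorem symb_mem (ϖ : compatTensors A k) (f : SmoothFn E M) :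
    symb ϖ f ∈ extDeg E F V (k - 1) := fun x =>
  Submodule.smul_mem _ _ (contrFn_mem ϖ f x)

theorem IsMu.apply_dTensor_symb {ϖ : compatTensors A k}
    {m : TA E F V →ₗ[SmoothFn E M] extDeg E F V k} (h : IsMu ϖ.1 m) (f : SmoothFn E M)
    (u : Sec E F V) : (m (dTensor f u)).1 = symb ϖ f * ofSec u := by
  rw [h.apply_dTensor, ofSec_mul_comm u (contrFn_mem ϖ f), symb, smul_mul_assoc, zpow_natCast]

theorem homDeriv_compAnchor_add (H K : TA E F V) (w : ExtSec E F V) :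
    homDeriv (compAnchor A (H + K)) w =
      homDeriv (compAnchor A H) w + homDeriv (compAnchor A K) w :=
  ExtSec.val_ext fun x => derivExt_add (H.1 x ∘ₗ A.anchor.1 x) (K.1 x ∘ₗ A.anchor.1 x) (w.1 x)

theorem homDeriv_compAnchor_smul (f : SmoothFn E M) (H : TA E F V) (w : ExtSec E F V) :
    homDeriv (compAnchor A (f • H)) w = f • homDeriv (compAnchor A H) w :=
  ExtSec.val_ext fun x => by
    rw [smul_ext_apply]
    exact derivExt_smul (f x) (H.1 x ∘ₗ A.anchor.1 x) (w.1 x)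

variable [SigmaCompactSpace M]

theorem homDeriv_dTensor (hk : 1 ≤ k) {w : ExtSec E F V} (hw : w ∈ extDeg E F V k)
    (f : SmoothFn E M) (v : Sec E F V) :
    homDeriv (compAnchor A (dTensor f v)) w = schouten A w (ofFn f) * ofSec v := by
  refine ExtSec.val_ext fun x => ?_
  rw [ExtSec.mul_val, schouten_fn_right A hw, ofSec_val, smul_mul_assoc]
  have h1 : contr (A.pullD f x) (w.1 x) ∈
      (⋀[ℝ]^(k - 1) (V x) : Submodule ℝ (ExteriorAlgebra ℝ (V x))) :=
    contr_mem _ _ (by rw [Nat.sub_add_cancel hk]; exact hw x)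
  have h2 : derivExt ((A.pullD f x).smulRight (v x)) (w.1 x) = _ := derivExt_smulRight _ _ _
  refine h2.trans ?_
  rw [ι_mul_comm_deg _ h1, Nat.cast_sub hk, Nat.cast_one]

/-- The infinitesimal form, on functions, of the cocycle condition for `j¹u` and `df ⊗ v`. -/
def IsSymbCompat (ϖ : compatTensors A k) (D : Sec E F V → ExtSec E F V) : Prop :=
  ∀ u f, symb ϖ (lieD (A.anchor.app u) f) =
    schouten A (ofSec u) (symb ϖ f) + schouten A (D u) (ofFn f)

theorem mu_lieHom_dTensor {ϖ : compatTensors A k}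
    {m : TA E F V →ₗ[SmoothFn E M] extDeg E F V k} (h : IsMu ϖ.1 m) (u : Sec E F V)
    (f : SmoothFn E M) (v : Sec E F V) :
    (m (lieHom A u (dTensor f v))).1 - schouten A (ofSec u) (m (dTensor f v)).1 =
      (symb ϖ (lieD (A.anchor.app u) f) - schouten A (ofSec u) (symb ϖ f)) * ofSec v := by
  rw [lieHom_dTensor, map_add, Submodule.coe_add, h.apply_dTensor_symb, h.apply_dTensor_symb,
    h.apply_dTensor_symb, (schouten_sec_isDer A u).zero_mul (symb_mem ϖ f),
    (schouten_spec A).sec_sec, sub_mul]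
  abel

/-- The cocycle identity for `j¹u` and `K`. The difference of `m (𝓛_u K)` and `[u, m K]` is
`C^∞(M)`-linear in `K`, so it is enough to take `K = df ⊗ v`. -/
theorem mu_lieHom (hk : 1 ≤ k) {ϖ : compatTensors A k}
    {m : TA E F V →ₗ[SmoothFn E M] extDeg E F V k} (h : IsMu ϖ.1 m) {D : Sec E F V → ExtSec E F V}
    (hD : ∀ u, D u ∈ extDeg E F V k) (hc : IsSymbCompat ϖ D) (u : Sec E F V) (K : TA E F V) :
    (m (lieHom A u K)).1 =
      schouten A (ofSec u) (m K).1 + homDeriv (compAnchor A K) (D u) := by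
  let Φ : TA E F V →ₗ[SmoothFn E M] ExtSec E F V :=
    { toFun := fun K => (m (lieHom A u K)).1 - schouten A (ofSec u) (m K).1
      map_add' := fun K K' => by
        rw [lieHom_add, map_add, map_add, Submodule.coe_add, Submodule.coe_add, map_add]; abel
      map_smul' := fun f K => by
        rw [lieHom_smul, map_add, map_smul, map_smul, map_smul, Submodule.coe_add,
          Submodule.coe_smul, Submodule.coe_smul, Submodule.coe_smul, fn_smul_eq f (m K).1,
          schouten_sec_fn_mul, RingHom.id_apply, smul_sub, fn_smul_eq, fn_smul_eq, fn_smul_eq]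
        abel }
  let Ψ : TA E F V →ₗ[SmoothFn E M] ExtSec E F V :=
    { toFun := fun K => homDeriv (compAnchor A K) (D u)
      map_add' := fun K K' => homDeriv_compAnchor_add K K' _
      map_smul' := fun f K => homDeriv_compAnchor_smul f K _ }
  have hΦ : Φ = Ψ := homLinear_ext fun f v => by
    change (m (lieHom A u (dTensor f v))).1 - schouten A (ofSec u) (m (dTensor f v)).1 =
      homDeriv (compAnchor A (dTensor f v)) (D u)
    rw [mu_lieHom_dTensor h, homDeriv_dTensor hk (hD u), hc, add_sub_cancel_left]
  exact sub_eq_iff_eq_add'.1 (LinearMap.congr_fun hΦ K)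

/-- The converse of `mu_lieHom`: the identity for `K = df ⊗ v` and all `v` may be divided by `v`. -/
theorem symbCompat_of_mu_lieHom (hk : 1 ≤ k) (hk' : k ≤ finrank ℝ F) {ϖ : compatTensors A k}
    {m : TA E F V →ₗ[SmoothFn E M] extDeg E F V k} (h : IsMu ϖ.1 m) {D : Sec E F V → ExtSec E F V}
    (hD : ∀ u, D u ∈ extDeg E F V k)
    (hc : ∀ u K, (m (lieHom A u K)).1 =
      schouten A (ofSec u) (m K).1 + homDeriv (compAnchor A K) (D u)) : IsSymbCompat ϖ D := by
  intro u f
  have hmem : schouten A (ofSec u) (symb ϖ f) ∈ extDeg E F V (k - 1) :=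
    (schouten_spec A).deg 1 (k - 1) (k - 1) (add_comm _ _) _ (ofSec_mem u) _ (symb_mem ϖ f)
  have hmem' : schouten A (D u) (ofFn f) ∈ extDeg E F V (k - 1) :=
    (schouten_spec A).deg k 0 (k - 1) (by omega) _ (hD u) _ (ofFn_mem f)
  have hmem0 := Submodule.sub_mem _ (Submodule.sub_mem _
    (symb_mem ϖ (lieD (A.anchor.app u) f)) hmem) hmem'
  have h0 := eq_zero_of_ofSec_mul (m := k - 1) (by omega) hmem0 fun v => by
    rw [ofSec_mul_comm v hmem0, sub_mul, ← mu_lieHom_dTensor h, ← homDeriv_dTensor hk (hD u), hc,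
      add_sub_cancel_left, sub_self, smul_zero]
  rw [sub_sub, sub_eq_zero] at h0
  exact h0

/-- The bundle map `𝔍A → ∧^k A` with values `D u` on `j¹u` and restriction `μ_ϖ` to `𝔥`. -/
def jetMap (hk : 1 ≤ k) (ϖ : compatTensors A k) (D : Sec E F V →ₗ[ℝ] ExtSec E F V)
    (hD : ∀ u, D u ∈ extDeg E F V k)
    (hmul : ∀ f u, D (f • u) = symb ϖ f * ofSec u + ofFn f * D u) :
    JetSec E F V →ₗ[SmoothFn E M] extDeg E F V k where
  toFun a := ⟨D a.1, hD a.1⟩ + mu hk ϖ a.2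
  map_add' a b := Subtype.ext (by
    change D (a.1 + b.1) + (mu hk ϖ (a.2 + b.2)).1 =
      D a.1 + (mu hk ϖ a.2).1 + (D b.1 + (mu hk ϖ b.2).1)
    rw [map_add, map_add, Submodule.coe_add]; abel)
  map_smul' f a := Subtype.ext (by
    change D (f • a.1) + (mu hk ϖ (f • a.2 - dTensor f a.1)).1 = f • (D a.1 + (mu hk ϖ a.2).1)
    rw [hmul, map_sub, map_smul, Submodule.coe_sub, (isMu_mu hk ϖ).apply_dTensor_symb, smul_add,
      fn_smul_eq, Submodule.coe_smul]
    abel)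

theorem jetMap_mem_cocycles (hk : 1 ≤ k) (ϖ : compatTensors A k)
    (D : Sec E F V →ₗ[ℝ] ExtSec E F V) (hD : ∀ u, D u ∈ extDeg E F V k)
    (hmul : ∀ f u, D (f • u) = symb ϖ f * ofSec u + ofFn f * D u) (hc : IsSymbCompat ϖ D)
    (hbr : ∀ u v, D (A.bracket u v) = schouten A (ofSec u) (D v) - schouten A (ofSec v) (D u)) :
    jetMap hk ϖ D hD hmul ∈ Z1Jet A k := fun a b => Subtype.ext <| by
  have h1 := congrArg Subtype.val (mu_mem_cocycles hk ϖ a.2 b.2)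
  have h2 := mu_lieHom hk (isMu_mu hk ϖ) hD hc a.1 b.2
  have h3 := mu_lieHom hk (isMu_mu hk ϖ) hD hc b.1 a.2
  change (mu hk ϖ (isoBracket A a.2 b.2)).1 = -homDeriv (compAnchor A a.2) (mu hk ϖ b.2).1 -
    -homDeriv (compAnchor A b.2) (mu hk ϖ a.2).1 at h1
  change D (A.bracket a.1 b.1) +
      (mu hk ϖ (lieHom A a.1 b.2 - lieHom A b.1 a.2 + isoBracket A a.2 b.2)).1 =
    (schouten A (ofSec a.1) (D b.1 + (mu hk ϖ b.2).1) -
      homDeriv (compAnchor A a.2) (D b.1 + (mu hk ϖ b.2).1)) -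
    (schouten A (ofSec b.1) (D a.1 + (mu hk ϖ a.2).1) -
      homDeriv (compAnchor A b.2) (D a.1 + (mu hk ϖ a.2).1))
  rw [map_add (mu hk ϖ), map_sub (mu hk ϖ), Submodule.coe_add, Submodule.coe_sub, h1, h2, h3, hbr]
  simp only [map_add]
  abel

end JetCocycle

/-! ### From differentials to characteristic pairs -/

section OfDifferential

variable {E : Type*} [NormedAddCommGroup E] [NormedSpace ℝ E] [FiniteDimensional ℝ E]
  {M : Type*} [TopologicalSpace M] [ChartedSpace E M] [T2Space M] [IsManifold 𝓘(ℝ, E) ∞ M]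
  {F : Type*} [NormedAddCommGroup F] [NormedSpace ℝ F] [FiniteDimensional ℝ F]
  {V : M → Type*} [TopologicalSpace (TotalSpace F V)] [∀ x, TopologicalSpace (V x)]
  [∀ x, AddCommGroup (V x)] [∀ x, Module ℝ (V x)] [FiberBundle F V] [VectorBundle ℝ F V]
  [ContMDiffVectorBundle ∞ F V 𝓘(ℝ, E)]
  [SigmaCompactSpace M] {A : LieAlgebroid E F V} {k : ℕ}

variable (E F V) in
/-- The inclusion `C^∞(M) → Γ(∧^• A)` as a linear map. -/
def ofFnₗ : SmoothFn E M →ₗ[ℝ] ExtSec E F V where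
  toFun := ofFn
  map_add' := ofFn_add
  map_smul' := ofFn_rsmul

variable (E F V) in
/-- The inclusion `Γ(A) → Γ(∧^• A)` as a linear map. -/
def ofSecₗ : Sec E F V →ₗ[ℝ] ExtSec E F V where
  toFun := ofSec
  map_add' := ofSec_add
  map_smul' := ofSec_rsmul

theorem IsDer.isPointDeriv {ε : ℤ} {D : ExtSec E F V →ₗ[ℝ] ExtSec E F V} (h : IsDer ε D) (x : M) :
    IsPointDeriv x (evalExt E F V x ∘ₗ D ∘ₗ ofFnₗ E F V) := fun f g => by
  change (D (ofFn (f * g))).1 x = f x • (D (ofFn g)).1 x + g x • (D (ofFn f)).1 x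
  rw [ofFn_mul, h.fn_mul, ← ofFn_comm, ExtSec.add_val, ExtSec.mul_val, ExtSec.mul_val, ofFn_val,
    ofFn_val, ← Algebra.smul_def, ← Algebra.smul_def, add_comm]

variable (δ : differentials A k)

theorem differentials.isDer : IsDer ((k : ℤ) - 1) δ.1 := δ.2.2.1

theorem differentials.fn_mem (f : SmoothFn E M) : δ.1 (ofFn f) ∈ extDeg E F V (k - 1) := by
  have := δ.2.1 0 _ (ofFn_mem f)
  rwa [zero_add] at this

theorem differentials.sec_mem (hk : 1 ≤ k) (u : Sec E F V) :
    δ.1 (ofSec u) ∈ extDeg E F V k := by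
  have := δ.2.1 1 _ (ofSec_mem u)
  rwa [Nat.add_sub_cancel' hk] at this

/-- The tensor part of a differential, as a family of tensors. -/
def tensorPart (x : M) : TangentSpace 𝓘(ℝ, E) x ⊗[ℝ] ExteriorAlgebra ℝ (V x) :=
  let c := (exists_coords (E := E) x).choose
  ∑ i, c.X i x ⊗ₜ[ℝ] ((-1 : ℝ) ^ (k - 1) • (δ.1 (ofFn (c.f i))).1 x)

/-- The tensor part `ϖ` of `δ` satisfies `ι_{df} ϖ = (-1)^{k-1} δ f`, since `δ` is a derivation on
functions and hence depends only on their differentials. -/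
theorem contrL_tensorPart (f : SmoothFn E M) (x : M) :
    contrL (dAt f x) (tensorPart δ x) = (-1 : ℝ) ^ (k - 1) • (δ.1 (ofFn f)).1 x := by
  have h := ((differentials.isDer δ).isPointDeriv x).eq_sum
    (exists_coords (E := E) x).choose_spec f
  change (δ.1 (ofFn f)).1 x = ∑ i, _ • (δ.1 (ofFn _)).1 x at h
  rw [h]
  simp only [tensorPart, map_sum, contrL_tmul, Finset.smul_sum]
  exact Finset.sum_congr rfl fun i _ => smul_comm _ _ _

theorem tensorPart_mem (hk : 1 ≤ k) : tensorPart δ ∈ compatTensors A k := by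
  refine ⟨fun x => Submodule.sum_mem _ fun i _ => tmul_mem_tensorDeg _
    (Submodule.smul_mem _ _ (differentials.fn_mem δ _ x)), fun f => ?_, fun x ξ η => ?_⟩
  · rw [funext (contrL_tensorPart δ f)]
    exact (δ.1 (ofFn f)).2.smul _
  · obtain ⟨f, rfl⟩ := exists_dAt_eq x ξ
    obtain ⟨g, rfl⟩ := exists_dAt_eq x η
    have h := congrArg (fun Q : ExtSec E F V => Q.1 x) (δ.2.2.2 0 _ (ofFn_mem f) (ofFn g))
    change (δ.1 (schouten A (ofFn f) (ofFn g))).1 x = _ at h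
    simp only [ExtSec.add_val, ExtSec.rsmul_val, schouten_fn_left,
      schouten_fn_right A (differentials.fn_mem δ f)] at h
    rw [(schouten_spec A).fn_fn, map_zero, ExtSec.zero_val, Nat.cast_sub hk,
      neg_one_zpow_eq (m := ((k : ℤ) - 1) * ((0 : ℕ) - 1)) (n := ((k : ℤ) - (1 : ℕ)) - 1 + 1)
        (k := -((k : ℤ) - 1)) (by push_cast; ring), neg_one_zpow_add_one, neg_smul, smul_neg,
      neg_neg, ← smul_add, eq_comm, smul_eq_zero] at h
    have h0 := h.resolve_left (zpow_ne_zero _ (by norm_num))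
    rw [contrL_tensorPart, contrL_tensorPart, map_smul, map_smul, ← smul_neg]
    congr 1
    exact eq_neg_of_add_eq_zero_right h0

/-- The tensor part of a differential. -/
def toTensor (hk : 1 ≤ k) : compatTensors A k := ⟨tensorPart δ, tensorPart_mem δ hk⟩

theorem symb_toTensor (hk : 1 ≤ k) (f : SmoothFn E M) :
    symb (toTensor δ hk) f = δ.1 (ofFn f) := ExtSec.val_ext fun x => by
  change (-1 : ℝ) ^ (k - 1) • contrL (dAt f x) (tensorPart δ x) = _
  rw [contrL_tensorPart, smul_smul, ← mul_pow]
  norm_num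

theorem exists_charPair (hk : 1 ≤ k) :
    ∃ (χ : Z1Jet A k) (ϖ : compatTensors A k), IsCharPair A k δ χ ϖ := by
  have hD : ∀ u, (δ.1 ∘ₗ ofSecₗ E F V) u ∈ extDeg E F V k := differentials.sec_mem δ hk
  have hmul : ∀ f u, (δ.1 ∘ₗ ofSecₗ E F V) (f • u) =
      symb (toTensor δ hk) f * ofSec u + ofFn f * (δ.1 ∘ₗ ofSecₗ E F V) u := fun f u => by
    change δ.1 (ofSec (f • u)) = _ + ofFn f * δ.1 (ofSec u)
    rw [← ofFn_mul_ofSec, (differentials.isDer δ).fn_mul, symb_toTensor]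
  have hbr : ∀ u P, δ.1 (schouten A (ofSec u) P) =
      schouten A (δ.1 (ofSec u)) P + schouten A (ofSec u) (δ.1 P) := fun u P => by
    rw [δ.2.2.2 1 _ (ofSec_mem u) P]
    simp
  refine ⟨⟨jetMap hk (toTensor δ hk) (δ.1 ∘ₗ ofSecₗ E F V) hD hmul,
    jetMap_mem_cocycles hk _ _ hD hmul (fun u f => ?_) fun u v => ?_⟩, toTensor δ hk,
    fun H x => ?_, fun u => ?_, fun f x => ?_⟩
  · change _ = _ + schouten A (δ.1 (ofSec u)) (ofFn f)
    rw [symb_toTensor, symb_toTensor, ← (schouten_spec A).sec_fn, hbr, add_comm]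
  · change δ.1 (ofSec _) = schouten A (ofSec u) (δ.1 (ofSec v)) -
      schouten A (ofSec v) (δ.1 (ofSec u))
    rw [← (schouten_spec A).sec_sec, hbr, schouten_sec_right A (differentials.sec_mem δ hk u)]
    abel
  · change (δ.1 (ofSec 0) + (mu hk (toTensor δ hk) H).1).1 x = _
    rw [ofSec_zero, map_zero, zero_add]; rfl
  · change _ = δ.1 (ofSec u) + (mu hk (toTensor δ hk) 0).1
    rw [map_zero, Submodule.coe_zero, add_zero]
  · rw [← symb_toTensor δ hk]; rfl

end OfDifferential

/-! ### Extension of derivations from functions and sections to multivector sections -/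

section Extension

variable {E : Type*} [NormedAddCommGroup E] [NormedSpace ℝ E] [FiniteDimensional ℝ E]
  {M : Type*} [TopologicalSpace M] [ChartedSpace E M] [T2Space M] [IsManifold 𝓘(ℝ, E) ∞ M]
  {F : Type*} [NormedAddCommGroup F] [NormedSpace ℝ F] [FiniteDimensional ℝ F]
  {V : M → Type*} [TopologicalSpace (TotalSpace F V)] [∀ x, TopologicalSpace (V x)]
  [∀ x, AddCommGroup (V x)] [∀ x, Module ℝ (V x)] [FiberBundle F V] [VectorBundle ℝ F V]
  [ContMDiffVectorBundle ∞ F V 𝓘(ℝ, E)]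

variable (E F V) in
/-- The values on functions and on sections of `A` of a graded derivation of `Γ(∧^• A)` of
degree `m`. -/
structure DerData (m : ℕ) where
  /-- The values on functions. -/
  fn : SmoothFn E M →ₗ[ℝ] ExtSec E F V
  /-- The values on sections of `A`. -/
  sec : Sec E F V →ₗ[ℝ] ExtSec E F V
  fn_mem : ∀ f, fn f ∈ extDeg E F V m
  sec_mem : ∀ u, sec u ∈ extDeg E F V (m + 1)
  fn_mul : ∀ f g, fn (f * g) = ofFn f * fn g + ofFn g * fn f
  sec_smul : ∀ f u, sec (f • u) = fn f * ofSec u + ofFn f * sec u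

namespace Frm

variable (φ : Frm E F V)

/-- The derivation `T` at a point, applied to the components of `P` in the frame. -/
def compDeriv (T : SmoothFn E M →ₗ[ℝ] ExteriorAlgebra ℝ F) (P : ExtSec E F V) :
    ExteriorAlgebra ℝ F :=
  ∑ a, T (φ.coordFn ((finBasis ℝ (ExteriorAlgebra ℝ F)).coord a) P) *
    finBasis ℝ (ExteriorAlgebra ℝ F) a

variable {φ} {T : SmoothFn E M →ₗ[ℝ] ExteriorAlgebra ℝ F} {y : M}

/-- `compDeriv` may be computed from any local expression of `P` with constant multivectors. -/
theorem compDeriv_eq (hT : IsPointDeriv y T) (hy : y ∈ φ.U) {P : ExtSec E F V} {ι : Type*}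
    [Fintype ι] {f : ι → SmoothFn E M} {w : ι → ExteriorAlgebra ℝ F}
    (h : ∀ z ∈ φ.U, φ.loc P z = ∑ j, f j z • w j) : φ.compDeriv T P = ∑ j, T (f j) * w j := by
  let b := finBasis ℝ (ExteriorAlgebra ℝ F)
  have h1 : ∀ a, T (φ.coordFn (b.coord a) P) = ∑ j, b.coord a (w j) • T (f j) := fun a => by
    have : ∀ z ∈ φ.U, φ.coordFn (b.coord a) P z =
        (∑ j, b.coord a (w j) • f j : SmoothFn E M) z := fun z hz => by
      rw [φ.coordFn_apply hz, h z hz, fn_sum_apply, map_sum]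
      refine Finset.sum_congr rfl fun j _ => ?_
      rw [map_smul, fn_smul_apply, smul_eq_mul, mul_comm]
    rw [hT.congr (Filter.eventually_of_mem (φ.isOpen.mem_nhds hy) this), map_sum]
    simp only [map_smul]
  have h2 : ∀ j, T (f j) * w j = ∑ a, b.coord a (w j) • (T (f j) * b a) := fun j => by
    conv_lhs => rw [← sum_coord_smul b (w j), Finset.mul_sum]
    simp only [mul_smul_comm]
  change ∑ a, T (φ.coordFn (b.coord a) P) * b a = _
  simp only [h1, h2, Finset.sum_mul, smul_mul_assoc]
  exact Finset.sum_comm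

theorem loc_eq_sum (P : ExtSec E F V) {z : M} (hz : z ∈ φ.U) :
    φ.loc P z = ∑ a, φ.coordFn ((finBasis ℝ (ExteriorAlgebra ℝ F)).coord a) P z •
      finBasis ℝ (ExteriorAlgebra ℝ F) a := by
  simp only [φ.coordFn_apply hz, sum_coord_smul]

theorem compDeriv_mul (hT : IsPointDeriv y T) (hy : y ∈ φ.U) {m p : ℕ}
    (hm : ∀ f, T f ∈ (⋀[ℝ]^m F : Submodule ℝ (ExteriorAlgebra ℝ F))) {P : ExtSec E F V}
    (hP : P ∈ extDeg E F V p) (Q : ExtSec E F V) :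
    φ.compDeriv T (P * Q) = φ.compDeriv T P * φ.loc Q y +
      (-1 : ℝ) ^ ((m : ℤ) * p) • (φ.loc P y * φ.compDeriv T Q) := by
  let b := finBasis ℝ (ExteriorAlgebra ℝ F)
  have h := compDeriv_eq hT hy (P := P * Q)
    (f := fun j : _ × _ => φ.coordFn (b.coord j.1) P * φ.coordFn (b.coord j.2) Q)
    (w := fun j => b j.1 * b j.2) fun z hz => by
      rw [φ.loc_mul, loc_eq_sum P hz, loc_eq_sum Q hz, Finset.sum_mul_sum,
        Fintype.sum_prod_type]
      refine Finset.sum_congr rfl fun a _ => Finset.sum_congr rfl fun c _ => ?_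
      rw [smul_mul_smul_comm, fn_mul_apply]
  have e1 : φ.compDeriv T P * φ.loc Q y = ∑ a, ∑ c,
      φ.coordFn (b.coord c) Q y • (T (φ.coordFn (b.coord a) P) * (b a * b c)) := by
    rw [loc_eq_sum Q hy, compDeriv, Finset.sum_mul_sum]
    refine Finset.sum_congr rfl fun a _ => Finset.sum_congr rfl fun c _ => ?_
    rw [mul_smul_comm, mul_assoc]
  have e2 : (-1 : ℝ) ^ ((m : ℤ) * p) • (φ.loc P y * φ.compDeriv T Q) = ∑ a, ∑ c,
      φ.coordFn (b.coord a) P y • (T (φ.coordFn (b.coord c) Q) * (b a * b c)) := by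
    rw [compDeriv, Finset.mul_sum, Finset.smul_sum, Finset.sum_comm]
    refine Finset.sum_congr rfl fun c _ => ?_
    rw [← mul_assoc, ← smul_mul_assoc, ← mul_comm_deg (hm _) (φ.loc_mem hP y), loc_eq_sum P hy,
      Finset.mul_sum, Finset.sum_mul]
    refine Finset.sum_congr rfl fun a _ => ?_
    rw [mul_smul_comm, smul_mul_assoc, mul_assoc]
  rw [h, e1, e2, Fintype.sum_prod_type, ← Finset.sum_add_distrib]
  refine Finset.sum_congr rfl fun a _ => ?_
  rw [← Finset.sum_add_distrib]
  refine Finset.sum_congr rfl fun c _ => ?_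
  rw [hT, add_mul, smul_mul_assoc, smul_mul_assoc, add_comm]

theorem compDeriv_mem (hT : IsPointDeriv y T) (hy : y ∈ φ.U) {m p : ℕ}
    (hm : ∀ f, T f ∈ (⋀[ℝ]^m F : Submodule ℝ (ExteriorAlgebra ℝ F))) {P : ExtSec E F V}
    (hP : P ∈ extDeg E F V p) :
    φ.compDeriv T P ∈ (⋀[ℝ]^(p + m) F : Submodule ℝ (ExteriorAlgebra ℝ F)) := by
  let S : Submodule ℝ (ExteriorAlgebra ℝ F) := ⋀[ℝ]^p F
  obtain ⟨g, hg⟩ := S.subtype.exists_leftInverse_of_injective S.ker_subtype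
  have h := compDeriv_eq hT hy (P := P)
    (f := fun a => φ.coordFn ((finBasis ℝ (ExteriorAlgebra ℝ F)).coord a) P)
    (w := fun a => (g (finBasis ℝ (ExteriorAlgebra ℝ F) a)).1) fun z hz => by
      have h1 : (g (φ.loc P z)).1 = φ.loc P z :=
        congrArg Subtype.val (LinearMap.congr_fun hg ⟨φ.loc P z, φ.loc_mem hP z⟩)
      rw [← h1]
      conv_lhs => rw [loc_eq_sum P hz]
      simp only [map_sum, map_smul, Submodule.coe_sum, Submodule.coe_smul]
  rw [h, add_comm p m]
  exact Submodule.sum_mem _ fun a _ => deg_mul_mem (hm _) (g _).2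

theorem compDeriv_ofFn (hT : IsPointDeriv y T) (hy : y ∈ φ.U) (f : SmoothFn E M) :
    φ.compDeriv T (ofFn f) = T f := by
  rw [compDeriv_eq hT hy (P := ofFn f) (ι := Unit) (f := fun _ => f) (w := fun _ => 1)
    fun z hz => by simp [loc_ofFn, Algebra.algebraMap_eq_smul_one]]
  simp

theorem compDeriv_ofSec (hT : IsPointDeriv y T) (hy : y ∈ φ.U) {u : Sec E F V}
    {c : Fin (finrank ℝ F) → SmoothFn E M} (hc : φ.χ • u = ∑ i, c i • φ.s i) :
    φ.compDeriv T (ofSec u) = ∑ i, T (c i) * ExteriorAlgebra.ι ℝ (finBasis ℝ F i) :=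
  compDeriv_eq hT hy fun z hz => by
    rw [loc_ofSec, φ.coord_eq hc hz, map_sum]
    simp only [map_smul]

end Frm

namespace DerData

variable {m : ℕ} (d : DerData E F V m) (φ : Frm E F V)

/-- The derivation `f ↦ d f (y)`, read in a frame. -/
def locFn (y : M) : SmoothFn E M →ₗ[ℝ] ExteriorAlgebra ℝ F :=
  (ExteriorAlgebra.map (φ.e.linearMapAt ℝ y)).toLinearMap ∘ₗ evalExt E F V y ∘ₗ d.fn

theorem locFn_apply (y : M) (f : SmoothFn E M) : d.locFn φ y f = φ.loc (d.fn f) y := rfl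

theorem isPointDeriv_locFn (y : M) : IsPointDeriv y (d.locFn φ y) := fun f g => by
  simp only [locFn_apply, d.fn_mul, φ.loc_add, φ.loc_mul, φ.loc_ofFn, ← Algebra.smul_def]

/-- The extension of `d`, read in a frame: `P ↦ ∑ d(P_I) s_I + ∑ d(sᵢ) ∧ ι_{sⁱ} P`, where `P_I`
are the components of `P` and `sⁱ` is the dual frame. -/
def locExt (P : ExtSec E F V) (y : M) : ExteriorAlgebra ℝ F :=
  φ.compDeriv (d.locFn φ y) P +
    ∑ i, φ.loc (d.sec (φ.s i)) y * contr ((finBasis ℝ F).coord i) (φ.loc P y)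

theorem smooth_locExt (P : ExtSec E F V) {y : M} (hy : y ∈ φ.U) :
    SmoothAt E (d.locExt φ P) y := by
  refine SmoothAt.add (SmoothAt.sum fun a _ => ?_) (SmoothAt.sum fun i _ => ?_)
  · exact Frm.smooth_mul (φ.smooth_loc (d.fn _) hy) (SmoothAt.const _)
  · exact Frm.smooth_mul (φ.smooth_loc (d.sec _) hy) ((φ.smooth_loc P hy).linear _)

/-- `locExt`, as a linear map to the fibre. -/
def extAt (y : M) : ExtSec E F V →ₗ[ℝ] ExteriorAlgebra ℝ (V y) :=
  (ExteriorAlgebra.map (φ.e.symmₗ ℝ y)).toLinearMap ∘ₗ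
    { toFun := fun P => d.locExt φ P y
      map_add' := fun P Q => by
        simp only [locExt, Frm.compDeriv, φ.coordFn_add, φ.loc_add, map_add, add_mul, mul_add,
          Finset.sum_add_distrib]
        abel
      map_smul' := fun r P => by
        simp only [locExt, Frm.compDeriv, φ.coordFn_smul, φ.loc_smul, map_smul, smul_mul_assoc,
          mul_smul_comm, ← Finset.smul_sum, smul_add, RingHom.id_apply] }

theorem extAt_apply (P : ExtSec E F V) (y : M) :
    d.extAt φ y P = ExteriorAlgebra.map (φ.e.symmₗ ℝ y) (d.locExt φ P y) := rfl

variable {φ} {y : M}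

theorem locExt_mul {p : ℕ} {P : ExtSec E F V} (hP : P ∈ extDeg E F V p) (Q : ExtSec E F V)
    (hy : y ∈ φ.U) : d.locExt φ (P * Q) y = d.locExt φ P y * φ.loc Q y +
      (-1 : ℝ) ^ ((m : ℤ) * p) • (φ.loc P y * d.locExt φ Q y) := by
  have h1 : ∀ i, φ.loc (d.sec (φ.s i)) y *
      contr ((finBasis ℝ F).coord i) (φ.loc P y * φ.loc Q y) =
      φ.loc (d.sec (φ.s i)) y * contr ((finBasis ℝ F).coord i) (φ.loc P y) * φ.loc Q y +
      (-1 : ℝ) ^ ((m : ℤ) * p) • (φ.loc P y *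
        (φ.loc (d.sec (φ.s i)) y * contr ((finBasis ℝ F).coord i) (φ.loc Q y))) := fun i => by
    rw [contr_mul _ _ (φ.loc_mem hP y), mul_add, ← mul_assoc, mul_smul_comm, ← mul_assoc,
      mul_comm_deg (φ.loc_mem (d.sec_mem (φ.s i)) y) (φ.loc_mem hP y), smul_mul_assoc, smul_smul,
      ← zpow_add₀ (by norm_num), mul_assoc (φ.loc P y)]
    congr 2
    exact neg_one_zpow_eq (k := p) (by push_cast; ring)
  simp only [locExt, φ.loc_mul]
  rw [Frm.compDeriv_mul (d.isPointDeriv_locFn φ y) hy (fun f => φ.loc_mem (d.fn_mem f) y) hP]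
  simp only [h1, Finset.sum_add_distrib, ← Finset.sum_mul, ← Finset.smul_sum, ← Finset.mul_sum,
    add_mul, mul_add, smul_add]
  abel

theorem isDerAt_extAt (hy : y ∈ φ.U) : IsDerAt y m (d.extAt φ y) := fun p P hP Q => by
  rw [extAt_apply, d.locExt_mul hP Q hy, map_add, map_mul, map_smul, map_mul, φ.map_loc hy,
    φ.map_loc hy]
  rfl

theorem extAt_ofFn (hy : y ∈ φ.U) (f : SmoothFn E M) :
    d.extAt φ y (ofFn f) = (d.fn f).1 y := by
  rw [extAt_apply, locExt, Frm.compDeriv_ofFn (d.isPointDeriv_locFn φ y) hy, φ.loc_ofFn,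
    locFn_apply]
  simp only [contr_algebraMap, mul_zero, Finset.sum_const_zero, add_zero]
  exact φ.map_loc hy _

theorem extAt_ofSec (hy : y ∈ φ.U) (u : Sec E F V) :
    d.extAt φ y (ofSec u) = (d.sec u).1 y := by
  obtain ⟨c, hc⟩ := φ.span u
  have hχ : φ.loc (d.fn φ.χ) y = 0 := by
    rw [← locFn_apply, (d.isPointDeriv_locFn φ y).congr (g := 1)
      (Filter.eventually_of_mem (φ.isOpen.mem_nhds hy) φ.χ_one),
      (d.isPointDeriv_locFn φ y).map_one]
  have h1 : φ.loc (d.sec u) y = φ.loc (d.sec (φ.χ • u)) y := by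
    rw [d.sec_smul, φ.loc_add, φ.loc_mul, φ.loc_mul, hχ, MulZeroClass.zero_mul, zero_add,
      φ.loc_ofFn, φ.χ_one y hy, map_one, one_mul]
  have h2 : ∀ i, contr ((finBasis ℝ F).coord i)
      (ExteriorAlgebra.ι ℝ (φ.e.linearMapAt ℝ y (u y))) = algebraMap ℝ _ (c i y) := fun i => by
    rw [contr_ι, φ.coord_eq hc hy]
    simp [Finsupp.single_apply]
  have h3 : ∀ P : ExteriorAlgebra ℝ F, ∀ r : ℝ, P * algebraMap ℝ _ r = algebraMap ℝ _ r * P :=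
    fun P r => (Algebra.commutes r P).symm
  rw [extAt_apply, locExt, Frm.compDeriv_ofSec (d.isPointDeriv_locFn φ y) hy hc, φ.loc_ofSec]
  simp only [h2, h3]
  rw [← φ.map_loc hy, h1, hc, map_sum, ← Finset.sum_add_distrib]
  congr 1
  have h4 : φ.loc (∑ i, d.sec (c i • φ.s i)) y = ∑ i, φ.loc (d.sec (c i • φ.s i)) y := by
    simp only [Frm.loc, ext_sum_val, map_sum]
  rw [h4]
  refine Finset.sum_congr rfl fun i _ => ?_
  rw [d.sec_smul, φ.loc_add, φ.loc_mul, φ.loc_mul, φ.loc_ofFn, φ.loc_ofSec, φ.frame y hy,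
    locFn_apply]

theorem extAt_mem (hy : y ∈ φ.U) {p : ℕ} {P : ExtSec E F V} (hP : P ∈ extDeg E F V p) :
    d.extAt φ y P ∈ (⋀[ℝ]^(p + m) (V y) : Submodule ℝ (ExteriorAlgebra ℝ (V y))) := by
  refine Frm.map_mem _ (Submodule.add_mem _ (Frm.compDeriv_mem (d.isPointDeriv_locFn φ y) hy
    (fun f => φ.loc_mem (d.fn_mem f) y) hP) (Submodule.sum_mem _ fun i _ => ?_))
  rcases p with _ | p
  · rw [contr_zero_deg _ (φ.loc_mem hP y), mul_zero]; exact Submodule.zero_mem _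
  · have := deg_mul_mem (φ.loc_mem (d.sec_mem (φ.s i)) y)
      (contr_mem ((finBasis ℝ F).coord i) p (φ.loc_mem hP y))
    rwa [show m + 1 + p = p + 1 + m by ring] at this

theorem extAt_eq {φ' : Frm E F V} (hy : y ∈ φ.U) (hy' : y ∈ φ'.U) (P : ExtSec E F V) :
    d.extAt φ y P = d.extAt φ' y P :=
  (d.isDerAt_extAt hy).ext (d.isDerAt_extAt hy')
    (fun f => (d.extAt_ofFn hy f).trans (d.extAt_ofFn hy' f).symm)
    (fun u => (d.extAt_ofSec hy u).trans (d.extAt_ofSec hy' u).symm) P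

/-- Compatible values on functions and on sections of `A` extend to a graded derivation. It is
given by `locExt` in each frame, and the frames agree since derivations are determined by their
values on functions and sections. -/
theorem exists_isDer (d : DerData E F V m) : ∃ D : ExtSec E F V →ₗ[ℝ] ExtSec E F V, IsDer m D ∧
    (∀ f, D (ofFn f) = d.fn f) ∧ (∀ u, D (ofSec u) = d.sec u) ∧
    ∀ p, ∀ P ∈ extDeg E F V p, D P ∈ extDeg E F V (p + m) := by
  choose φ hφ using fun x : M => exists_frm (E := E) (F := F) (V := V) x
  let D : ExtSec E F V →ₗ[ℝ] ExtSec E F V :=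
    { toFun := fun P => ⟨fun y => d.extAt (φ y) y P, fun e _ x hx => by
        have := Frm.smooth_map ((φ x).smooth_change e hx (hφ x)) (d.smooth_locExt (φ x) P (hφ x))
        refine this.congr ?_
        filter_upwards [(φ x).isOpen.mem_nhds (hφ x)] with y hy
        rw [d.extAt_eq (hφ y) hy, extAt_apply, ← AlgHom.comp_apply, ExteriorAlgebra.map_comp_map]⟩
      map_add' := fun P Q => ExtSec.val_ext fun y => map_add _ _ _
      map_smul' := fun r P => ExtSec.val_ext fun y => (d.extAt (φ y) y).map_smul r P }
  exact ⟨D, fun p P hP Q => ExtSec.val_ext fun y => d.isDerAt_extAt (hφ y) p P hP Q,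
    fun f => ExtSec.val_ext fun y => d.extAt_ofFn (hφ y) f,
    fun u => ExtSec.val_ext fun y => d.extAt_ofSec (hφ y) u,
    fun p P hP y => d.extAt_mem (hφ y) hP⟩

end DerData

end Extension

/-! ### From characteristic pairs to differentials -/

section OfPair

variable {E : Type*} [NormedAddCommGroup E] [NormedSpace ℝ E] [FiniteDimensional ℝ E]
  {M : Type*} [TopologicalSpace M] [ChartedSpace E M] [T2Space M] [IsManifold 𝓘(ℝ, E) ∞ M]
  {F : Type*} [NormedAddCommGroup F] [NormedSpace ℝ F] [FiniteDimensional ℝ F]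
  {V : M → Type*} [TopologicalSpace (TotalSpace F V)] [∀ x, TopologicalSpace (V x)]
  [∀ x, AddCommGroup (V x)] [∀ x, Module ℝ (V x)] [FiberBundle F V] [VectorBundle ℝ F V]
  [ContMDiffVectorBundle ∞ F V 𝓘(ℝ, E)]

section Bracket

variable [SigmaCompactSpace M] (A : LieAlgebroid E F V)

/-- The operator `δ` of degree `m` is a derivation of the Schouten bracket of `P` and `Q`, where
`P` has degree `p`. -/
def IsBrDer (m : ℕ) (δ : ExtSec E F V →ₗ[ℝ] ExtSec E F V) (p : ℕ) (P Q : ExtSec E F V) : Prop :=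
  δ (schouten A P Q) =
    schouten A (δ P) Q + (-1 : ℝ) ^ ((m : ℤ) * ((p : ℤ) - 1)) • schouten A P (δ Q)

variable {A} {m : ℕ} {δ : ExtSec E F V →ₗ[ℝ] ExtSec E F V}

theorem IsBrDer.swap (hdeg : ∀ p, ∀ P ∈ extDeg E F V p, δ P ∈ extDeg E F V (p + m))
    {p q : ℕ} {P Q : ExtSec E F V} (hP : P ∈ extDeg E F V p)
    (hQ : Q ∈ extDeg E F V q) (h : IsBrDer A m δ p P Q) : IsBrDer A m δ q Q P := by
  unfold IsBrDer at h ⊢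
  rw [(schouten_spec A).swap q p Q hQ P hP, map_smul, h,
    (schouten_spec A).swap _ q _ (hdeg p P hP) Q hQ,
    (schouten_spec A).swap p _ P hP _ (hdeg q Q hQ)]
  simp only [smul_add, smul_smul, mul_neg, neg_mul, neg_neg]
  have e1 : (-1 : ℝ) ^ (((q : ℤ) - 1) * ((p : ℤ) - 1)) *
      (-1) ^ ((((p + m : ℕ) : ℤ) - 1) * ((q : ℤ) - 1)) = (-1) ^ ((m : ℤ) * ((q : ℤ) - 1)) := by
    rw [← zpow_add₀ (by norm_num)]
    exact neg_one_zpow_eq (k := ((q : ℤ) - 1) * ((p : ℤ) - 1)) (by push_cast; ring)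
  have e2 : (-1 : ℝ) ^ (((q : ℤ) - 1) * ((p : ℤ) - 1)) * ((-1) ^ ((m : ℤ) * ((p : ℤ) - 1)) *
      (-1) ^ (((p : ℤ) - 1) * (((q + m : ℕ) : ℤ) - 1))) = 1 := by
    rw [← zpow_add₀ (by norm_num), ← zpow_add₀ (by norm_num), ← zpow_zero (-1 : ℝ)]
    exact neg_one_zpow_eq (k := ((p : ℤ) - 1) * ((q : ℤ) - 1 + m)) (by push_cast; ring)
  rw [e1, e2, one_smul, add_comm]

theorem IsBrDer.of_generators (hδ : IsDer m δ)
    (hdeg : ∀ p, ∀ P ∈ extDeg E F V p, δ P ∈ extDeg E F V (p + m)) {p : ℕ} {P : ExtSec E F V}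
    (hP : P ∈ extDeg E F V p) (hfn : ∀ f, IsBrDer A m δ p P (ofFn f))
    (hsec : ∀ u, IsBrDer A m δ p P (ofSec u)) (Q : ExtSec E F V) : IsBrDer A m δ p P Q := by
  have h1 := hδ.commutator (schouten_isDer A hP)
    (fun q Q hQ => Or.inr ⟨q + m, by push_cast; ring, hdeg q Q hQ⟩) (schouten_shift A hP)
  have h2 := (schouten_isDer A (hdeg p P hP)).of_eq (ε' := m + ((p : ℤ) - 1))
    (by push_cast; ring)
  have h3 := h1.ext h2 (fun f => sub_eq_iff_eq_add.2 (hfn f))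
    (fun u => sub_eq_iff_eq_add.2 (hsec u))
  exact sub_eq_iff_eq_add.1 (LinearMap.congr_fun h3 Q)

/-- A graded derivation of the exterior product is a derivation of the Schouten bracket as soon as
it is one on functions and sections of `A`. The defect is a graded derivation in the second
argument, and it is graded skew-symmetric. -/
theorem isBrDer_of_generators (hδ : IsDer m δ)
    (hdeg : ∀ p, ∀ P ∈ extDeg E F V p, δ P ∈ extDeg E F V (p + m))
    (hff : ∀ f g, IsBrDer A m δ 0 (ofFn f) (ofFn g))
    (huf : ∀ u f, IsBrDer A m δ 1 (ofSec u) (ofFn f))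
    (huv : ∀ u v, IsBrDer A m δ 1 (ofSec u) (ofSec v)) {p : ℕ} {P : ExtSec E F V}
    (hP : P ∈ extDeg E F V p) (Q : ExtSec E F V) : IsBrDer A m δ p P Q :=
  IsBrDer.of_generators hδ hdeg hP
    (fun f => (IsBrDer.of_generators hδ hdeg (ofFn_mem f) (hff f)
      (fun u => (huf u f).swap hdeg (ofSec_mem u) (ofFn_mem f)) P).swap hdeg (ofFn_mem f) hP)
    (fun u => (IsBrDer.of_generators hδ hdeg (ofSec_mem u) (huf u) (huv u) P).swap hdeg
      (ofSec_mem u) hP) Q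

end Bracket

theorem contrL_add {U W : Type*} [AddCommGroup U] [Module ℝ U] [AddCommGroup W] [Module ℝ W]
    (ξ η : Dual ℝ U) (t : U ⊗[ℝ] ExteriorAlgebra ℝ W) :
    contrL (ξ + η) t = contrL ξ t + contrL η t := by
  simp only [contrL, LinearMap.rTensor_add, LinearMap.comp_add, LinearMap.add_apply]

theorem contrL_smul {U W : Type*} [AddCommGroup U] [Module ℝ U] [AddCommGroup W] [Module ℝ W]
    (r : ℝ) (ξ : Dual ℝ U) (t : U ⊗[ℝ] ExteriorAlgebra ℝ W) :
    contrL (r • ξ) t = r • contrL ξ t := by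
  simp only [contrL, LinearMap.rTensor_smul, LinearMap.comp_smul, LinearMap.smul_apply]

variable {A : LieAlgebroid E F V} {k : ℕ}

/-- `symb` as a linear map in the function. -/
def symbₗ (ϖ : compatTensors A k) : SmoothFn E M →ₗ[ℝ] ExtSec E F V where
  toFun := symb ϖ
  map_add' f g := by
    have : contrFn ϖ (f + g) = contrFn ϖ f + contrFn ϖ g := ExtSec.val_ext fun x => by
      rw [contrFn_val, dAt_add, contrL_add]; rfl
    rw [symb, this, smul_add]; rfl
  map_smul' r f := by
    have : contrFn ϖ (r • f) = r • contrFn ϖ f := ExtSec.val_ext fun x => by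
      rw [contrFn_val, dAt_smul, contrL_smul]; rfl
    rw [symb, this, smul_comm]; rfl

theorem symb_mul (ϖ : compatTensors A k) (f g : SmoothFn E M) :
    symb ϖ (f * g) = ofFn f * symb ϖ g + ofFn g * symb ϖ f := by
  have : contrFn ϖ (f * g) = f • contrFn ϖ g + g • contrFn ϖ f := ExtSec.val_ext fun x => by
    rw [contrFn_val, dAt_mul, contrL_add, contrL_smul, contrL_smul, ExtSec.add_val,
      smul_ext_apply, smul_ext_apply]
    rfl
  rw [symb, this, smul_add, fn_smul_eq, fn_smul_eq, ← mul_smul_comm, ← mul_smul_comm]; rfl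

variable [SigmaCompactSpace M]

/-- The `ρ`-compatibility of `ϖ`, in terms of the values on functions. -/
theorem symb_compat (hk : 1 ≤ k) (ϖ : compatTensors A k) (f g : SmoothFn E M) :
    schouten A (symb ϖ f) (ofFn g) +
      (-1 : ℝ) ^ (((k - 1 : ℕ) : ℤ) * ((0 : ℕ) - 1)) • schouten A (ofFn f) (symb ϖ g) = 0 := by
  refine ExtSec.val_ext fun x => ?_
  rw [ExtSec.add_val, ExtSec.rsmul_val, schouten_fn_right A (symb_mem ϖ f), schouten_fn_left,
    neg_one_zpow_eq (m := ((k - 1 : ℕ) : ℤ) * ((0 : ℕ) - 1)) (n := ((k - 1 : ℕ) : ℤ) - 1 + 1)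
      (k := -((k - 1 : ℕ) : ℤ)) (by push_cast; ring), neg_one_zpow_add_one, smul_neg, neg_smul,
    neg_neg, ← smul_add]
  have h : contr (A.pullD g x) (contrL (dAt f x) (ϖ.1 x)) =
    -contr (A.pullD f x) (contrL (dAt g x) (ϖ.1 x)) := ϖ.2.2.2 x (dAt g x) (dAt f x)
  simp only [symb, ExtSec.rsmul_val, contrFn_val, map_smul]
  rw [h, smul_neg, neg_add_cancel, smul_zero]
  rfl

theorem lieHom_zero_right (u : Sec E F V) : lieHom A u (0 : TA E F V) = 0 := by
  have h := lieHom_add A u 0 0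
  rw [add_zero] at h
  exact left_eq_add.1 h

theorem jetBracket_j1_j1 (u v : Sec E F V) :
    jetBracket A (JetSec.j1 u) (JetSec.j1 v) = JetSec.j1 (A.bracket u v) :=
  Prod.ext rfl (by
    change lieHom A u 0 - lieHom A v 0 + isoBracket A 0 0 = 0
    have h : isoBracket A (0 : TA E F V) 0 = 0 := sub_self _
    rw [lieHom_zero_right, lieHom_zero_right, h, sub_self, add_zero])

theorem jetBracket_j1_incl (u : Sec E F V) (K : TA E F V) :
    jetBracket A (JetSec.j1 u) (JetSec.incl K) = JetSec.incl (lieHom A u K) :=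
  Prod.ext (map_zero (A.bracket u)) (by
    change lieHom A u K - lieHom A 0 0 + isoBracket A 0 K = lieHom A u K
    have h : isoBracket A (0 : TA E F V) K = 0 := by
      refine Subtype.ext (funext fun x => ?_)
      change K.1 x ∘ₗ A.anchor.1 x ∘ₗ 0 - 0 ∘ₗ A.anchor.1 x ∘ₗ K.1 x = 0
      rw [LinearMap.comp_zero, LinearMap.comp_zero, LinearMap.zero_comp, sub_zero]
    rw [lieHom_zero_right, h, sub_zero, add_zero])

theorem homDeriv_compAnchor_zero (w : ExtSec E F V) :
    homDeriv (compAnchor A (0 : TA E F V)) w = 0 := by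
  simpa using homDeriv_compAnchor_smul (A := A) (0 : SmoothFn E M) 0 w

theorem jetAd_j1 (u : Sec E F V) (w : extDeg E F V k) :
    (jetAd A k (JetSec.j1 u) w).1 = schouten A (ofSec u) w.1 := by
  change schouten A (ofSec u) w.1 - homDeriv (compAnchor A (0 : TA E F V)) w.1 = _
  rw [homDeriv_compAnchor_zero, sub_zero]

theorem jetAd_incl (H : TA E F V) (w : extDeg E F V k) :
    (jetAd A k (JetSec.incl H) w).1 = -homDeriv (compAnchor A H) w.1 := by
  change schouten A (ofSec 0) w.1 - homDeriv (compAnchor A H) w.1 = _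
  rw [ofSec_zero, map_zero, LinearMap.zero_apply, zero_sub]

theorem cocycle_bracket (χ : Z1Jet A k) (u v : Sec E F V) :
    (χ.1 (JetSec.j1 (A.bracket u v))).1 = schouten A (ofSec u) (χ.1 (JetSec.j1 v)).1 -
      schouten A (ofSec v) (χ.1 (JetSec.j1 u)).1 := by
  rw [← jetBracket_j1_j1, χ.2, Submodule.coe_sub, jetAd_j1, jetAd_j1]

theorem cocycle_symbCompat (hk : 1 ≤ k) (hk' : k ≤ finrank ℝ F) {χ : Z1Jet A k}
    {ϖ : compatTensors A k} (h : IsMu ϖ.1 (χ.1 ∘ₗ JetSec.incl)) :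
    IsSymbCompat ϖ (fun u => (χ.1 (JetSec.j1 u)).1) := by
  refine symbCompat_of_mu_lieHom hk hk' h (fun u => (χ.1 (JetSec.j1 u)).2) fun u K => ?_
  change (χ.1 (JetSec.incl (lieHom A u K))).1 = schouten A (ofSec u) (χ.1 (JetSec.incl K)).1 + _
  rw [← jetBracket_j1_incl, χ.2, Submodule.coe_sub, jetAd_j1, jetAd_incl, sub_neg_eq_add]

/-- The values on functions and on sections of `A` of the differential of a characteristic pair. -/
def pairData (hk : 1 ≤ k) (χ : Z1Jet A k) (ϖ : compatTensors A k)
    (h : IsMu ϖ.1 (χ.1 ∘ₗ JetSec.incl)) : DerData E F V (k - 1) where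
  fn := symbₗ ϖ
  sec :=
    { toFun := fun u => (χ.1 (JetSec.j1 u)).1
      map_add' := fun u v => by
        have : JetSec.j1 (u + v) = JetSec.j1 u + JetSec.j1 v :=
          Prod.ext rfl (add_zero (0 : TA E F V)).symm
        rw [this, map_add, Submodule.coe_add]
      map_smul' := fun r u => by
        have h1 : ofFn (r • (1 : SmoothFn E M)) = algebraMap ℝ (ExtSec E F V) r := by
          rw [ofFn_rsmul, Algebra.algebraMap_eq_smul_one]
          congr 1
        have h2 : dTensor (r • (1 : SmoothFn E M)) u = 0 := JetSec.hom_ext fun x v => by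
          rw [JetSec.dTensor_val, dAt_smul, dAt_one, smul_zero, LinearMap.zero_apply, zero_smul,
            JetSec.hom_zero_val]
        have h3 : r • u = (r • (1 : SmoothFn E M)) • u := by rw [smul_assoc, one_smul]
        rw [RingHom.id_apply, h3, JetSec.j1_smul, h2, map_zero, add_zero, map_smul,
          Submodule.coe_smul, fn_smul_eq, h1, ← Algebra.smul_def] }
  fn_mem := symb_mem ϖ
  sec_mem u := by
    rw [Nat.sub_add_cancel hk]
    exact (χ.1 (JetSec.j1 u)).2
  fn_mul := symb_mul ϖ
  sec_smul f u := by
    change (χ.1 (JetSec.j1 (f • u))).1 = symb ϖ f * ofSec u + ofFn f * (χ.1 (JetSec.j1 u)).1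
    rw [JetSec.j1_smul, map_add, map_smul, Submodule.coe_add, Submodule.coe_smul, fn_smul_eq,
      ← h.apply_dTensor_symb, add_comm]
    rfl

/-- Every characteristic pair comes from a differential. -/
theorem exists_differential (hk : 1 ≤ k) (hk' : k ≤ finrank ℝ F) {χ : Z1Jet A k}
    {ϖ : compatTensors A k} (h : IsMu ϖ.1 (χ.1 ∘ₗ JetSec.incl)) :
    ∃ δ : differentials A k, IsCharPair A k δ χ ϖ := by
  obtain ⟨δ, hδ, hfn, hsec, hdeg⟩ := (pairData hk χ ϖ h).exists_isDer
  change ∀ f, δ (ofFn f) = symb ϖ f at hfn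
  change ∀ u, δ (ofSec u) = (χ.1 (JetSec.j1 u)).1 at hsec
  have hcast : ((k - 1 : ℕ) : ℤ) = (k : ℤ) - 1 := by rw [Nat.cast_sub hk, Nat.cast_one]
  have hbr : ∀ {p : ℕ} {P : ExtSec E F V}, P ∈ extDeg E F V p → ∀ Q,
      IsBrDer A (k - 1) δ p P Q := by
    refine isBrDer_of_generators hδ hdeg (fun f g => ?_) (fun u f => ?_) (fun u v => ?_)
    · rw [IsBrDer, (schouten_spec A).fn_fn, map_zero, hfn, hfn, symb_compat hk]
    · rw [IsBrDer, (schouten_spec A).sec_fn, hfn, hfn, hsec,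
        cocycle_symbCompat hk hk' h u f, add_comm]
      simp
    · rw [IsBrDer, (schouten_spec A).sec_sec, hsec, hsec, hsec, cocycle_bracket,
        schouten_sec_right A (χ.1 (JetSec.j1 u)).2]
      simp only [Nat.cast_one, sub_self, mul_zero, zpow_zero, one_smul]
      abel
  refine ⟨⟨δ, hdeg, fun p P hP Q => ?_, fun p P hP Q => ?_⟩, h, hsec, fun f x => ?_⟩
  · rw [← hcast]; exact hδ p P hP Q
  · rw [← hcast]; exact hbr hP Q
  · exact congrArg (fun Q : ExtSec E F V => Q.1 x) (hfn f)

end OfPair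

/-! ### Quotients of subspaces -/

namespace SubQuot

variable {X Y : Type*} [AddCommGroup X] [Module ℝ X] [AddCommGroup Y] [Module ℝ Y]
  {S T : Submodule ℝ X}

theorem mk_surjective : Function.Surjective (mk S T) :=
  Submodule.mkQ_surjective (T.comap S.subtype)

theorem mk_eq_mk {a b : S} : mk S T a = mk S T b ↔ (a : X) - b ∈ T :=
  Submodule.Quotient.eq (T.comap S.subtype)

theorem mk_eq_zero {a : S} : mk S T a = 0 ↔ (a : X) ∈ T :=
  Submodule.Quotient.mk_eq_zero (T.comap S.subtype)

/-- The linear map on the quotient induced by a linear map that vanishes on `S ∩ T`. -/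
def lift (φ : S →ₗ[ℝ] Y) (h : ∀ a : S, (a : X) ∈ T → φ a = 0) : SubQuot S T →ₗ[ℝ] Y :=
  (T.comap S.subtype).liftQ φ h

theorem lift_injective (φ : S →ₗ[ℝ] Y) (h : ∀ a : S, (a : X) ∈ T → φ a = 0)
    (h' : ∀ a : S, φ a = 0 → (a : X) ∈ T) : Function.Injective (lift φ h) := by
  rw [injective_iff_map_eq_zero]
  intro r hr
  obtain ⟨a, rfl⟩ := mk_surjective r
  exact mk_eq_zero.2 (h' a hr)

end SubQuot

/-- Two linear maps `f`, `g` out of `R` such that `f` is injective and the pair is surjective onto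
a fibre product identify `R` with the fibre product. -/
def fibreProductEquiv {R X Y Z : Type*} [AddCommGroup R] [Module ℝ R] [AddCommGroup X]
    [Module ℝ X] [AddCommGroup Y] [Module ℝ Y] [AddCommGroup Z] [Module ℝ Z] (f : R →ₗ[ℝ] X)
    (g : R →ₗ[ℝ] Y) (a : X →ₗ[ℝ] Z) (b : Y →ₗ[ℝ] Z) (h : ∀ r, a (f r) = b (g r))
    (hf : Function.Injective f) (hs : ∀ x y, a x = b y → ∃ r, f r = x ∧ g r = y) :
    R ≃ₗ[ℝ] LinearMap.eqLocus (a ∘ₗ LinearMap.fst ℝ X Y) (b ∘ₗ LinearMap.snd ℝ X Y) :=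
  LinearEquiv.ofBijective ((f.prod g).codRestrict _ h)
    ⟨fun _ _ hrs => hf (congrArg Prod.fst (congrArg Subtype.val hrs)), fun ⟨⟨x, y⟩, hxy⟩ =>
      (hs x y hxy).imp fun _ hr => Subtype.ext (Prod.ext hr.1 hr.2)⟩

/-! ### The correspondence and the induced maps -/

section Correspondence

variable {E : Type*} [NormedAddCommGroup E] [NormedSpace ℝ E] [FiniteDimensional ℝ E]
  {M : Type*} [TopologicalSpace M] [ChartedSpace E M] [T2Space M] [IsManifold 𝓘(ℝ, E) ∞ M]
  {F : Type*} [NormedAddCommGroup F] [NormedSpace ℝ F] [FiniteDimensional ℝ F]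
  {V : M → Type*} [TopologicalSpace (TotalSpace F V)] [∀ x, TopologicalSpace (V x)]
  [∀ x, AddCommGroup (V x)] [∀ x, Module ℝ (V x)] [FiberBundle F V] [VectorBundle ℝ F V]
  [ContMDiffVectorBundle ∞ F V 𝓘(ℝ, E)]
  [SigmaCompactSpace M] {A : LieAlgebroid E F V} {k : ℕ}

variable (A) in
/-- The assignment `ϖ ↦ μ_ϖ`, as a linear map into the cocycles. -/
def muₗ (hk : 1 ≤ k) : compatTensors A k →ₗ[ℝ] Z1Iso A k where
  toFun ϖ := ⟨mu hk ϖ, mu_mem_cocycles hk ϖ⟩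
  map_add' ϖ ϖ' := Subtype.ext <| (isMu_mu hk (ϖ + ϖ')).eq fun H x =>
    (congrArg₂ (· + ·) (isMu_mu hk ϖ H x) (isMu_mu hk ϖ' H x)).trans
      (map_add (applyFirst (H.1 x)) (ϖ.1 x) (ϖ'.1 x)).symm
  map_smul' r ϖ := Subtype.ext <| (isMu_mu hk (r • ϖ)).eq fun H x =>
    (congrArg (r • ·) (isMu_mu hk ϖ H x)).trans
      (map_smul (applyFirst (H.1 x)) r (ϖ.1 x)).symm

theorem mu_sub (hk : 1 ≤ k) (ϖ ϖ' : compatTensors A k) :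
    mu hk (ϖ - ϖ') = mu hk ϖ - mu hk ϖ' :=
  (isMu_mu hk (ϖ - ϖ')).eq fun H x =>
    (congrArg₂ (· - ·) (isMu_mu hk ϖ H x) (isMu_mu hk ϖ' H x)).trans
      (map_sub (applyFirst (H.1 x)) (ϖ.1 x) (ϖ'.1 x)).symm

theorem muₗ_mem_iff (hk : 1 ≤ k) (hk' : k ≤ finrank ℝ F) (ϖ : compatTensors A k) :
    (muₗ A hk ϖ).1 ∈ B1Iso A k ↔ ϖ.1 ∈ exactTensors A k := by
  constructor
  · rintro ⟨τ, hτ⟩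
    have : ϖ = exactTensor A (-τ) := mu_injective hk hk' <| LinearMap.ext fun H => by
      rw [mu_exactTensor, neg_neg]
      exact hτ H
    rw [this]
    exact exactTensor_mem _
  · rintro ⟨τ, hτ, h⟩
    let τ' : extDeg E F V k := ⟨τ, hτ⟩
    have : ϖ = exactTensor A τ' := Subtype.ext (funext h)
    rw [this]
    exact ⟨-τ', mu_exactTensor hk τ'⟩

variable {δ δ' : differentials A k} {χ χ' : Z1Jet A k}
  {ϖ ϖ' : compatTensors A k}

namespace IsCharPair

theorem fn_eq_symb (h : IsCharPair A k δ χ ϖ) (f : SmoothFn E M) :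
    δ.1 (ofFn f) = symb ϖ f :=
  ExtSec.val_ext fun x => h.fn f x

theorem add (h : IsCharPair A k δ χ ϖ) (h' : IsCharPair A k δ' χ' ϖ') :
    IsCharPair A k (δ + δ') (χ + χ') (ϖ + ϖ') where
  restrict H x := (congrArg₂ (· + ·) (h.restrict H x) (h'.restrict H x)).trans
    (map_add (applyFirst (H.1 x)) (ϖ.1 x) (ϖ'.1 x)).symm
  sec u := congrArg₂ (· + ·) (h.sec u) (h'.sec u)
  fn f x := (congrArg₂ (· + ·) (h.fn f x) (h'.fn f x)).trans <| by
    rw [← smul_add, ← map_add]; rfl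

theorem smul (r : ℝ) (h : IsCharPair A k δ χ ϖ) :
    IsCharPair A k (r • δ) (r • χ) (r • ϖ) where
  restrict H x := (congrArg (r • ·) (h.restrict H x)).trans
    (map_smul (applyFirst (H.1 x)) r (ϖ.1 x)).symm
  sec u := congrArg (r • ·) (h.sec u)
  fn f x := (congrArg (r • ·) (h.fn f x)).trans <| by
    rw [smul_comm, ← map_smul]; rfl

theorem tensor_eq (h : IsCharPair A k δ χ ϖ) (h' : IsCharPair A k δ χ' ϖ') : ϖ = ϖ' :=
  Subtype.ext <| tensorFam_ext fun f x =>
    smul_right_injective _ (pow_ne_zero (k - 1) (neg_ne_zero.2 (one_ne_zero (α := ℝ))))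
      ((h.fn f x).symm.trans (h'.fn f x))

theorem cocycle_eq (h : IsCharPair A k δ χ ϖ) (h' : IsCharPair A k δ χ' ϖ') : χ = χ' := by
  obtain rfl := h.tensor_eq h'
  refine Subtype.ext <| LinearMap.ext fun a => ?_
  have h1 : χ.1 (JetSec.incl a.2) = χ'.1 (JetSec.incl a.2) :=
    LinearMap.congr_fun (h.restrict.eq h'.restrict) a.2
  have h2 : χ.1 (JetSec.j1 a.1) = χ'.1 (JetSec.j1 a.1) :=
    Subtype.ext ((h.sec a.1).symm.trans (h'.sec a.1))
  rw [JetSec.eq_j1_add_incl a, map_add, map_add, h1, h2]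

theorem differential_eq (h : IsCharPair A k δ χ ϖ) (h' : IsCharPair A k δ' χ ϖ) : δ = δ' :=
  Subtype.ext <| (differentials.isDer δ).ext (differentials.isDer δ')
    (fun f => (h.fn_eq_symb f).trans (h'.fn_eq_symb f).symm)
    (fun u => (h.sec u).trans (h'.sec u).symm)

end IsCharPair

theorem schouten_ofFn_eq_symb (hk : 1 ≤ k) (τ : extDeg E F V k) (f : SmoothFn E M) :
    schouten A τ.1 (ofFn f) = symb (exactTensor A τ) f := ExtSec.val_ext fun x => by
  have hs : (-1 : ℝ) ^ ((k : ℤ) - 1) = (-1) ^ (k - 1) := by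
    rw [← zpow_natCast, Nat.cast_sub hk, Nat.cast_one]
  rw [schouten_fn_right A τ.2, hs, ← contrL_exactTensor]
  rfl

theorem schouten_ofSec_eq_jetAd (τ : extDeg E F V k) (u : Sec E F V) :
    schouten A τ.1 (ofSec u) = (jetAd A k (JetSec.j1 u) (-τ)).1 := by
  rw [jetAd_j1, Submodule.coe_neg, map_neg, schouten_sec_right A τ.2]

theorem jetAd_incl_eq_isoAd (H : TA E F V) (w : extDeg E F V k) :
    jetAd A k (JetSec.incl H) w = isoAd A k H w :=
  Subtype.ext (jetAd_incl H w)

namespace IsCharPair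

/-- The characteristic pair of `[τ, ·]` is the coboundary of `-τ` together with `D_ρ τ`. -/
theorem of_exact (hk : 1 ≤ k) (h : IsCharPair A k δ χ ϖ) {τ : extDeg E F V k}
    (hτ : δ.1 = schouten A τ.1) :
    ϖ = exactTensor A τ ∧ ∀ a, χ.1 a = jetAd A k a (-τ) := by
  have hϖ : ϖ = exactTensor A τ := Subtype.ext <| tensorFam_ext fun f x =>
    smul_right_injective _ (pow_ne_zero (k - 1) (neg_ne_zero.2 (one_ne_zero (α := ℝ)))) <| by
      have h1 := (h.fn_eq_symb f).symm.trans
        ((LinearMap.congr_fun hτ (ofFn f)).trans (schouten_ofFn_eq_symb hk τ f))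
      exact congrArg (fun P : ExtSec E F V => P.1 x) h1
  refine ⟨hϖ, fun a => ?_⟩
  have h1 : χ.1 (JetSec.incl a.2) = jetAd A k (JetSec.incl a.2) (-τ) := by
    rw [jetAd_incl_eq_isoAd, ← mu_exactTensor hk, ← hϖ]
    exact LinearMap.congr_fun (h.restrict.eq (isMu_mu hk ϖ)) a.2
  have h2 : χ.1 (JetSec.j1 a.1) = jetAd A k (JetSec.j1 a.1) (-τ) := Subtype.ext <| by
    rw [← h.sec, hτ, schouten_ofSec_eq_jetAd]
  have h3 : jetAd A k a (-τ) =
      jetAd A k (JetSec.j1 a.1) (-τ) + jetAd A k (JetSec.incl a.2) (-τ) :=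
    Subtype.ext <| by
      rw [Submodule.coe_add, jetAd_j1, jetAd_incl, ← sub_eq_add_neg]; rfl
  conv_lhs => rw [JetSec.eq_j1_add_incl a]
  rw [map_add, h1, h2, h3]

/-- A differential is exact as soon as its cocycle is a coboundary: by injectivity of `ϖ ↦ μ_ϖ`
the cocycle determines the tensor. -/
theorem exact_of_coboundary (hk : 1 ≤ k) (hk' : k ≤ finrank ℝ F) (h : IsCharPair A k δ χ ϖ)
    (hχ : χ.1 ∈ B1Jet A k) : δ.1 ∈ exactDifferentials A k := by
  obtain ⟨τ, hτ⟩ := hχ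
  have hϖ : ϖ = exactTensor A (-τ) := mu_injective hk hk' <| LinearMap.ext fun H => by
    rw [mu_exactTensor, neg_neg, ← jetAd_incl_eq_isoAd, ← hτ]
    exact LinearMap.congr_fun ((isMu_mu hk ϖ).eq h.restrict) H
  refine ⟨(-τ).1, (-τ).2, ?_⟩
  refine (differentials.isDer δ).ext (schouten_isDer A (-τ).2) (fun f => ?_) (fun u => ?_)
  · rw [h.fn_eq_symb, hϖ, schouten_ofFn_eq_symb hk]
  · rw [h.sec, hτ, schouten_ofSec_eq_jetAd, neg_neg]

end IsCharPair

variable (A) in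
/-- The cocycle `χ` of the characteristic pair `(χ, ϖ)` of a differential. -/
def charCocycle (hk : 1 ≤ k) : differentials A k →ₗ[ℝ] Z1Jet A k :=
  have spec (δ : differentials A k) := (exists_charPair δ hk).choose_spec.choose_spec
  { toFun := fun δ => (exists_charPair δ hk).choose
    map_add' := fun δ δ' => (spec (δ + δ')).cocycle_eq ((spec δ).add (spec δ'))
    map_smul' := fun r δ => (spec (r • δ)).cocycle_eq ((spec δ).smul r) }

variable (A) in
/-- The tensor `ϖ` of the characteristic pair `(χ, ϖ)` of a differential. -/
def charTensor (hk : 1 ≤ k) : differentials A k →ₗ[ℝ] compatTensors A k :=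
  have spec (δ : differentials A k) := (exists_charPair δ hk).choose_spec.choose_spec
  { toFun := fun δ => (exists_charPair δ hk).choose_spec.choose
    map_add' := fun δ δ' => (spec (δ + δ')).tensor_eq ((spec δ).add (spec δ'))
    map_smul' := fun r δ => (spec (r • δ)).tensor_eq ((spec δ).smul r) }

theorem isCharPair_charPair (hk : 1 ≤ k) (δ : differentials A k) :
    IsCharPair A k δ (charCocycle A hk δ) (charTensor A hk δ) :=
  (exists_charPair δ hk).choose_spec.choose_spec

theorem charCocycle_mem (hk : 1 ≤ k) (δ : differentials A k)
    (h : δ.1 ∈ exactDifferentials A k) : (charCocycle A hk δ).1 ∈ B1Jet A k := by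
  obtain ⟨τ, hτ, h⟩ := h
  let τ' : extDeg E F V k := ⟨τ, hτ⟩
  exact ⟨-τ', ((isCharPair_charPair hk δ).of_exact hk (τ := τ') h).2⟩

theorem charTensor_mem (hk : 1 ≤ k) (δ : differentials A k)
    (h : δ.1 ∈ exactDifferentials A k) : (charTensor A hk δ).1 ∈ exactTensors A k := by
  obtain ⟨τ, hτ, h⟩ := h
  rw [((isCharPair_charPair hk δ).of_exact hk (τ := ⟨τ, hτ⟩) h).1]
  exact exactTensor_mem _

variable (A k)

/-- The class of a cocycle in `H^1(𝔥, ∧^k A)`. -/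
def isoClass : Z1Iso A k →ₗ[ℝ] H1Iso A k :=
  SubQuot.mk (X := TA E F V →ₗ[SmoothFn E M] extDeg E F V k) (Z1Iso A k) (B1Iso A k)

/-- The class of a cocycle in `H^1(𝔍A, ∧^k A)`. -/
def jetClass : Z1Jet A k →ₗ[ℝ] H1Jet A k :=
  SubQuot.mk (X := JetSec E F V →ₗ[SmoothFn E M] extDeg E F V k) (Z1Jet A k) (B1Jet A k)

variable {A k}

theorem isoClass_eq_zero {m : Z1Iso A k} : isoClass A k m = 0 ↔ m.1 ∈ B1Iso A k :=
  SubQuot.mk_eq_zero (X := TA E F V →ₗ[SmoothFn E M] extDeg E F V k)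

theorem jetClass_eq_zero : jetClass A k χ = 0 ↔ χ.1 ∈ B1Jet A k :=
  SubQuot.mk_eq_zero (X := JetSec E F V →ₗ[SmoothFn E M] extDeg E F V k)

theorem isoClass_eq {m m' : Z1Iso A k} :
    isoClass A k m = isoClass A k m' ↔ m.1 - m'.1 ∈ B1Iso A k :=
  SubQuot.mk_eq_mk (X := TA E F V →ₗ[SmoothFn E M] extDeg E F V k)

theorem jetClass_surjective : Function.Surjective (jetClass A k) :=
  SubQuot.mk_surjective (X := JetSec E F V →ₗ[SmoothFn E M] extDeg E F V k)

variable (A)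

/-- The map `μ : R^k_ρ → H^1(𝔥, ∧^k A)`. -/
def muMap (hk : 1 ≤ k) (hk' : k ≤ finrank ℝ F) : RedTensors A k →ₗ[ℝ] H1Iso A k :=
  SubQuot.lift (isoClass A k ∘ₗ muₗ A hk)
    fun ϖ h => isoClass_eq_zero.2 ((muₗ_mem_iff hk hk' ϖ).2 h)

/-- The map `κ : R^k_diff → H^1(𝔍A, ∧^k A)`. -/
def kappa (hk : 1 ≤ k) : RedDiff A k →ₗ[ℝ] H1Jet A k :=
  SubQuot.lift (jetClass A k ∘ₗ charCocycle A hk)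
    fun δ h => jetClass_eq_zero.2 (charCocycle_mem hk δ h)

/-- The map `i^! : R^k_diff → R^k_ρ`. -/
def iShriek (hk : 1 ≤ k) : RedDiff A k →ₗ[ℝ] RedTensors A k :=
  SubQuot.lift (SubQuot.mk _ _ ∘ₗ charTensor A hk)
    fun δ h => SubQuot.mk_eq_zero.2 (charTensor_mem hk δ h)

theorem muMap_injective (hk : 1 ≤ k) (hk' : k ≤ finrank ℝ F) :
    Function.Injective (muMap A hk hk') :=
  SubQuot.lift_injective _ _ fun ϖ h => (muₗ_mem_iff hk hk' ϖ).1 (isoClass_eq_zero.1 h)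

theorem kappa_injective (hk : 1 ≤ k) (hk' : k ≤ finrank ℝ F) :
    Function.Injective (kappa A hk) :=
  SubQuot.lift_injective _ _ fun δ h =>
    (isCharPair_charPair hk δ).exact_of_coboundary hk hk' (jetClass_eq_zero.1 h)

variable {A}

theorem IsCharPair.kappa_mk (hk : 1 ≤ k) (h : IsCharPair A k δ χ ϖ) :
    kappa A hk (SubQuot.mk _ _ δ) = jetClass A k χ :=
  congrArg (jetClass A k) ((isCharPair_charPair hk δ).cocycle_eq h)

theorem IsCharPair.iShriek_mk (hk : 1 ≤ k) (h : IsCharPair A k δ χ ϖ) :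
    iShriek A hk (SubQuot.mk _ _ δ) = SubQuot.mk _ _ ϖ :=
  congrArg (SubQuot.mk _ _) ((isCharPair_charPair hk δ).tensor_eq h)

variable (A k) in
/-- On classes of cocycles, `i^*` is the restriction to `𝔥`. -/
theorem exists_istar_jetClass (χ : Z1Jet A k) :
    ∃ m : Z1Iso A k, m.1 = χ.1 ∘ₗ JetSec.incl ∧ istar A k (jetClass A k χ) = isoClass A k m :=
  ⟨_, rfl, rfl⟩

theorem istar_kappa (hk : 1 ≤ k) (hk' : k ≤ finrank ℝ F) (r : RedDiff A k) :
    istar A k (kappa A hk r) = muMap A hk hk' (iShriek A hk r) := by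
  obtain ⟨δ, rfl⟩ := SubQuot.mk_surjective r
  obtain ⟨m, hm, h⟩ := exists_istar_jetClass A k (charCocycle A hk δ)
  refine h.trans (congrArg (isoClass A k) (Subtype.ext ?_))
  exact hm.trans ((isCharPair_charPair hk δ).restrict.eq (isMu_mu hk _))

/-- Surjectivity onto the fibre product. If the restriction of `χ` to `𝔥` and `μ_ϖ` differ by the
coboundary of `τ`, then `ϖ` may be replaced by `ϖ - D_ρ τ`, after which they agree. -/
theorem exists_redDiff (hk : 1 ≤ k) (hk' : k ≤ finrank ℝ F) {x : H1Jet A k} {y : RedTensors A k}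
    (hxy : istar A k x = muMap A hk hk' y) :
    ∃ r, kappa A hk r = x ∧ iShriek A hk r = y := by
  obtain ⟨χ, rfl⟩ := jetClass_surjective x
  obtain ⟨ϖ, rfl⟩ := SubQuot.mk_surjective y
  obtain ⟨m, hm, h⟩ := exists_istar_jetClass A k χ
  obtain ⟨τ, hτ⟩ := isoClass_eq.1 (h.symm.trans hxy)
  rw [hm] at hτ
  have hmu : χ.1 ∘ₗ JetSec.incl = mu hk (ϖ - exactTensor A τ) := LinearMap.ext fun H => by
    have h1 : χ.1 (JetSec.incl H) - mu hk ϖ H = isoAd A k H τ := hτ H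
    rw [mu_sub, LinearMap.sub_apply, mu_exactTensor, map_neg, sub_neg_eq_add, ← h1,
      LinearMap.comp_apply]
    abel
  have hpair : IsMu (ϖ - exactTensor A τ).1 (χ.1 ∘ₗ JetSec.incl) := hmu ▸ isMu_mu hk _
  obtain ⟨δ, hδ⟩ := exists_differential hk hk' hpair
  refine ⟨SubQuot.mk _ _ δ, hδ.kappa_mk hk, (hδ.iShriek_mk hk).trans (SubQuot.mk_eq_mk.2 ?_)⟩
  have h3 : (ϖ - exactTensor A τ).1 - ϖ.1 = -(exactTensor A τ).1 := by
    rw [Submodule.coe_sub]; abel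
  rw [h3]
  exact Submodule.neg_mem _ (exactTensor_mem τ)

variable (A) in
/-- The isomorphism `β` from `R^k_diff` onto the fibre product. -/
def betaEquiv (hk : 1 ≤ k) (hk' : k ≤ finrank ℝ F) : RedDiff A k ≃ₗ[ℝ]
    LinearMap.eqLocus (istar A k ∘ₗ LinearMap.fst ℝ (H1Jet A k) (RedTensors A k))
      (muMap A hk hk' ∘ₗ LinearMap.snd ℝ (H1Jet A k) (RedTensors A k)) :=
  fibreProductEquiv (kappa A hk) (iShriek A hk) (istar A k) (muMap A hk hk')
    (istar_kappa hk hk') (kappa_injective A hk hk') fun _ _ => exists_redDiff hk hk'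

end Correspondence

end

end LieAlgd

open LieAlgd

theorem theorem4p6 {E : Type*} [NormedAddCommGroup E] [NormedSpace ℝ E] [FiniteDimensional ℝ E]
    {M : Type*} [TopologicalSpace M] [ChartedSpace E M] [IsManifold 𝓘(ℝ, E) ∞ M]
    [T2Space M] [SigmaCompactSpace M]
    {F : Type*} [NormedAddCommGroup F] [NormedSpace ℝ F] [FiniteDimensional ℝ F]
    {V : M → Type*} [TopologicalSpace (TotalSpace F V)] [∀ x, TopologicalSpace (V x)]
    [∀ x, AddCommGroup (V x)] [∀ x, Module ℝ (V x)] [FiberBundle F V] [VectorBundle ℝ F V]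
    [ContMDiffVectorBundle ∞ F V 𝓘(ℝ, E)]
    (A : LieAlgebroid E F V) (k : ℕ) (hk : 1 ≤ k) (hk' : k ≤ finrank ℝ F) :
    (∀ δ : differentials A k, ∃! p : Z1Jet A k × compatTensors A k, IsCharPair A k δ p.1 p.2) ∧
    (∀ (χ : Z1Jet A k) (ϖ : compatTensors A k), IsMu ϖ.1 (χ.1 ∘ₗ JetSec.incl) →
      ∃! δ : differentials A k, IsCharPair A k δ χ ϖ) ∧
    ∃ (μ : RedTensors A k →ₗ[ℝ] H1Iso A k) (κ : RedDiff A k →ₗ[ℝ] H1Jet A k)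
      (ishriek : RedDiff A k →ₗ[ℝ] RedTensors A k),
      (∀ ϖ : compatTensors A k, ∃ m : Z1Iso A k, IsMu ϖ.1 m.1 ∧
        μ (SubQuot.mk _ _ ϖ) = SubQuot.mk _ _ m) ∧
      (∀ (δ : differentials A k) (χ : Z1Jet A k) (ϖ : compatTensors A k), IsCharPair A k δ χ ϖ →
        κ (SubQuot.mk _ _ δ) = SubQuot.mk _ _ χ ∧
        ishriek (SubQuot.mk _ _ δ) = SubQuot.mk _ _ ϖ) ∧
      Function.Injective μ ∧ Function.Injective κ ∧
      (∀ r, istar A k (κ r) = μ (ishriek r)) ∧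
      ∃ β : RedDiff A k ≃ₗ[ℝ]
          LinearMap.eqLocus (istar A k ∘ₗ LinearMap.fst ℝ (H1Jet A k) (RedTensors A k))
            (μ ∘ₗ LinearMap.snd ℝ (H1Jet A k) (RedTensors A k)),
        ∀ r, (β r : H1Jet A k × RedTensors A k) = (κ r, ishriek r) := by
  refine ⟨fun δ => ?_, fun χ ϖ h => ?_, muMap A hk hk', kappa A hk, iShriek A hk, fun ϖ => ?_,
    fun δ χ ϖ h => ⟨h.kappa_mk hk, h.iShriek_mk hk⟩, muMap_injective A hk hk',
    kappa_injective A hk hk', istar_kappa hk hk', betaEquiv A hk hk', fun r => rfl⟩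
  · obtain ⟨χ, ϖ, h⟩ := exists_charPair δ hk
    exact ⟨(χ, ϖ), h, fun p hp => Prod.ext (hp.cocycle_eq h) (hp.tensor_eq h)⟩
  · obtain ⟨δ, hδ⟩ := exists_differential hk hk' h
    exact ⟨δ, hδ, fun δ' hδ' => hδ'.differential_eq hδ⟩
  · exact ⟨muₗ A hk ϖ, isMu_mu hk ϖ, rfl⟩
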